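/- Let $\varphi$ be Euler's function, $\varphi_0(n)=n$ and $\varphi_{k+1}(n)=\varphi(\varphi_k(n))$ for $k\ge 0$, and let $\Phi_k(x,y)$ be the number of positive integers $n\le x$ such that every prime factor of $\varphi_k(n)$ is at most $y$. Let $\pi(x)$ be the number of primes $p\le x$, and $\pi(x;d,1)$ the number of those with $p\equiv 1 \pmod d$. Let $\log_1 u=\log u$ and $\log_{k+1}u=\log(\log_k u)$. Let $\sigma_0=\rho$ be the Dickman function, i.e. the unique continuous function on $[0,\infty)$ with $\rho(u)=1$ for $0\le u\le 1$ and $u\rho'(u)=-\rho(u-1)$ for $u>1$. For $k\ge 0$ let $\sigma_{k+1}$ be the unique continuous function on $[0,\infty)$ with $\sigma_{k+1}(u)=1$ for $0\le u\le 1$ and $$u\,\sigma_{k+1}(u)=\int_0^u \sigma_{k+1}(u-t)\,\sigma_k(t)\,dt\qquad (u\ge 1).$$ Theorem. Assume the following weak form of the Elliott–Halberstam conjecture: for every fixed $\epsilon>0$, $$\sum_{d\le x^{1-\epsilon}}\left|\pi(x;d,1)-\frac{\pi(x)}{\varphi(d)}\right|=o(\pi(x))\qquad (x\to\infty).$$ Then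 the functions $\sigma_k$ exist and are unique, and for every fixed $U>1$ and every integer $k\ge 0$, $$\Phi_k(x,x^{1/u})\sim x\,\sigma_k(u)\qquad\text{as } x\to\infty,\text{ uniformly for } 1\le u\le U.$$ Moreover, as $u\to\infty$, $$\sigma_0(u)=\left(\frac{e+o(1)}{u\log u}\right)^u\qquad\text{and}\qquad \sigma_k(u)=\left(\frac{1+o(1)}{\log_k u\cdot\log_{k+1}u}\right)^u\quad\text{for every fixed } k\ge 1.$$ -/

import Mathlib

open Filter Topology Asymptotics

namespace IteratedTotient

/-- `π(x)`: the number of primes `p ≤ x`. -/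
noncomputable def primePi (x : ℝ) : ℕ := Nat.primeCounting ⌊x⌋₊

/-- `π(x; d, 1)`: the number of primes `p ≤ x` with `p ≡ 1 mod d`. -/
noncomputable def primePiOne (x : ℝ) (d : ℕ) : ℕ :=
  ((Finset.Icc 1 ⌊x⌋₊).filter (fun p => p.Prime ∧ p ≡ 1 [MOD d])).card

/-- The weak Elliott–Halberstam conjecture: for every fixed `ε > 0`,
`∑_{d ≤ x^(1-ε)} |π(x; d, 1) - π(x)/φ(d)| = o(π(x))` as `x → ∞`. -/
def WeakElliottHalberstam : Prop :=
  ∀ ε : ℝ, 0 < ε →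
    (fun x : ℝ => ∑ d ∈ Finset.Icc 1 ⌊x ^ (1 - ε)⌋₊,
        |(primePiOne x d : ℝ) - (primePi x : ℝ) / (Nat.totient d : ℝ)|)
      =o[atTop] (fun x : ℝ => (primePi x : ℝ))

/-- `φ_k`, the `k`-th iterate of Euler's function (`φ_0(n) = n`). -/
def phiIter (k n : ℕ) : ℕ := Nat.totient^[k] n

open Classical in
/-- `Φ_k(x, y)`: the number of positive integers `n ≤ x` such that every prime factor of
`φ_k(n)` is at most `y`. -/
noncomputable def PhiCount (k : ℕ) (x y : ℝ) : ℕ :=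
  ((Finset.Icc 1 ⌊x⌋₊).filter
    (fun n => ∀ p : ℕ, p.Prime → p ∣ phiIter k n → (p : ℝ) ≤ y)).card

/-- `ρ` is (on `[0, ∞)`) the Dickman function: continuous, equal to `1` on `[0, 1]`, and
`u ρ'(u) = -ρ(u - 1)` for `u > 1` (at `u = 1` the function has a corner). -/
structure IsDickman (ρ : ℝ → ℝ) : Prop where
  continuousOn : ContinuousOn ρ (Set.Ici 0)
  eq_one : ∀ u ∈ Set.Icc (0 : ℝ) 1, ρ u = 1
  hasDerivAt : ∀ u : ℝ, 1 < u → HasDerivAt ρ (-ρ (u - 1) / u) u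

/-- `σ` is (on `[0, ∞)`) the continuous solution of the delay integral equation
`u σ(u) = ∫_0^u σ(u - t) χ(t) dt` for `u ≥ 1`, with `σ = 1` on `[0, 1]`. -/
structure IsDelaySolution (χ σ : ℝ → ℝ) : Prop where
  continuousOn : ContinuousOn σ (Set.Ici 0)
  eq_one : ∀ u ∈ Set.Icc (0 : ℝ) 1, σ u = 1
  integral_eq : ∀ u : ℝ, 1 ≤ u → u * σ u = ∫ t in (0 : ℝ)..u, σ (u - t) * χ t

/-- The sequence `σ_0 = ρ, σ_1, σ_2, …`, where `σ_{k+1}` solves the delay integral equation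
with kernel `σ_k`. -/
structure IsSigmaSequence (σ : ℕ → ℝ → ℝ) : Prop where
  zero : IsDickman (σ 0)
  succ : ∀ k : ℕ, IsDelaySolution (σ k) (σ (k + 1))

/-- The `k`-fold iterated logarithm `log_k`. -/
noncomputable def logIter (k : ℕ) (u : ℝ) : ℝ := Real.log^[k] u

end IteratedTotient

/-!
# Smooth values of iterated totients

The functions `σ_k` and the counting functions `Φ_k` are treated by one induction each, and every
step of the induction is a statement about a delay equation
`u σ(u) = ∫_0^u σ(u - t) χ(t) dt` with a kernel `0 ≤ χ ≤ 1`, `χ = 1` on `[0, 1]` (`DelayPair`). The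
Dickman function belongs to the kernel `χ = 1_{[0, 1]}` (`DelayPair.isDickman`), and `σ_{k+1}` to the
kernel `σ_k`, so that uniqueness, positivity and the passage from a kernel to `Φ_k` need no separate
treatment of `k = 0`.

**The delay equation.** After subtracting `1`, the equation is a contraction on bounded continuous
functions with an exponential weight, which gives existence and uniqueness. Decay comes from
comparing `σ` with exponentials: for `s ≥ 0`, at a maximum of `σ(w) e^{sw}` the equation gives
`σ(u) ≤ exp (-s u + s X)` if `∫_0^V χ(t) e^{st} dt ≤ X` for all `V` (`DelayPair.le_exp`), and at a
minimum it gives `σ(u) ≥ (min_{[0,τ]} σ) e^{-su}` if `∫_0^τ χ(t) e^{st} dt > u`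
(`DelayPair.exp_le`). Inserting the asymptotic formula for `log σ_k` into the integrals yields that
for `log σ_{k+1}`.

**Mean values.** Let `f` be completely multiplicative with values in `[0, 1]`, equal to `1` up to `y`.
From `∑ f(n) log n = ∑ Λ(d) f(d) ∑ f(m)` (sum over `d m ≤ x`), the mean value of `f` up to `x` is an
approximate solution, in the variable `log x / log y`, of the delay equation whose kernel is the
density of the weights `Λ(d) f(d) / d`. Stability of the equation gives
`DelayPair.exists_mean_value`.

**Iterated totients.** Outside a negligible set, `φ_{k+1}(n)` is `y`-smooth if and only if
`φ_{k+1}(p) = φ_k(p - 1)` is `y`-smooth for each prime `p ∣ n`: an exception forces `q² ∣ φ_i(n)` for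
some prime `q > y` and some `i ≤ k`, which is rare (`exists_abs_summatory_sub_le`). So `Φ_{k+1}` is
the summatory function of a completely multiplicative indicator function, and its values at primes
have to be known on average, that is, the frequency of the primes `p` with `φ_k(p - 1)` smooth.

**Shifted primes.** Whether `φ_k(n)` is `y`-smooth depends only on the part of `n` composed of primes
exceeding `y = x^{1/u}`. A function of this rough part is a sum, with bounded coefficients, over the
boundedly many rough divisors of `n`. The divisors up to `x^{1-ε}` have the same densities among the
numbers `p - 1` as among the integers, by the Elliott–Halberstam hypothesis. A number with a larger
rough divisor has no prime factor between `x^ε` and a fixed small power of `x`, and by the second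
moment of the number of such prime factors these numbers are few in both sequences. Hence
the frequency of smooth `φ_k(p - 1)` is that of smooth `φ_k(n)` (`exists_transference`), which
is `σ_k` by induction. By partial summation `σ_k` is then the kernel for the next step
(`DelayPair.exists_cdfClose`).
-/

namespace IteratedTotient

open MeasureTheory Set intervalIntegral
open ArithmeticFunction (vonMangoldt)

/-! ### Delay equations -/

/-- The kernels `χ` of the delay equations `u σ(u) = ∫_0^u σ(u - t) χ(t) dt` considered here:
measurable, with values in `[0, 1]`, and equal to `1` on `[0, 1]`. -/
structure IsKernel (χ : ℝ → ℝ) : Prop where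
  measurable : Measurable χ
  nonneg : ∀ t, 0 ≤ χ t
  le_one : ∀ t, χ t ≤ 1
  eq_one : ∀ t ∈ Icc (0 : ℝ) 1, χ t = 1

/-- A delay solution `σ` for the kernel `χ`, extended by `1` to the negative axis, so that it is
continuous on the whole line. The delay equation is required for all `u ≥ 0`; for `u ≤ 1` it says
`u = u`. -/
structure DelayPair (χ σ : ℝ → ℝ) : Prop where
  kernel : IsKernel χ
  continuous : Continuous σ
  eq_one : ∀ u ≤ 1, σ u = 1
  integral_eq : ∀ u, 0 ≤ u → u * σ u = ∫ t in (0 : ℝ)..u, σ (u - t) * χ t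

namespace IsKernel

variable {χ : ℝ → ℝ}

theorem intervalIntegrable_mul (h : IsKernel χ) {g : ℝ → ℝ} (hg : Continuous g) (a b : ℝ) :
    IntervalIntegrable (fun t => g t * χ t) volume a b := by
  refine (hg.intervalIntegrable a b).mono_fun
    (hg.measurable.mul h.measurable).aestronglyMeasurable (Eventually.of_forall fun t => ?_)
  simp only [norm_mul, Real.norm_eq_abs]
  rw [abs_of_nonneg (h.nonneg t)]
  exact mul_le_of_le_one_right (abs_nonneg _) (h.le_one t)

theorem intervalIntegrable (h : IsKernel χ) (a b : ℝ) : IntervalIntegrable χ volume a b := by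
  simpa using h.intervalIntegrable_mul (g := fun _ => 1) continuous_const a b

/-- The kernel whose delay solution is the Dickman function. -/
theorem indicator : IsKernel (Set.indicator (Icc (0 : ℝ) 1) fun _ => 1) where
  measurable := measurable_const.indicator measurableSet_Icc
  nonneg t := Set.indicator_nonneg (fun _ _ => zero_le_one) t
  le_one _ := Set.indicator_apply_le' (fun _ => le_rfl) (fun _ => zero_le_one)
  eq_one _ ht := Set.indicator_of_mem ht _

end IsKernel

theorem integral_exp_mul_sub {s : ℝ} (hs : s ≠ 0) (a b : ℝ) :
    ∫ t in a..b, Real.exp (s * t) = (Real.exp (s * b) - Real.exp (s * a)) / s := by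
  rw [intervalIntegral.integral_comp_mul_left (fun x => Real.exp x) hs, integral_exp, smul_eq_mul]
  field_simp

namespace DelayPair

variable {χ σ : ℝ → ℝ}

/-- The delay equation after the exponential change of scale `σ(w) ↦ σ(w) e^{sw}`. -/
theorem integral_eq_exp (h : DelayPair χ σ) (s : ℝ) {u : ℝ} (hu : 0 ≤ u) :
    u * (σ u * Real.exp (s * u)) =
      ∫ t in (0 : ℝ)..u, (σ (u - t) * Real.exp (s * (u - t))) * (Real.exp (s * t) * χ t) := by
  rw [← mul_assoc, h.integral_eq u hu, ← intervalIntegral.integral_mul_const]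
  refine intervalIntegral.integral_congr fun t _ => ?_
  rw [show s * u = s * (u - t) + s * t by ring, Real.exp_add]; ring

theorem continuous_mul_exp (h : DelayPair χ σ) (s : ℝ) :
    Continuous fun w => σ w * Real.exp (s * w) :=
  h.continuous.mul (by fun_prop)

theorem integral_scaled_le (h : DelayPair χ σ) (s : ℝ) {u M : ℝ} (hu : 0 ≤ u)
    (hM : ∀ w ∈ Icc 0 u, σ w * Real.exp (s * w) ≤ M) :
    u * (σ u * Real.exp (s * u)) ≤ M * ∫ t in (0 : ℝ)..u, Real.exp (s * t) * χ t := by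
  rw [h.integral_eq_exp s hu, ← intervalIntegral.integral_const_mul]
  refine intervalIntegral.integral_mono_on hu ?_ ?_ fun t ht => ?_
  · have hc : Continuous fun t => (σ (u - t) * Real.exp (s * (u - t))) * Real.exp (s * t) :=
      ((h.continuous_mul_exp s).comp (by fun_prop : Continuous fun t : ℝ => u - t)).mul (by fun_prop)
    simpa only [mul_assoc] using h.kernel.intervalIntegrable_mul hc 0 u
  · exact (h.kernel.intervalIntegrable_mul (by fun_prop) 0 u).const_mul M
  · exact mul_le_mul_of_nonneg_right (hM _ ⟨by linarith [ht.2], by linarith [ht.1]⟩)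
      (mul_nonneg (Real.exp_pos _).le (h.kernel.nonneg t))

theorem le_integral_scaled (h : DelayPair χ σ) (s : ℝ) {u m : ℝ} (hu : 0 ≤ u)
    (hm : ∀ w ∈ Icc 0 u, m ≤ σ w * Real.exp (s * w)) :
    m * (∫ t in (0 : ℝ)..u, Real.exp (s * t) * χ t) ≤ u * (σ u * Real.exp (s * u)) := by
  rw [h.integral_eq_exp s hu, ← intervalIntegral.integral_const_mul]
  refine intervalIntegral.integral_mono_on hu ?_ ?_ fun t ht => ?_
  · exact (h.kernel.intervalIntegrable_mul (by fun_prop) 0 u).const_mul m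
  · have hc : Continuous fun t => (σ (u - t) * Real.exp (s * (u - t))) * Real.exp (s * t) :=
      ((h.continuous_mul_exp s).comp (by fun_prop : Continuous fun t : ℝ => u - t)).mul (by fun_prop)
    simpa only [mul_assoc] using h.kernel.intervalIntegrable_mul hc 0 u
  · exact mul_le_mul_of_nonneg_right (hm _ ⟨by linarith [ht.2], by linarith [ht.1]⟩)
      (mul_nonneg (Real.exp_pos _).le (h.kernel.nonneg t))

end DelayPair

theorem IsKernel.integral_exp_neg_le {χ : ℝ → ℝ} (h : IsKernel χ) {K u : ℝ} (hK : 0 < K)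
    (hu : 0 ≤ u) : ∫ t in (0 : ℝ)..u, Real.exp (-K * t) * χ t ≤ 1 / K := by
  have h1 : ∫ t in (0 : ℝ)..u, Real.exp (-K * t) * χ t ≤ ∫ t in (0 : ℝ)..u, Real.exp (-K * t) := by
    refine intervalIntegral.integral_mono_on hu (h.intervalIntegrable_mul (by fun_prop) 0 u)
      ((by fun_prop : Continuous fun t : ℝ => Real.exp (-K * t)).intervalIntegrable 0 u)
      fun t _ => ?_
    exact mul_le_of_le_one_right (Real.exp_pos _).le (h.le_one t)
  refine h1.trans ?_
  rw [integral_exp_mul_sub (neg_ne_zero.mpr hK.ne'), mul_zero, Real.exp_zero, div_neg, ← neg_div,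
    neg_sub]
  gcongr
  linarith [Real.exp_pos (-K * u)]

namespace DelayPair

variable {χ σ : ℝ → ℝ}

theorem nonneg (h : DelayPair χ σ) (u : ℝ) : 0 ≤ σ u := by
  by_contra! hneg
  have hu1 : 1 < u := by
    by_contra! hle
    rw [h.eq_one u hle] at hneg; linarith
  -- a negative minimum of `σ(w) e^{-2w}` would have to lie in `[0, 1/2]`
  obtain ⟨w, hw, hmin⟩ := isCompact_Icc.exists_isMinOn (nonempty_Icc.mpr (by linarith : (0 : ℝ) ≤ u))
    (h.continuous_mul_exp (-2)).continuousOn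
  have hm : σ w * Real.exp (-2 * w) < 0 :=
    (hmin ⟨by linarith, le_rfl⟩).trans_lt (mul_neg_of_neg_of_pos hneg (Real.exp_pos _))
  have h1 := h.le_integral_scaled (-2) hw.1 (m := σ w * Real.exp (-2 * w))
    fun v hv => hmin ⟨hv.1, hv.2.trans hw.2⟩
  have h2 := h.kernel.integral_exp_neg_le two_pos hw.1
  have hw1 : 1 < w := by
    by_contra! hle
    rw [h.eq_one w hle] at hm
    linarith [Real.exp_pos (-2 * w)]
  nlinarith

theorem intervalIntegrable (h : DelayPair χ σ) (u a b : ℝ) :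
    IntervalIntegrable (fun t => σ (u - t) * χ t) volume a b :=
  h.kernel.intervalIntegrable_mul (h.continuous.comp (by fun_prop)) a b

theorem le_one (h : DelayPair χ σ) (u : ℝ) : σ u ≤ 1 := by
  by_contra! hgt
  have hu1 : 1 < u := by
    by_contra! hle
    rw [h.eq_one u hle] at hgt; linarith
  obtain ⟨w, hw, hmax⟩ := isCompact_Icc.exists_isMaxOn (nonempty_Icc.mpr (by linarith : (0 : ℝ) ≤ u))
    h.continuous.continuousOn
  have hM : 1 < σ w := hgt.trans_le (hmax ⟨by linarith, le_rfl⟩)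
  have hw1 : 1 < w := by
    by_contra! hle
    rw [h.eq_one w hle] at hM; linarith
  have h1 := h.integral_eq w hw.1
  have h2 : ∫ t in (0 : ℝ)..w, σ (w - t) * χ t ≤ ∫ t in (0 : ℝ)..w, σ (w - t) :=
    intervalIntegral.integral_mono_on hw.1 (h.intervalIntegrable w 0 w)
      ((h.continuous.comp (by fun_prop : Continuous fun t : ℝ => w - t)).intervalIntegrable 0 w)
      fun t _ => mul_le_of_le_one_right (h.nonneg _) (h.kernel.le_one t)
  rw [intervalIntegral.integral_comp_sub_left (fun t => σ t) w, sub_self, sub_zero,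
    ← intervalIntegral.integral_add_adjacent_intervals (h.continuous.intervalIntegrable 0 1)
      (h.continuous.intervalIntegrable 1 w)] at h2
  have h3 : ∫ t in (0 : ℝ)..1, σ t = 1 := by
    rw [intervalIntegral.integral_congr (g := fun _ => 1) fun t ht => ?_]
    · simp
    · rw [uIcc_of_le zero_le_one] at ht
      exact h.eq_one t ht.2
  have h4 : ∫ t in (1 : ℝ)..w, σ t ≤ ∫ _ in (1 : ℝ)..w, σ w :=
    intervalIntegral.integral_mono_on hw1.le (h.continuous.intervalIntegrable 1 w)
      intervalIntegrable_const fun t ht => hmax ⟨by linarith [ht.1], ht.2.trans hw.2⟩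
  rw [intervalIntegral.integral_const, smul_eq_mul] at h4
  nlinarith

theorem pos (h : DelayPair χ σ) (u : ℝ) : 0 < σ u := by
  -- positivity spreads to the right by half a unit at a time
  have key : ∀ n : ℕ, ∃ c > 0, ∀ v ≤ 1 + (n : ℝ) / 2, c ≤ σ v := by
    intro n
    induction n with
    | zero => exact ⟨1, one_pos, fun v hv => (h.eq_one v (by simpa using hv)).ge⟩
    | succ n ih =>
      obtain ⟨c, hc, hv⟩ := ih
      refine ⟨min c (c / 2 / (1 + (n + 1 : ℝ) / 2)), by positivity, fun v hvn => ?_⟩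
      rcases le_or_gt v (1 + (n : ℝ) / 2) with hle | hgt
      · exact (min_le_left _ _).trans (hv v hle)
      refine (min_le_right _ _).trans ?_
      push_cast at hvn
      have hn : (0 : ℝ) ≤ n := n.cast_nonneg
      have hv1 : 1 < v := by linarith
      have h1 := h.integral_eq v (by linarith)
      have hnn : ∀ t, 0 ≤ σ (v - t) * χ t := fun t => mul_nonneg (h.nonneg _) (h.kernel.nonneg t)
      have h2 : ∫ t in (1 / 2 : ℝ)..1, σ (v - t) * χ t ≤ ∫ t in (0 : ℝ)..v, σ (v - t) * χ t :=
        intervalIntegral.integral_mono_interval (by norm_num) (by norm_num) hv1.le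
          (Eventually.of_forall hnn) (h.intervalIntegrable v 0 v)
      have h3 : ∫ _ in (1 / 2 : ℝ)..1, c ≤ ∫ t in (1 / 2 : ℝ)..1, σ (v - t) * χ t :=
        intervalIntegral.integral_mono_on (by norm_num) intervalIntegrable_const
          (h.intervalIntegrable v _ _) fun t ht => by
            rw [h.kernel.eq_one t ⟨by linarith [ht.1], ht.2⟩, mul_one]
            exact hv _ (by linarith [ht.1])
      rw [intervalIntegral.integral_const, smul_eq_mul] at h3
      rw [div_le_iff₀ (by positivity)]
      nlinarith [h.nonneg v]
  obtain ⟨n, hn⟩ := exists_nat_gt (2 * u)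
  obtain ⟨c, hc, hv⟩ := key n
  exact hc.trans_le (hv u (by linarith))

theorem isKernel (h : DelayPair χ σ) : IsKernel σ :=
  ⟨h.continuous.measurable, h.nonneg, h.le_one, fun t ht => h.eq_one t ht.2⟩

/-- **Upper bound for delay solutions.** The maximum of `σ(w) e^{sw}` over an initial interval is
attained at some `w ≤ X`, because there `w · max ≤ max · ∫ e^{st} χ(t) dt`. -/
theorem le_exp (h : DelayPair χ σ) {s X u : ℝ} (hs : 0 ≤ s) (hu : 0 ≤ u)
    (hX : ∀ V, 0 ≤ V → ∫ t in (0 : ℝ)..V, Real.exp (s * t) * χ t ≤ X) :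
    σ u ≤ Real.exp (s * X - s * u) := by
  obtain ⟨w, hw, hmax⟩ := isCompact_Icc.exists_isMaxOn (nonempty_Icc.mpr hu)
    (h.continuous_mul_exp s).continuousOn
  have h1 := h.integral_scaled_le s hw.1 (M := σ w * Real.exp (s * w))
    fun v hv => hmax ⟨hv.1, hv.2.trans hw.2⟩
  have hM : 0 < σ w * Real.exp (s * w) := mul_pos (h.pos w) (Real.exp_pos _)
  have hwX : w ≤ X := by
    refine le_trans ?_ (hX w hw.1)
    rw [mul_comm] at h1
    exact le_of_mul_le_mul_left h1 hM
  have h2 : σ u * Real.exp (s * u) ≤ σ w * Real.exp (s * w) := hmax ⟨hu, le_rfl⟩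
  rw [Real.exp_sub, le_div_iff₀ (Real.exp_pos _)]
  refine h2.trans ((mul_le_of_le_one_left (Real.exp_pos _).le (h.le_one w)).trans ?_)
  exact Real.exp_le_exp.mpr (mul_le_mul_of_nonneg_left hwX hs)

/-- **Lower bound for delay solutions.** If `∫_0^τ e^{st} χ(t) dt > u`, then the minimum of
`σ(w) e^{sw}` over `[0, u]` is attained at some `w < τ`. -/
theorem exp_le (h : DelayPair χ σ) {s τ u c : ℝ} (hs : 0 ≤ s) (hu : 0 ≤ u) (hτ : 0 ≤ τ)
    (hX : u < ∫ t in (0 : ℝ)..τ, Real.exp (s * t) * χ t) (hc : ∀ w ∈ Icc 0 τ, c ≤ σ w) :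
    c * Real.exp (-(s * u)) ≤ σ u := by
  obtain ⟨w, hw, hmin⟩ := isCompact_Icc.exists_isMinOn (nonempty_Icc.mpr hu)
    (h.continuous_mul_exp s).continuousOn
  have h1 := h.le_integral_scaled s hw.1 (m := σ w * Real.exp (s * w))
    fun v hv => hmin ⟨hv.1, hv.2.trans hw.2⟩
  have hm : 0 < σ w * Real.exp (s * w) := mul_pos (h.pos w) (Real.exp_pos _)
  have hwτ : w < τ := by
    by_contra! hle
    have h2 : ∫ t in (0 : ℝ)..τ, Real.exp (s * t) * χ t ≤ ∫ t in (0 : ℝ)..w, Real.exp (s * t) * χ t :=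
      intervalIntegral.integral_mono_interval le_rfl hτ hle
        (Eventually.of_forall fun t => mul_nonneg (Real.exp_pos _).le (h.kernel.nonneg t))
        (h.kernel.intervalIntegrable_mul (by fun_prop) 0 w)
    rw [mul_comm w] at h1
    have := le_of_mul_le_mul_left h1 hm
    linarith [hw.2]
  have h2 : σ w * Real.exp (s * w) ≤ σ u * Real.exp (s * u) := hmin ⟨hu, le_rfl⟩
  rw [Real.exp_neg, ← div_eq_mul_inv, div_le_iff₀ (Real.exp_pos _)]
  refine le_trans ?_ h2
  refine (hc w ⟨hw.1, hwτ.le⟩).trans (le_mul_of_one_le_right (h.nonneg w) ?_)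
  exact Real.one_le_exp (mul_nonneg hs hw.1)

/-- Uniqueness of delay solutions, by a Gronwall argument with the weight `e^{-2u}`. -/
theorem unique {σ' : ℝ → ℝ} (h : DelayPair χ σ) (h' : DelayPair χ σ') : σ = σ' := by
  funext u
  rcases le_or_gt u 1 with hu | hu
  · rw [h.eq_one u hu, h'.eq_one u hu]
  let e : ℝ → ℝ := fun w => |σ w - σ' w| * Real.exp (-2 * w)
  have hec : Continuous e := (h.continuous.sub h'.continuous).abs.mul (by fun_prop)
  obtain ⟨w, hw, hmax⟩ := isCompact_Icc.exists_isMaxOn (nonempty_Icc.mpr (by linarith : (0 : ℝ) ≤ u))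
    hec.continuousOn
  have hM0 : 0 ≤ e w := mul_nonneg (abs_nonneg _) (Real.exp_pos _).le
  have hew : e w = 0 := by
    by_contra hne
    have hpos : 0 < e w := lt_of_le_of_ne hM0 (Ne.symm hne)
    have hw1 : 1 < w := by
      by_contra! hle
      apply hne
      simp [e, h.eq_one w hle, h'.eq_one w hle]
    have h1 : w * (σ w - σ' w) = ∫ t in (0 : ℝ)..w, (σ (w - t) - σ' (w - t)) * χ t := by
      rw [mul_sub, h.integral_eq w hw.1, h'.integral_eq w hw.1,
        ← intervalIntegral.integral_sub (h.intervalIntegrable w 0 w) (h'.intervalIntegrable w 0 w)]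
      simp only [sub_mul]
    have h2 : w * |σ w - σ' w| ≤ ∫ t in (0 : ℝ)..w, |σ (w - t) - σ' (w - t)| * χ t := by
      calc w * |σ w - σ' w| = |w * (σ w - σ' w)| := by rw [abs_mul, abs_of_nonneg hw.1]
        _ ≤ ∫ t in (0 : ℝ)..w, |(σ (w - t) - σ' (w - t)) * χ t| := by
            rw [h1]; exact intervalIntegral.abs_integral_le_integral_abs hw.1
        _ = _ := by simp only [abs_mul, abs_of_nonneg (h.kernel.nonneg _)]
    have h3 : ∫ t in (0 : ℝ)..w, |σ (w - t) - σ' (w - t)| * χ t ≤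
        ∫ t in (0 : ℝ)..w, (e w * Real.exp (2 * w)) * (Real.exp (-2 * t) * χ t) := by
      refine intervalIntegral.integral_mono_on hw.1 ?_ ?_ fun t ht => ?_
      · exact h.kernel.intervalIntegrable_mul
          ((h.continuous.comp (by fun_prop)).sub (h'.continuous.comp (by fun_prop))).abs 0 w
      · exact (h.kernel.intervalIntegrable_mul (by fun_prop) 0 w).const_mul _
      · have h4 : |σ (w - t) - σ' (w - t)| * Real.exp (-2 * (w - t)) ≤ e w :=
          hmax ⟨by linarith [ht.2], by linarith [ht.1, hw.2]⟩
        rw [← mul_assoc]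
        refine mul_le_mul_of_nonneg_right ?_ (h.kernel.nonneg t)
        have : |σ (w - t) - σ' (w - t)| =
            (|σ (w - t) - σ' (w - t)| * Real.exp (-2 * (w - t))) * Real.exp (2 * w) *
              Real.exp (-2 * t) := by
          rw [mul_assoc, mul_assoc, ← Real.exp_add, ← Real.exp_add]
          ring_nf; simp
        rw [this]
        gcongr
    rw [intervalIntegral.integral_const_mul] at h3
    have h5 := h.kernel.integral_exp_neg_le two_pos hw.1
    have h6 : w * e w ≤ e w * (1 / 2) := by
      have : w * |σ w - σ' w| ≤ (e w * Real.exp (2 * w)) * (1 / 2) :=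
        h2.trans (h3.trans (mul_le_mul_of_nonneg_left h5 (by positivity)))
      calc w * e w = (w * |σ w - σ' w|) * Real.exp (-2 * w) := by simp only [e]; ring
        _ ≤ (e w * Real.exp (2 * w)) * (1 / 2) * Real.exp (-2 * w) := by gcongr
        _ = e w * (1 / 2) * (Real.exp (2 * w) * Real.exp (-2 * w)) := by ring
        _ = e w * (1 / 2) := by rw [← Real.exp_add]; simp
    nlinarith
  have : e u ≤ 0 := hew ▸ hmax ⟨by linarith, le_rfl⟩
  have h7 : |σ u - σ' u| ≤ 0 := by
    by_contra! hlt
    exact absurd this (not_le.mpr (mul_pos hlt (Real.exp_pos _)))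
  exact sub_eq_zero.mp (abs_nonpos_iff.mp h7)

end DelayPair

namespace IsKernel

variable {χ : ℝ → ℝ}

open BoundedContinuousFunction

theorem intervalIntegrable_mul_exp (h : IsKernel χ) {g : ℝ → ℝ} (hg : Continuous g)
    (s v a b : ℝ) :
    IntervalIntegrable (fun t => g (v - t) * (Real.exp (s * t) * χ t)) volume a b := by
  have := h.intervalIntegrable_mul (g := fun t => g (v - t) * Real.exp (s * t)) (by fun_prop) a b
  simpa only [mul_assoc] using this

/-- The integral operator whose fixed point `g` gives the delay solution `1 + e^{2v} g(v)`. -/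
noncomputable def delayOp (χ : ℝ → ℝ) (g : ℝ → ℝ) (v : ℝ) : ℝ :=
  (Real.exp (-2 * v) * (∫ t in (0 : ℝ)..v, (χ t - 1)) +
    ∫ t in (0 : ℝ)..(v - 1), g (v - t) * (Real.exp (-2 * t) * χ t)) / v

theorem continuous_delayOp (h : IsKernel χ) (g : ℝ →ᵇ ℝ) :
    Continuous fun u => delayOp χ g (max u 1) := by
  have h1 : Continuous fun v : ℝ => ∫ t in (0 : ℝ)..v, (χ t - 1) :=
    intervalIntegral.continuous_primitive
      (fun a b => (h.intervalIntegrable a b).sub intervalIntegrable_const) 0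
  have h2 : Continuous fun p : ℝ × ℝ =>
      ∫ t in (0 : ℝ)..p.2, g (p.1 - t) * (Real.exp (-2 * t) * χ t) := by
    rw [continuous_iff_continuousAt]
    rintro ⟨x₀, b₀⟩
    obtain ⟨a, ha⟩ := exists_lt (min 0 b₀)
    obtain ⟨b, hb⟩ := exists_gt (max 0 b₀)
    rw [lt_min_iff] at ha
    rw [max_lt_iff] at hb
    refine intervalIntegral.continuousAt_parametric_primitive_of_dominated (μ := volume)
      (F := fun x t : ℝ => g (x - t) * (Real.exp (-2 * t) * χ t))
      (fun t => ‖g‖ * (Real.exp (-2 * t) * χ t)) a b (fun x => ?_) ?_ ?_ ?_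
      ⟨ha.1, hb.1⟩ ⟨ha.2, hb.2⟩ Real.volume_singleton
    · have := h.measurable
      have hg := g.continuous.measurable
      exact Measurable.aestronglyMeasurable (by fun_prop)
    · refine Eventually.of_forall fun x => Eventually.of_forall fun t => ?_
      have h0 : 0 ≤ Real.exp (-2 * t) * χ t := mul_nonneg (Real.exp_pos _).le (h.nonneg t)
      rw [norm_mul, Real.norm_of_nonneg h0]
      exact mul_le_mul_of_nonneg_right (g.norm_coe_le_norm _) h0
    · exact (h.intervalIntegrable_mul (by fun_prop) a b).const_mul _
    · refine Eventually.of_forall fun t => ?_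
      have hg := g.continuous
      exact Continuous.continuousAt (by fun_prop)
  have h3 : Continuous fun v : ℝ => ∫ t in (0 : ℝ)..(v - 1), g (v - t) * (Real.exp (-2 * t) * χ t) :=
    h2.comp (by fun_prop : Continuous fun v : ℝ => (v, v - 1))
  have hm : Continuous fun u : ℝ => max u 1 := by fun_prop
  refine Continuous.div₀ ?_ hm fun u => ?_
  · exact (((by fun_prop : Continuous fun v : ℝ => Real.exp (-2 * v)).mul h1).add h3).comp hm
  · exact (zero_lt_one.trans_le (le_max_right u 1)).ne'

theorem abs_integral_le_half (h : IsKernel χ) {g : ℝ → ℝ} (hg : Continuous g) {C v w : ℝ}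
    (hC : 0 ≤ C) (hgC : ∀ x, |g x| ≤ C) (hw : 0 ≤ w) :
    |∫ t in (0 : ℝ)..w, g (v - t) * (Real.exp (-2 * t) * χ t)| ≤ C / 2 := by
  calc |∫ t in (0 : ℝ)..w, g (v - t) * (Real.exp (-2 * t) * χ t)|
      ≤ ∫ t in (0 : ℝ)..w, |g (v - t) * (Real.exp (-2 * t) * χ t)| :=
        intervalIntegral.abs_integral_le_integral_abs hw
    _ ≤ ∫ t in (0 : ℝ)..w, C * (Real.exp (-2 * t) * χ t) := by
        refine intervalIntegral.integral_mono_on hw ?_ ?_ fun t _ => ?_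
        · exact (h.intervalIntegrable_mul_exp hg _ _ 0 w).abs
        · exact (h.intervalIntegrable_mul (by fun_prop) 0 w).const_mul C
        · have h0 : 0 ≤ Real.exp (-2 * t) * χ t := mul_nonneg (Real.exp_pos _).le (h.nonneg t)
          rw [abs_mul, abs_of_nonneg h0]
          exact mul_le_mul_of_nonneg_right (hgC _) h0
    _ ≤ C * (1 / 2) := by
        rw [intervalIntegral.integral_const_mul]
        exact mul_le_mul_of_nonneg_left (h.integral_exp_neg_le two_pos hw) hC
    _ = C / 2 := by ring

theorem abs_delayOp_le (h : IsKernel χ) (g : ℝ →ᵇ ℝ) {v : ℝ} (hv : 1 ≤ v) :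
    |delayOp χ g v| ≤ 1 + ‖g‖ := by
  have hv0 : 0 < v := by linarith
  have h1 : |∫ t in (0 : ℝ)..v, (χ t - 1)| ≤ v := by
    have := intervalIntegral.norm_integral_le_of_norm_le_const (a := 0) (b := v)
      (f := fun t => χ t - 1) (C := 1) fun t _ => by
        rw [Real.norm_eq_abs, abs_le]; constructor <;> linarith [h.nonneg t, h.le_one t]
    simpa [abs_of_pos hv0] using this
  have h2 := h.abs_integral_le_half g.continuous (v := v) (norm_nonneg g)
    (fun x => g.norm_coe_le_norm x) (sub_nonneg.mpr hv)
  rw [delayOp, abs_div, abs_of_pos hv0, div_le_iff₀ hv0]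
  refine (abs_add_le _ _).trans ?_
  rw [abs_mul, abs_of_pos (Real.exp_pos _)]
  have h3 : Real.exp (-2 * v) ≤ 1 := Real.exp_le_one_iff.mpr (by linarith)
  nlinarith [norm_nonneg g, abs_nonneg (∫ t in (0 : ℝ)..v, (χ t - 1)), Real.exp_pos (-2 * v)]

/-- Existence of delay solutions, by the contraction principle in a weighted sup norm. -/
theorem exists_delayPair (h : IsKernel χ) : ∃ σ, DelayPair χ σ := by
  let T : (ℝ →ᵇ ℝ) → (ℝ →ᵇ ℝ) := fun g =>
    BoundedContinuousFunction.ofNormedAddCommGroup (fun u => delayOp χ g (max u 1))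
      (h.continuous_delayOp g) (1 + ‖g‖) fun u => h.abs_delayOp_le g (le_max_right u 1)
  have hT : ContractingWith (1 / 2) T := by
    refine ⟨by norm_num, LipschitzWith.of_dist_le_mul fun f g => ?_⟩
    rw [BoundedContinuousFunction.dist_le (by positivity)]
    intro u
    have hv : 1 ≤ max u 1 := le_max_right u 1
    change dist (delayOp χ f (max u 1)) (delayOp χ g (max u 1)) ≤ _
    generalize max u 1 = v at hv
    have hint : ∀ g : ℝ →ᵇ ℝ, IntervalIntegrable
        (fun t => g (v - t) * (Real.exp (-2 * t) * χ t)) volume 0 (v - 1) := fun g =>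
      h.intervalIntegrable_mul_exp g.continuous _ _ _ _
    have h1 : delayOp χ f v - delayOp χ g v =
        (∫ t in (0 : ℝ)..(v - 1), (f - g) (v - t) * (Real.exp (-2 * t) * χ t)) / v := by
      simp only [BoundedContinuousFunction.coe_sub, Pi.sub_apply, sub_mul]
      rw [intervalIntegral.integral_sub (hint f) (hint g), delayOp, delayOp]
      ring
    have h2 := h.abs_integral_le_half (f - g).continuous (v := v) (norm_nonneg (f - g))
      (fun x => (f - g).norm_coe_le_norm x) (sub_nonneg.mpr hv)
    rw [Real.dist_eq, h1, abs_div, abs_of_pos (by linarith : 0 < v), dist_eq_norm,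
      div_le_iff₀ (by linarith)]
    refine h2.trans ?_
    have := norm_nonneg (f - g)
    push_cast
    nlinarith
  let g := ContractingWith.fixedPoint T hT
  have hg : ∀ u, delayOp χ g (max u 1) = g u := fun u =>
    DFunLike.congr_fun (ContractingWith.fixedPoint_isFixedPt hT) u
  have hχ1 : ∫ t in (0 : ℝ)..1, (χ t - 1) = 0 := by
    rw [intervalIntegral.integral_congr (g := fun _ => 0) fun t ht => ?_]
    · simp
    · rw [uIcc_of_le zero_le_one] at ht
      simp [h.eq_one t ht]
  have hg0 : ∀ u ≤ 1, g u = 0 := fun u hu => by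
    rw [← hg u, max_eq_right hu, delayOp, hχ1]; simp
  have hgc := g.continuous
  let σ : ℝ → ℝ := fun v => 1 + Real.exp (2 * v) * g v
  have hσc : Continuous σ := by fun_prop
  refine ⟨σ, h, hσc, fun u hu => by simp [σ, hg0 u hu], fun u hu => ?_⟩
  have hsplit : ∫ t in (0 : ℝ)..u, σ (u - t) * χ t = (∫ t in (0 : ℝ)..u, χ t) +
      Real.exp (2 * u) * ∫ t in (0 : ℝ)..u, g (u - t) * (Real.exp (-2 * t) * χ t) := by
    rw [← intervalIntegral.integral_const_mul, ← intervalIntegral.integral_add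
      (h.intervalIntegrable 0 u)]
    · refine intervalIntegral.integral_congr fun t _ => ?_
      simp only [σ]
      rw [show 2 * (u - t) = 2 * u + -2 * t by ring, Real.exp_add]; ring
    · exact (h.intervalIntegrable_mul_exp hgc _ _ 0 u).const_mul _
  rw [hsplit]
  rcases le_or_gt u 1 with hu1 | hu1
  · have h1 : ∫ t in (0 : ℝ)..u, χ t = u := by
      rw [intervalIntegral.integral_congr (g := fun _ => 1) fun t ht => ?_]
      · simp
      · rw [uIcc_of_le hu] at ht
        exact h.eq_one t ⟨ht.1, ht.2.trans hu1⟩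
    have h2 : ∫ t in (0 : ℝ)..u, g (u - t) * (Real.exp (-2 * t) * χ t) = 0 := by
      rw [intervalIntegral.integral_congr (g := fun _ => 0) fun t ht => ?_]
      · simp
      · rw [uIcc_of_le hu] at ht
        simp [hg0 (u - t) (by linarith [ht.1])]
    rw [h1, h2]
    simp [σ, hg0 u hu1]
  · have hu0 : 0 < u := by linarith
    have h1 := hg u
    rw [max_eq_left hu1.le, delayOp, div_eq_iff hu0.ne'] at h1
    have h2 : ∫ t in (0 : ℝ)..u, g (u - t) * (Real.exp (-2 * t) * χ t) =
        ∫ t in (0 : ℝ)..(u - 1), g (u - t) * (Real.exp (-2 * t) * χ t) := by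
      have hint : ∀ a b, IntervalIntegrable
          (fun t => g (u - t) * (Real.exp (-2 * t) * χ t)) volume a b :=
        h.intervalIntegrable_mul_exp hgc _ _
      rw [← intervalIntegral.integral_add_adjacent_intervals (hint 0 (u - 1)) (hint (u - 1) u)]
      rw [intervalIntegral.integral_congr (a := u - 1) (g := fun _ => 0) fun t ht => ?_]
      · simp
      · rw [uIcc_of_le (by linarith)] at ht
        simp [hg0 (u - t) (by linarith [ht.1])]
    rw [h2]
    have h3 : ∫ t in (0 : ℝ)..u, (χ t - 1) = (∫ t in (0 : ℝ)..u, χ t) - u := by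
      rw [intervalIntegral.integral_sub (h.intervalIntegrable 0 u) intervalIntegrable_const]
      simp
    rw [h3] at h1
    have h4 : Real.exp (2 * u) * Real.exp (-2 * u) = 1 := by rw [← Real.exp_add]; simp
    simp only [σ]
    linear_combination Real.exp (2 * u) * (-h1) + ((∫ t in (0 : ℝ)..u, χ t) - u) * h4

end IsKernel

/-! ### The sequence `σ_k` -/

theorem integral_indicator_kernel (σ : ℝ → ℝ) {u : ℝ} (hu : 1 ≤ u) :
    ∫ t in (0 : ℝ)..u, σ (u - t) * Set.indicator (Icc (0 : ℝ) 1) (fun _ => 1) t =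
      ∫ t in (u - 1)..u, σ t := by
  have h1 : (fun t => σ (u - t) * Set.indicator (Icc (0 : ℝ) 1) (fun _ => (1 : ℝ)) t) =
      Set.indicator (Icc (0 : ℝ) 1) (fun t => σ (u - t)) := by
    funext t
    by_cases ht : t ∈ Icc (0 : ℝ) 1 <;> simp [ht]
  rw [h1, intervalIntegral.integral_of_le (by linarith), ← integral_Icc_eq_integral_Ioc,
    setIntegral_indicator measurableSet_Icc,
    Set.inter_eq_right.mpr (Icc_subset_Icc_right hu), integral_Icc_eq_integral_Ioc,
    ← intervalIntegral.integral_of_le zero_le_one, intervalIntegral.integral_comp_sub_left]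
  simp

/-- The delay solution for the kernel `1_{[0,1]}` is the Dickman function. -/
theorem DelayPair.isDickman {σ : ℝ → ℝ}
    (h : DelayPair (Set.indicator (Icc (0 : ℝ) 1) fun _ => 1) σ) : IsDickman σ where
  continuousOn := h.continuous.continuousOn
  eq_one u hu := h.eq_one u hu.2
  hasDerivAt u hu := by
    have hu0 : u ≠ 0 := by positivity
    let F : ℝ → ℝ := fun v => ∫ t in (0 : ℝ)..v, σ t
    have hF : ∀ v, HasDerivAt F (σ v) v := fun v =>
      intervalIntegral.integral_hasDerivAt_right (h.continuous.intervalIntegrable _ _)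
        (h.continuous.stronglyMeasurableAtFilter _ _) h.continuous.continuousAt
    have h1 : ∀ v, 1 ≤ v → σ v = (F v - F (v - 1)) / v := fun v hv => by
      rw [eq_div_iff (by positivity), mul_comm, h.integral_eq v (by linarith),
        integral_indicator_kernel σ hv, intervalIntegral.integral_interval_sub_left
          (h.continuous.intervalIntegrable _ _) (h.continuous.intervalIntegrable _ _)]
    have h2 : HasDerivAt (fun v => (F v - F (v - 1)) / v)
        (((σ u - σ (u - 1)) * u - (F u - F (u - 1)) * 1) / u ^ 2) u :=
      ((hF u).sub ((hF (u - 1)).comp_sub_const u 1)).div (hasDerivAt_id u) hu0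
    have h3 := h2.congr_of_eventuallyEq (f₁ := σ)
      ((eventually_ge_nhds hu).mono fun v hv => h1 v hv)
    refine h3.congr_deriv ?_
    have h4 := h1 u hu.le
    rw [eq_div_iff hu0] at h4
    rw [← h4]
    field_simp
    ring

/-- The extension of a function on `[0, ∞)` to the line by its value at `0`. -/
def extendLeft (σ : ℝ → ℝ) (u : ℝ) : ℝ := σ (max u 0)

theorem extendLeft_of_nonneg (σ : ℝ → ℝ) {u : ℝ} (hu : 0 ≤ u) : extendLeft σ u = σ u := by
  rw [extendLeft, max_eq_left hu]

theorem continuous_extendLeft {σ : ℝ → ℝ} (h : ContinuousOn σ (Ici 0)) :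
    Continuous (extendLeft σ) :=
  h.comp_continuous (by fun_prop) fun u => le_max_right u 0

theorem extendLeft_of_le_one {σ : ℝ → ℝ} (h : ∀ u ∈ Icc (0 : ℝ) 1, σ u = 1) {u : ℝ} (hu : u ≤ 1) :
    extendLeft σ u = 1 :=
  h _ ⟨le_max_right u 0, max_le hu zero_le_one⟩

theorem IsDickman.delayPair {ρ : ℝ → ℝ} (h : IsDickman ρ) :
    DelayPair (Set.indicator (Icc (0 : ℝ) 1) fun _ => 1) (extendLeft ρ) := by
  have hc := continuous_extendLeft h.continuousOn
  have h1 : ∀ u ≤ 1, extendLeft ρ u = 1 := fun u hu => extendLeft_of_le_one h.eq_one hu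
  refine ⟨IsKernel.indicator, hc, h1, fun u hu => ?_⟩
  rcases le_or_gt u 1 with hu1 | hu1
  · rw [h1 u hu1, mul_one, intervalIntegral.integral_congr (g := fun _ => 1) fun t ht => ?_]
    · simp
    · rw [uIcc_of_le hu] at ht
      have ht1 : t ∈ Icc (0 : ℝ) 1 := ⟨ht.1, ht.2.trans hu1⟩
      rw [h1 _ (by linarith [ht.1]), Set.indicator_of_mem ht1, mul_one]
  rw [integral_indicator_kernel _ hu1.le]
  -- both sides have the same derivative and agree at `u = 1`
  let F : ℝ → ℝ := fun v => ∫ t in (0 : ℝ)..v, extendLeft ρ t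
  have hF : ∀ v, HasDerivAt F (extendLeft ρ v) v := fun v =>
    intervalIntegral.integral_hasDerivAt_right (hc.intervalIntegrable _ _)
      (hc.stronglyMeasurableAtFilter _ _) hc.continuousAt
  let G : ℝ → ℝ := fun v => v * extendLeft ρ v - (F v - F (v - 1))
  have hFc : Continuous F := continuous_iff_continuousAt.mpr fun v => (hF v).continuousAt
  have hG : ContinuousOn G (Icc 1 u) := by
    apply Continuous.continuousOn
    fun_prop
  have hG1 : G 1 = 0 := by
    have : F 1 = 1 := by
      simp only [F]
      rw [intervalIntegral.integral_congr (g := fun _ => 1) fun t ht => ?_]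
      · simp
      · rw [uIcc_of_le zero_le_one] at ht
        exact h1 t ht.2
    simp [G, this, F, h1 1 le_rfl]
  have hconst : G u = G 1 := by
    have hd : ∀ v ∈ Ioo 1 u, HasDerivAt G 0 v := fun v hv => by
      have hv0 : v ≠ 0 := by linarith [hv.1]
      have e1 : HasDerivAt (extendLeft ρ) (-ρ (v - 1) / v) v :=
        (h.hasDerivAt v hv.1).congr_of_eventuallyEq
          ((eventually_ge_nhds (by linarith [hv.1] : (0 : ℝ) < v)).mono fun w hw =>
            extendLeft_of_nonneg ρ hw)
      have e2 := ((hasDerivAt_id v).mul e1).sub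
        ((hF v).sub ((hF (v - 1)).comp_sub_const v 1))
      refine e2.congr_deriv ?_
      rw [extendLeft_of_nonneg ρ (by linarith [hv.1] : (0 : ℝ) ≤ v - 1)]
      simp only [id]
      field_simp
      ring
    obtain ⟨c, hc1, hc2⟩ := exists_hasDerivAt_eq_slope G (fun _ => 0) hu1 hG hd
    have hne : u - 1 ≠ 0 := by linarith
    rw [eq_div_iff hne, zero_mul] at hc2
    linarith
  rw [hG1] at hconst
  have := intervalIntegral.integral_interval_sub_left (μ := volume) (f := extendLeft ρ)
    (hc.intervalIntegrable 0 u) (hc.intervalIntegrable 0 (u - 1))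
  simp only [G, F] at hconst
  linarith

theorem IsDelaySolution.delayPair {χ σ : ℝ → ℝ} (h : IsDelaySolution χ σ)
    (hχ : IsKernel (extendLeft χ)) : DelayPair (extendLeft χ) (extendLeft σ) := by
  have h1 : ∀ u ≤ 1, extendLeft σ u = 1 := fun u hu => extendLeft_of_le_one h.eq_one hu
  refine ⟨hχ, continuous_extendLeft h.continuousOn, h1, fun u hu => ?_⟩
  rcases le_or_gt u 1 with hu1 | hu1
  · rw [h1 u hu1, mul_one, intervalIntegral.integral_congr (g := fun _ => 1) fun t ht => ?_]
    · simp
    · rw [uIcc_of_le hu] at ht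
      rw [h1 _ (by linarith [ht.1]), hχ.eq_one t ⟨ht.1, ht.2.trans hu1⟩, mul_one]
  · rw [extendLeft_of_nonneg σ hu, h.integral_eq u hu1.le]
    refine intervalIntegral.integral_congr fun t ht => ?_
    rw [uIcc_of_le hu] at ht
    rw [extendLeft_of_nonneg σ (by linarith [ht.2]), extendLeft_of_nonneg χ ht.1]

/-- The kernel of the delay equation for `σ_k`: the indicator of `[0, 1]` for `k = 0`, and
`σ_{k-1}` for `k ≥ 1`. -/
noncomputable def sigmaKernel (σ : ℕ → ℝ → ℝ) : ℕ → ℝ → ℝ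
  | 0 => Set.indicator (Icc (0 : ℝ) 1) fun _ => 1
  | k + 1 => extendLeft (σ k)

theorem IsSigmaSequence.delayPair {σ : ℕ → ℝ → ℝ} (h : IsSigmaSequence σ) (k : ℕ) :
    DelayPair (sigmaKernel σ k) (extendLeft (σ k)) := by
  induction k with
  | zero => exact h.zero.delayPair
  | succ k ih => exact (h.succ k).delayPair ih.isKernel

theorem exists_isSigmaSequence : ∃ σ, IsSigmaSequence σ := by
  let S : ℕ → {σ : ℝ → ℝ // IsKernel σ} := fun k => k.rec
    ⟨_, IsKernel.indicator.exists_delayPair.choose_spec.isKernel⟩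
    fun _ s => ⟨_, s.2.exists_delayPair.choose_spec.isKernel⟩
  refine ⟨fun k => (S k).1, IsKernel.indicator.exists_delayPair.choose_spec.isDickman, fun k => ?_⟩
  have h : DelayPair (S k).1 (S (k + 1)).1 := (S k).2.exists_delayPair.choose_spec
  exact ⟨h.continuous.continuousOn, fun u hu => h.eq_one u hu.2,
    fun u hu => h.integral_eq u (by linarith)⟩

theorem IsSigmaSequence.eqOn {σ τ : ℕ → ℝ → ℝ} (hσ : IsSigmaSequence σ) (hτ : IsSigmaSequence τ)
    (k : ℕ) : EqOn (σ k) (τ k) (Ici 0) := by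
  have key : extendLeft (σ k) = extendLeft (τ k) := by
    induction k with
    | zero => exact (hσ.delayPair 0).unique (hτ.delayPair 0)
    | succ k ih =>
      have h1 := hσ.delayPair (k + 1)
      have h2 := hτ.delayPair (k + 1)
      rw [sigmaKernel] at h1 h2
      rw [← ih] at h2
      exact h1.unique h2
  intro u hu
  rw [← extendLeft_of_nonneg (σ k) hu, key, extendLeft_of_nonneg (τ k) hu]

/-! ### Decay of the Dickman function -/

/-- A strict supersolution `e^{-f}` of `u w(u) = ∫_{u-1}^u w` dominates the Dickman function. -/
theorem dickman_le_of_supersolution {σ f : ℝ → ℝ} {a : ℝ}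
    (h : DelayPair (Set.indicator (Icc (0 : ℝ) 1) fun _ => 1) σ) (ha : 1 ≤ a)
    (hf : ContinuousOn f (Ici (a - 1)))
    (hw : ∀ u, a ≤ u → ∫ t in (u - 1)..u, Real.exp (-f t) < u * Real.exp (-f u)) :
    ∃ C, 0 < C ∧ ∀ u, a ≤ u → σ u ≤ C * Real.exp (-f u) := by
  have hcont : ∀ V, ContinuousOn (fun w => σ w * Real.exp (f w)) (Icc (a - 1) V) := fun V =>
    h.continuous.continuousOn.mul (hf.mono Icc_subset_Ici_self).rexp
  obtain ⟨b, hb, hbmax⟩ := isCompact_Icc.exists_isMaxOn (nonempty_Icc.mpr (by linarith)) (hcont a)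
  refine ⟨σ b * Real.exp (f b), mul_pos (h.pos b) (Real.exp_pos _), fun u hu => ?_⟩
  obtain ⟨w, hwm, hwmax⟩ := isCompact_Icc.exists_isMaxOn (nonempty_Icc.mpr (by linarith)) (hcont u)
  have hwa : w ≤ a := by
    by_contra! hlt
    have h1 := h.integral_eq w (by linarith)
    rw [integral_indicator_kernel σ (by linarith)] at h1
    have hwc : ContinuousOn (fun t => Real.exp (-f t)) (Icc (w - 1) w) :=
      (hf.mono fun x hx => show a - 1 ≤ x by linarith [hx.1]).neg.rexp
    have h2 : ∫ t in (w - 1)..w, σ t ≤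
        ∫ t in (w - 1)..w, (σ w * Real.exp (f w)) * Real.exp (-f t) := by
      refine intervalIntegral.integral_mono_on (by linarith) (h.continuous.intervalIntegrable _ _)
        ((hwc.intervalIntegrable_of_Icc (by linarith)).const_mul _) fun t ht => ?_
      have h3 : σ t * Real.exp (f t) ≤ σ w * Real.exp (f w) :=
        hwmax ⟨by linarith [ht.1], by linarith [ht.2, hwm.2]⟩
      calc σ t = σ t * Real.exp (f t) * Real.exp (-f t) := by
            rw [mul_assoc, ← Real.exp_add]; simp
        _ ≤ _ := by gcongr
    rw [intervalIntegral.integral_const_mul] at h2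
    have h4 := mul_lt_mul_of_pos_left (hw w hlt.le) (mul_pos (h.pos w) (Real.exp_pos (f w)))
    have h5 : σ w * Real.exp (f w) * (w * Real.exp (-f w)) = w * σ w := by
      have : Real.exp (f w) * Real.exp (-f w) = 1 := by rw [← Real.exp_add]; simp
      linear_combination w * σ w * this
    linarith
  have h6 : σ u * Real.exp (f u) ≤ σ b * Real.exp (f b) :=
    (hwmax ⟨by linarith, le_rfl⟩).trans (hbmax ⟨hwm.1, hwa⟩)
  calc σ u = σ u * Real.exp (f u) * Real.exp (-f u) := by
        rw [mul_assoc, ← Real.exp_add]; simp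
    _ ≤ _ := by gcongr

/-- The Dickman function dominates a strict subsolution `e^{-f}` of `u w(u) = ∫_{u-1}^u w`. -/
theorem le_dickman_of_subsolution {σ f : ℝ → ℝ} {a : ℝ}
    (h : DelayPair (Set.indicator (Icc (0 : ℝ) 1) fun _ => 1) σ) (ha : 1 ≤ a)
    (hf : ContinuousOn f (Ici (a - 1)))
    (hw : ∀ u, a ≤ u → u * Real.exp (-f u) < ∫ t in (u - 1)..u, Real.exp (-f t)) :
    ∃ C, 0 < C ∧ ∀ u, a ≤ u → C * Real.exp (-f u) ≤ σ u := by
  have hcont : ∀ V, ContinuousOn (fun w => σ w * Real.exp (f w)) (Icc (a - 1) V) := fun V =>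
    h.continuous.continuousOn.mul (hf.mono Icc_subset_Ici_self).rexp
  obtain ⟨b, hb, hbmin⟩ := isCompact_Icc.exists_isMinOn (nonempty_Icc.mpr (by linarith)) (hcont a)
  refine ⟨σ b * Real.exp (f b), mul_pos (h.pos b) (Real.exp_pos _), fun u hu => ?_⟩
  obtain ⟨w, hwm, hwmin⟩ := isCompact_Icc.exists_isMinOn (nonempty_Icc.mpr (by linarith)) (hcont u)
  have hwa : w ≤ a := by
    by_contra! hlt
    have h1 := h.integral_eq w (by linarith)
    rw [integral_indicator_kernel σ (by linarith)] at h1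
    have hwc : ContinuousOn (fun t => Real.exp (-f t)) (Icc (w - 1) w) :=
      (hf.mono fun x hx => show a - 1 ≤ x by linarith [hx.1]).neg.rexp
    have h2 : ∫ t in (w - 1)..w, (σ w * Real.exp (f w)) * Real.exp (-f t) ≤
        ∫ t in (w - 1)..w, σ t := by
      refine intervalIntegral.integral_mono_on (by linarith)
        ((hwc.intervalIntegrable_of_Icc (by linarith)).const_mul _)
        (h.continuous.intervalIntegrable _ _) fun t ht => ?_
      have h3 : σ w * Real.exp (f w) ≤ σ t * Real.exp (f t) :=
        hwmin ⟨by linarith [ht.1], by linarith [ht.2, hwm.2]⟩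
      calc _ ≤ σ t * Real.exp (f t) * Real.exp (-f t) := by gcongr
        _ = σ t := by rw [mul_assoc, ← Real.exp_add]; simp
    rw [intervalIntegral.integral_const_mul] at h2
    have h4 := mul_lt_mul_of_pos_left (hw w hlt.le) (mul_pos (h.pos w) (Real.exp_pos (f w)))
    have h5 : σ w * Real.exp (f w) * (w * Real.exp (-f w)) = w * σ w := by
      have : Real.exp (f w) * Real.exp (-f w) = 1 := by rw [← Real.exp_add]; simp
      linear_combination w * σ w * this
    linarith
  have h6 : σ b * Real.exp (f b) ≤ σ u * Real.exp (f u) :=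
    (hbmin ⟨hwm.1, hwa⟩ : _ ≤ σ w * Real.exp (f w)).trans (hwmin ⟨by linarith, le_rfl⟩)
  calc _ ≤ σ u * Real.exp (f u) * Real.exp (-f u) := by gcongr
    _ = σ u := by rw [mul_assoc, ← Real.exp_add]; simp

theorem integral_exp_linear {D : ℝ} (hD : D ≠ 0) (c u : ℝ) :
    ∫ t in (u - 1)..u, Real.exp (-(c - D * (u - t))) = Real.exp (-c) * ((Real.exp D - 1) / D) := by
  have : ∀ t : ℝ, Real.exp (-(c - D * (u - t))) = Real.exp (-c + D * u) * Real.exp (-D * t) := by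
    intro t; rw [← Real.exp_add]; ring_nf
  simp only [this]
  rw [intervalIntegral.integral_const_mul, integral_exp_mul_sub (neg_ne_zero.mpr hD),
    show -D * (u - 1) = -D * u + D by ring, Real.exp_add, Real.exp_add]
  have e : Real.exp (D * u) * Real.exp (-(D * u)) = 1 := by rw [← Real.exp_add]; simp
  field_simp
  linear_combination (Real.exp D - 1) * e

/-- The exponent `u (log u + log log u - 1 + c)`, which governs the decay of the Dickman function
for `c = 0`. -/
noncomputable def dickmanExponent (c u : ℝ) : ℝ :=
  u * (Real.log u + Real.log (Real.log u) - 1 + c)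

theorem hasDerivAt_dickmanExponent (c : ℝ) {u : ℝ} (hu : 1 < u) :
    HasDerivAt (dickmanExponent c)
      (Real.log u + Real.log (Real.log u) + c + (Real.log u)⁻¹) u := by
  have h0 : u ≠ 0 := by positivity
  have h1 : Real.log u ≠ 0 := (Real.log_pos hu).ne'
  have e1 := Real.hasDerivAt_log h0
  have e2 := (hasDerivAt_id u).mul (((e1.add (e1.log h1)).sub_const 1).add_const c)
  refine e2.congr_deriv ?_
  simp only [id, Pi.add_apply]
  field_simp
  ring

theorem tendsto_sub_one_atTop : Tendsto (fun u : ℝ => u - 1) atTop atTop :=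
  tendsto_atTop_add_const_right _ _ tendsto_id

/-- The function `exp (-u (log u + log log u - 1 - ε))` is eventually a supersolution of the delay
equation for the indicator kernel, so a multiple of it dominates the solution. -/
theorem dickman_upper {σ : ℝ → ℝ} (h : DelayPair (Set.indicator (Icc (0 : ℝ) 1) fun _ => 1) σ)
    {ε : ℝ} (hε : 0 < ε) : ∃ C, 0 < C ∧ ∀ᶠ u in atTop, σ u ≤ C * Real.exp (-dickmanExponent (-ε) u) := by
  have h1 : ∀ᶠ u : ℝ in atTop, (Real.log (u - 1))⁻¹ ≤ ε :=
    (tendsto_inv_atTop_zero.comp (Real.tendsto_log_atTop.comp tendsto_sub_one_atTop)).eventually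
      (eventually_le_nhds hε)
  have h2 : ∀ᶠ u : ℝ in atTop, ε ≤ Real.log (Real.log u) :=
    (Real.tendsto_log_atTop.comp Real.tendsto_log_atTop).eventually_ge_atTop ε
  obtain ⟨a, ha⟩ := eventually_atTop.mp (h1.and (h2.and (eventually_ge_atTop (3 : ℝ))))
  have ha3 : 3 ≤ a := (ha a le_rfl).2.2
  refine (dickman_le_of_supersolution h (f := dickmanExponent (-ε)) (a := a)
    (by linarith) (fun u (hu : a - 1 ≤ u) =>
      (hasDerivAt_dickmanExponent (-ε) (by linarith)).continuousAt.continuousWithinAt)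
    fun u hu => ?_).imp fun C hC => ⟨hC.1, (eventually_ge_atTop a).mono hC.2⟩
  obtain ⟨hu1, hu2, hu3⟩ := ha u hu
  set D := Real.log u + Real.log (Real.log u) + -ε + (Real.log (u - 1))⁻¹ with hD
  have hlog1 : 0 < Real.log (u - 1) := Real.log_pos (by linarith)
  have hlogu : 0 < Real.log u := Real.log_pos (by linarith)
  have hDlog : Real.log u ≤ D := by have := inv_pos.mpr hlog1; linarith
  have hDpos : 0 < D := hlogu.trans_le hDlog
  have hlin : ∀ t ∈ Icc (u - 1) u,
      dickmanExponent (-ε) u - D * (u - t) ≤ dickmanExponent (-ε) t := fun t ht => by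
    rcases eq_or_lt_of_le ht.2 with rfl | htu
    · simp
    obtain ⟨c, hc, hslope⟩ := exists_hasDerivAt_eq_slope (dickmanExponent (-ε))
      (fun u => Real.log u + Real.log (Real.log u) + -ε + (Real.log u)⁻¹) htu
      (fun x hx => (hasDerivAt_dickmanExponent (-ε)
        (by linarith [hx.1, ht.1])).continuousAt.continuousWithinAt)
      fun x hx => hasDerivAt_dickmanExponent (-ε) (by linarith [hx.1, ht.1])
    rw [eq_div_iff (by linarith)] at hslope
    have hcu : u - 1 < c := by linarith [hc.1, ht.1]
    have hlogc : 0 < Real.log c := Real.log_pos (by linarith)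
    have e1 : Real.log c ≤ Real.log u := Real.log_le_log (by linarith) hc.2.le
    have e2 : Real.log (Real.log c) ≤ Real.log (Real.log u) := Real.log_le_log hlogc e1
    have e3 : (Real.log c)⁻¹ ≤ (Real.log (u - 1))⁻¹ :=
      inv_anti₀ hlog1 (Real.log_le_log (by linarith) hcu.le)
    have : (Real.log c + Real.log (Real.log c) + -ε + (Real.log c)⁻¹) * (u - t) ≤ D * (u - t) :=
      mul_le_mul_of_nonneg_right (by linarith) (by linarith)
    linarith
  have hcw : ContinuousOn (fun t => Real.exp (-dickmanExponent (-ε) t)) (Icc (u - 1) u) :=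
    ContinuousOn.rexp (ContinuousOn.neg fun x hx => (hasDerivAt_dickmanExponent (-ε)
        (by linarith [hx.1])).continuousAt.continuousWithinAt)
  calc ∫ t in (u - 1)..u, Real.exp (-dickmanExponent (-ε) t)
      ≤ ∫ t in (u - 1)..u, Real.exp (-(dickmanExponent (-ε) u - D * (u - t))) :=
        intervalIntegral.integral_mono_on (by linarith)
          (hcw.intervalIntegrable_of_Icc (by linarith))
          (Continuous.intervalIntegrable (by fun_prop) _ _)
          fun t ht => Real.exp_le_exp.mpr (neg_le_neg (hlin t ht))
    _ = Real.exp (-dickmanExponent (-ε) u) * ((Real.exp D - 1) / D) :=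
        integral_exp_linear hDpos.ne' _ _
    _ < Real.exp (-dickmanExponent (-ε) u) * u := by
        refine mul_lt_mul_of_pos_left ?_ (Real.exp_pos _)
        rw [div_lt_iff₀ hDpos]
        have e4 : Real.exp D ≤ u * Real.log u := by
          have : D ≤ Real.log u + Real.log (Real.log u) := by linarith
          calc Real.exp D ≤ Real.exp (Real.log u + Real.log (Real.log u)) := Real.exp_le_exp.mpr this
            _ = u * Real.log u := by
              rw [Real.exp_add, Real.exp_log (by linarith), Real.exp_log hlogu]
        nlinarith
    _ = u * Real.exp (-dickmanExponent (-ε) u) := mul_comm _ _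

/-- The function `exp (-u (log u + log log u - 1 + ε))` is eventually a subsolution of the delay
equation for the indicator kernel, so the solution dominates a multiple of it. -/
theorem dickman_lower {σ : ℝ → ℝ} (h : DelayPair (Set.indicator (Icc (0 : ℝ) 1) fun _ => 1) σ)
    {ε : ℝ} (hε : 0 < ε) : ∃ C, 0 < C ∧ ∀ᶠ u in atTop, C * Real.exp (-dickmanExponent ε u) ≤ σ u := by
  have hlim : Tendsto (fun v : ℝ => (1 + v⁻¹) *
      (1 + (Real.log (Real.log v) / Real.log v + ε * (Real.log v)⁻¹)) + v⁻¹ * (Real.log v)⁻¹)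
      atTop (𝓝 ((1 + 0) * (1 + (0 + ε * 0)) + 0 * 0)) := by
    have e1 : Tendsto (fun v : ℝ => (Real.log v)⁻¹) atTop (𝓝 0) :=
      tendsto_inv_atTop_zero.comp Real.tendsto_log_atTop
    have e2 : Tendsto (fun v : ℝ => Real.log (Real.log v) / Real.log v) atTop (𝓝 0) :=
      Real.isLittleO_log_id_atTop.tendsto_div_nhds_zero.comp Real.tendsto_log_atTop
    exact ((tendsto_const_nhds.add tendsto_inv_atTop_zero).mul
      (tendsto_const_nhds.add (e2.add (e1.const_mul ε)))).add (tendsto_inv_atTop_zero.mul e1)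
  have h1 : ∀ᶠ v : ℝ in atTop, (1 + v⁻¹) *
      (1 + (Real.log (Real.log v) / Real.log v + ε * (Real.log v)⁻¹)) + v⁻¹ * (Real.log v)⁻¹ <
        Real.exp ε :=
    hlim.eventually (eventually_lt_nhds (by simpa using Real.one_lt_exp_iff.mpr hε))
  have h2 : ∀ᶠ u : ℝ in atTop, 0 ≤ Real.log (Real.log (u - 1)) :=
    ((Real.tendsto_log_atTop.comp Real.tendsto_log_atTop).comp
      tendsto_sub_one_atTop).eventually_ge_atTop 0
  obtain ⟨a, ha⟩ := eventually_atTop.mp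
    ((tendsto_sub_one_atTop.eventually h1).and (h2.and (eventually_ge_atTop (3 : ℝ))))
  have ha3 : 3 ≤ a := (ha a le_rfl).2.2
  refine (le_dickman_of_subsolution h (f := dickmanExponent ε) (a := a)
    (by linarith) (fun u (hu : a - 1 ≤ u) =>
      (hasDerivAt_dickmanExponent ε (by linarith)).continuousAt.continuousWithinAt)
    fun u hu => ?_).imp fun C hC => ⟨hC.1, (eventually_ge_atTop a).mono hC.2⟩
  obtain ⟨hu1, hu2, hu3⟩ := ha u hu
  set D := Real.log (u - 1) + Real.log (Real.log (u - 1)) + ε with hD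
  have hlog1 : 0 < Real.log (u - 1) := Real.log_pos (by linarith)
  have hDpos : 0 < D := by linarith
  have hlin : ∀ t ∈ Icc (u - 1) u,
      dickmanExponent ε t ≤ dickmanExponent ε u - D * (u - t) := fun t ht => by
    rcases eq_or_lt_of_le ht.2 with rfl | htu
    · simp
    obtain ⟨c, hc, hslope⟩ := exists_hasDerivAt_eq_slope (dickmanExponent ε)
      (fun u => Real.log u + Real.log (Real.log u) + ε + (Real.log u)⁻¹) htu
      (fun x hx => (hasDerivAt_dickmanExponent ε
        (by linarith [hx.1, ht.1])).continuousAt.continuousWithinAt)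
      fun x hx => hasDerivAt_dickmanExponent ε (by linarith [hx.1, ht.1])
    rw [eq_div_iff (by linarith)] at hslope
    have hcu : u - 1 < c := by linarith [hc.1, ht.1]
    have e1 : Real.log (u - 1) ≤ Real.log c := Real.log_le_log (by linarith) hcu.le
    have e2 : Real.log (Real.log (u - 1)) ≤ Real.log (Real.log c) := Real.log_le_log hlog1 e1
    have e3 : 0 < (Real.log c)⁻¹ := inv_pos.mpr (hlog1.trans_le e1)
    have : D * (u - t) ≤ (Real.log c + Real.log (Real.log c) + ε + (Real.log c)⁻¹) * (u - t) :=
      mul_le_mul_of_nonneg_right (by linarith) (by linarith)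
    linarith
  have hcw : ContinuousOn (fun t => Real.exp (-dickmanExponent ε t)) (Icc (u - 1) u) :=
    ContinuousOn.rexp (ContinuousOn.neg fun x hx => (hasDerivAt_dickmanExponent ε
        (by linarith [hx.1])).continuousAt.continuousWithinAt)
  calc u * Real.exp (-dickmanExponent ε u) = Real.exp (-dickmanExponent ε u) * u := mul_comm _ _
    _ < Real.exp (-dickmanExponent ε u) * ((Real.exp D - 1) / D) := by
        refine mul_lt_mul_of_pos_left ?_ (Real.exp_pos _)
        rw [lt_div_iff₀ hDpos]
        have e4 : Real.exp D = (u - 1) * Real.log (u - 1) * Real.exp ε := by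
          rw [hD, Real.exp_add, Real.exp_add, Real.exp_log (by linarith), Real.exp_log hlog1]
        have hv : 0 < u - 1 := by linarith
        have e5 := mul_lt_mul_of_pos_left hu1 (mul_pos hv hlog1)
        rw [← e4] at e5
        have e6 : (u - 1) * Real.log (u - 1) * ((1 + (u - 1)⁻¹) *
            (1 + (Real.log (Real.log (u - 1)) / Real.log (u - 1) + ε * (Real.log (u - 1))⁻¹)) +
              (u - 1)⁻¹ * (Real.log (u - 1))⁻¹) = u * D + 1 := by
          rw [hD]; field_simp; ring
        linarith
    _ = ∫ t in (u - 1)..u, Real.exp (-(dickmanExponent ε u - D * (u - t))) :=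
        (integral_exp_linear hDpos.ne' _ _).symm
    _ ≤ ∫ t in (u - 1)..u, Real.exp (-dickmanExponent ε t) :=
        intervalIntegral.integral_mono_on (by linarith)
          (Continuous.intervalIntegrable (by fun_prop) _ _)
          (hcw.intervalIntegrable_of_Icc (by linarith))
          fun t ht => Real.exp_le_exp.mpr (neg_le_neg (hlin t ht))

theorem tendsto_log_dickman {σ : ℝ → ℝ}
    (h : DelayPair (Set.indicator (Icc (0 : ℝ) 1) fun _ => 1) σ) :
    Tendsto (fun u => Real.log (σ u) / u + (Real.log u + Real.log (Real.log u) - 1)) atTop (𝓝 0) := by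
  rw [Metric.tendsto_nhds]
  intro ε hε
  obtain ⟨C, hC, hup⟩ := dickman_upper h (half_pos hε)
  obtain ⟨c, hc, hlow⟩ := dickman_lower h (half_pos hε)
  have hC0 : ∀ᶠ u : ℝ in atTop, Real.log C / u < ε / 2 :=
    (tendsto_const_nhds.div_atTop tendsto_id).eventually (eventually_lt_nhds (half_pos hε))
  have hc0 : ∀ᶠ u : ℝ in atTop, -(ε / 2) < Real.log c / u :=
    (tendsto_const_nhds.div_atTop tendsto_id).eventually
      (eventually_gt_nhds (neg_lt_zero.mpr (half_pos hε)))
  filter_upwards [hup, hlow, hC0, hc0, eventually_gt_atTop 0] with u h1 h2 h3 h4 hu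
  have e1 := Real.log_le_log (h.pos u) h1
  have e2 := Real.log_le_log (mul_pos hc (Real.exp_pos _)) h2
  rw [Real.log_mul hC.ne' (Real.exp_pos _).ne', Real.log_exp, dickmanExponent] at e1
  rw [Real.log_mul hc.ne' (Real.exp_pos _).ne', Real.log_exp, dickmanExponent] at e2
  rw [div_lt_iff₀ hu] at h3
  rw [lt_div_iff₀ hu] at h4
  rw [dist_zero_right, Real.norm_eq_abs, abs_lt]
  set A := Real.log u + Real.log (Real.log u) - 1
  have e3 : Real.log (σ u) / u * u = Real.log (σ u) := div_mul_cancel₀ _ hu.ne'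
  constructor <;> nlinarith

/-! ### Decay of the further delay solutions -/

theorem DelayPair.exp_neg_sq_le {χ σ : ℝ → ℝ} (h : DelayPair χ σ) {τ w : ℝ} (hτ : 1 ≤ τ)
    (hw : w ∈ Icc 0 τ) : Real.exp (-(2 * τ ^ 2)) ≤ σ w := by
  have hint : ∫ t in (0 : ℝ)..1, Real.exp (2 * τ * t) * χ t = (Real.exp (2 * τ) - 1) / (2 * τ) := by
    rw [intervalIntegral.integral_congr (g := fun t => Real.exp (2 * τ * t)) fun t ht => ?_]
    · rw [integral_exp_mul_sub (by positivity)]; simp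
    · rw [uIcc_of_le zero_le_one] at ht
      simp only
      rw [h.kernel.eq_one t ht, mul_one]
  have h1 := h.exp_le (s := 2 * τ) (τ := 1) (u := w) (c := 1) (by positivity) hw.1 zero_le_one ?_
    fun v hv => (h.eq_one v hv.2).ge
  · rw [one_mul] at h1
    refine le_trans (Real.exp_le_exp.mpr ?_) h1
    nlinarith [hw.2]
  · rw [hint, lt_div_iff₀ (by positivity)]
    have := Real.quadratic_le_exp_of_nonneg (by positivity : 0 ≤ 2 * τ)
    nlinarith [hw.2, hw.1]

/-- Passing lower bounds through the delay equation: if `χ(t) ≥ e^{-t(φ(t) + o(1))}`, and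
`φ(t) + 1/A ≤ ψ(u) + ε` for `t` near `A log u`, then `σ(u) ≥ e^{-u(ψ(u) + o(1))}`. -/
theorem DelayPair.lower_step {χ σ φ ψ : ℝ → ℝ} (h : DelayPair χ σ)
    (hχ : ∀ ε > 0, ∀ᶠ t in atTop, Real.exp (-(t * (φ t + ε))) ≤ χ t)
    (hφψ : ∀ ε > 0, ∃ A > 0, ∀ᶠ u in atTop,
      ∀ t ∈ Icc (A * Real.log u) (A * Real.log u + 1), φ t + 1 / A ≤ ψ u + ε)
    (hψ : ∀ᶠ u in atTop, 0 ≤ ψ u) {ε : ℝ} (hε : 0 < ε) :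
    ∀ᶠ u in atTop, Real.exp (-(u * (ψ u + ε))) ≤ σ u := by
  have hε4 : 0 < ε / 4 := by positivity
  obtain ⟨A, hA, hAev⟩ := hφψ (ε / 4) hε4
  obtain ⟨T, hT⟩ := eventually_atTop.mp (hχ (ε / 4) hε4)
  have hAlog : Tendsto (fun u : ℝ => A * Real.log u) atTop atTop :=
    Real.tendsto_log_atTop.const_mul_atTop hA
  have hlittle : ∀ᶠ u : ℝ in atTop, 2 * (A * Real.log u + 1) ^ 2 ≤ ε / 4 * u := by
    have h1 : (fun u : ℝ => 2 * (A * Real.log u + 1) ^ 2) =o[atTop] fun u : ℝ => u := by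
      have e1 : (fun u : ℝ => Real.log u ^ 2) =o[atTop] fun u : ℝ => u := by
        simpa using! Real.isLittleO_pow_log_id_atTop (n := 2)
      have e2 : (fun u : ℝ => Real.log u) =o[atTop] fun u : ℝ => u := Real.isLittleO_log_id_atTop
      have e3 : (fun _ : ℝ => (2 : ℝ)) =o[atTop] fun u : ℝ => u := isLittleO_const_id_atTop 2
      refine (((e1.const_mul_left (2 * A ^ 2)).add (e2.const_mul_left (4 * A))).add e3).congr_left
        fun u => by ring
    filter_upwards [h1.bound hε4, eventually_ge_atTop 0] with u hu hu0
    rw [Real.norm_of_nonneg (by positivity), Real.norm_of_nonneg hu0] at hu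
    exact hu
  filter_upwards [hAev, hAlog.eventually_ge_atTop T, hAlog.eventually_ge_atTop 1, hlittle, hψ,
    eventually_gt_atTop 0] with u h1 h2 h3 h4 h5 hu
  set a := A * Real.log u with ha
  set s := ψ u + 3 * (ε / 4) with hs
  have hs0 : 0 ≤ s := by positivity
  have hint : u < ∫ t in (0 : ℝ)..(a + 1), Real.exp (s * t) * χ t := by
    have hii := h.kernel.intervalIntegrable_mul
      (by fun_prop : Continuous fun t : ℝ => Real.exp (s * t))
    have e1 : ∫ t in a..(a + 1), Real.exp (s * t) * χ t ≤
        ∫ t in (0 : ℝ)..(a + 1), Real.exp (s * t) * χ t :=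
      intervalIntegral.integral_mono_interval (by linarith) (by linarith) le_rfl
        (Eventually.of_forall fun t => mul_nonneg (Real.exp_pos _).le (h.kernel.nonneg t)) (hii 0 _)
    have e2 : ∫ _ in a..(a + 1), u * Real.exp (ε / 4) ≤
        ∫ t in a..(a + 1), Real.exp (s * t) * χ t := by
      refine intervalIntegral.integral_mono_on (by linarith) intervalIntegrable_const (hii _ _)
        fun t ht => ?_
      have e3 := h1 t ht
      have e4 := hT t (h2.trans ht.1)
      calc u * Real.exp (ε / 4) = Real.exp (Real.log u + ε / 4) := by
            rw [Real.exp_add, Real.exp_log hu]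
        _ ≤ Real.exp (s * t + -(t * (φ t + ε / 4))) := by
            refine Real.exp_le_exp.mpr ?_
            have e5 : a * (1 / A + ε / 4) ≤ t * (s - (φ t + ε / 4)) :=
              mul_le_mul ht.1 (by linarith) (by positivity) (by linarith [ht.1])
            have e6 : a * (1 / A) = Real.log u := by rw [ha]; field_simp
            nlinarith
        _ ≤ _ := by
            rw [Real.exp_add]
            exact mul_le_mul_of_nonneg_left e4 (Real.exp_pos _).le
    rw [intervalIntegral.integral_const] at e2
    have e7 : u < u * Real.exp (ε / 4) := lt_mul_of_one_lt_right hu (Real.one_lt_exp_iff.mpr hε4)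
    simp only [add_sub_cancel_left, one_smul] at e2
    linarith
  have h6 := h.exp_le hs0 hu.le (by linarith : 0 ≤ a + 1) hint
    fun w hw => h.exp_neg_sq_le (by linarith) hw
  refine le_trans ?_ h6
  rw [← Real.exp_add]
  refine Real.exp_le_exp.mpr ?_
  rw [hs]
  nlinarith

/-- Passing upper bounds through the delay equation: if `χ(t) ≤ e^{-t(φ(t) + o(1))}`, and
`t (ψ(u) - ε - φ(t)) ≤ (1 - δ) log u` for all large `t`, then `σ(u) ≤ e^{-u(ψ(u) + o(1))}`. -/
theorem DelayPair.upper_step {χ σ φ ψ : ℝ → ℝ} (h : DelayPair χ σ)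
    (hχ : ∀ ε > 0, ∀ᶠ t in atTop, χ t ≤ Real.exp (-(t * (φ t - ε))))
    (hφψ : ∀ ε > 0, ∃ δ > 0, ∃ t₀ : ℝ, ∀ᶠ u in atTop,
      ∀ t ≥ t₀, t * (ψ u - ε - φ t) ≤ (1 - δ) * Real.log u)
    (hψ : Tendsto ψ atTop atTop) (hψ2 : ∀ᶠ u in atTop, ψ u ≤ 2 * Real.log (Real.log u))
    {ε : ℝ} (hε : 0 < ε) :
    ∀ᶠ u in atTop, σ u ≤ Real.exp (-(u * (ψ u - ε))) := by
  have hε4 : 0 < ε / 4 := by positivity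
  obtain ⟨δ, hδ, t₀, hev⟩ := hφψ (ε / 4) hε4
  obtain ⟨T', hT'⟩ := eventually_atTop.mp (hχ (ε / 4) hε4)
  set T := max (max T' t₀) 0 with hTdef
  have hT0 : 0 ≤ T := le_max_right _ _
  have hT : ∀ t ≥ T, χ t ≤ Real.exp (-(t * (φ t - ε / 4))) := fun t ht =>
    hT' t (((le_max_left _ _).trans (le_max_left _ _)).trans ht)
  have hlittle : ∀ᶠ u : ℝ in atTop, 2 * Real.log (Real.log u) *
      ((Real.log u ^ (2 * T) + Real.exp ((1 - δ) * Real.log u)) / (ε / 4)) ≤ ε / 4 * u := by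
    -- in terms of `z = log u`
    have h1 : (fun z : ℝ => 2 * Real.log z * ((z ^ (2 * T) + Real.exp ((1 - δ) * z)) / (ε / 4)))
        =o[atTop] fun z : ℝ => Real.exp z := by
      have e1 : (fun z : ℝ => Real.log z * z ^ (2 * T)) =o[atTop] fun z : ℝ => Real.exp z := by
        have := (Real.isLittleO_log_id_atTop.isBigO.mul (isBigO_refl (fun z : ℝ => z ^ (2 * T))
          atTop)).trans_isLittleO (g := fun z => id z * z ^ (2 * T)) (k := Real.exp) ?_
        · exact this
        · have e3 := isLittleO_rpow_exp_atTop (2 * T + 1)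
          refine e3.congr' ?_ EventuallyEq.rfl
          filter_upwards [eventually_gt_atTop 0] with z hz
          rw [Real.rpow_add hz, Real.rpow_one, id, mul_comm]
      have e2 : (fun z : ℝ => Real.log z * Real.exp ((1 - δ) * z)) =o[atTop]
          fun z : ℝ => Real.exp z := by
        have e3 : (fun z : ℝ => Real.log z) =o[atTop] fun z : ℝ => Real.exp (δ * z) :=
          Real.isLittleO_log_id_atTop.trans
            ((isLittleO_pow_exp_pos_mul_atTop 1 hδ).congr_left fun z => pow_one z)
        refine (e3.mul_isBigO (isBigO_refl (fun z : ℝ => Real.exp ((1 - δ) * z)) atTop)).congr_right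
          fun z => ?_
        rw [← Real.exp_add]; ring_nf
      refine ((e1.add e2).const_mul_left (2 / (ε / 4))).congr_left fun z => ?_
      field_simp
    have h2 := Real.tendsto_log_atTop.eventually (h1.bound hε4)
    filter_upwards [h2, eventually_gt_atTop 0] with u hu hu0
    rw [Real.norm_of_nonneg (Real.exp_pos _).le, Real.exp_log hu0] at hu
    exact (le_abs_self _).trans hu
  filter_upwards [hev, hlittle, hψ.eventually_ge_atTop (3 * (ε / 4)), hψ2,
    eventually_gt_atTop 0, Real.tendsto_log_atTop.eventually_gt_atTop 1]
    with u h1 h2 h3 h4 hu hlog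
  set s := ψ u - 3 * (ε / 4) with hs
  have hs0 : 0 ≤ s := by linarith
  set B := Real.log u ^ (2 * T) + Real.exp ((1 - δ) * Real.log u) with hB
  have hlogpos : 0 < Real.log u := by linarith
  have hllpos : 0 < Real.log (Real.log u) := Real.log_pos hlog
  have hB0 : 0 < B := by positivity
  have hpt : ∀ t ≥ 0, Real.exp (s * t) * χ t ≤ B * Real.exp (-(ε / 4) * t) := fun t ht => by
    rcases le_total T t with hTt | htT
    · have e1 := h1 t (((le_max_right _ _).trans (le_max_left _ _)).trans hTt)
      calc Real.exp (s * t) * χ t ≤ Real.exp (s * t) * Real.exp (-(t * (φ t - ε / 4))) :=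
            mul_le_mul_of_nonneg_left (hT t hTt) (Real.exp_pos _).le
        _ ≤ Real.exp ((1 - δ) * Real.log u) * Real.exp (-(ε / 4) * t) := by
            rw [← Real.exp_add, ← Real.exp_add]
            refine Real.exp_le_exp.mpr ?_
            rw [hs]; nlinarith
        _ ≤ _ := by
            refine mul_le_mul_of_nonneg_right ?_ (Real.exp_pos _).le
            rw [hB]; linarith [Real.rpow_pos_of_pos hlogpos (2 * T)]
    · calc Real.exp (s * t) * χ t ≤ Real.exp (s * t) :=
            mul_le_of_le_one_right (Real.exp_pos _).le (h.kernel.le_one t)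
        _ ≤ Real.exp (Real.log (Real.log u) * (2 * T)) * Real.exp (-(ε / 4) * t) := by
            rw [← Real.exp_add]
            refine Real.exp_le_exp.mpr ?_
            have e3 : (s + ε / 4) * t ≤ (2 * Real.log (Real.log u)) * T :=
              mul_le_mul (by linarith) htT ht (by positivity)
            linarith
        _ ≤ _ := by
            refine mul_le_mul_of_nonneg_right ?_ (Real.exp_pos _).le
            rw [hB, Real.rpow_def_of_pos hlogpos]
            linarith [Real.exp_pos ((1 - δ) * Real.log u)]
  have hX : ∀ V, 0 ≤ V → ∫ t in (0 : ℝ)..V, Real.exp (s * t) * χ t ≤ B / (ε / 4) := fun V hV => by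
    calc ∫ t in (0 : ℝ)..V, Real.exp (s * t) * χ t
        ≤ ∫ t in (0 : ℝ)..V, B * Real.exp (-(ε / 4) * t) :=
          intervalIntegral.integral_mono_on hV (h.kernel.intervalIntegrable_mul (by fun_prop) 0 V)
            (Continuous.intervalIntegrable (by fun_prop) _ _) fun t ht => hpt t ht.1
      _ = B * ((1 - Real.exp (-(ε / 4) * V)) / (ε / 4)) := by
          rw [intervalIntegral.integral_const_mul, integral_exp_mul_sub (by linarith), mul_zero,
            Real.exp_zero, div_neg, ← neg_div, neg_sub]
      _ ≤ B * (1 / (ε / 4)) := by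
          gcongr
          linarith [Real.exp_pos (-(ε / 4) * V)]
      _ = B / (ε / 4) := by ring
  refine (h.le_exp hs0 hu.le hX).trans (Real.exp_le_exp.mpr ?_)
  have e1 : s * (B / (ε / 4)) ≤ 2 * Real.log (Real.log u) * (B / (ε / 4)) :=
    mul_le_mul_of_nonneg_right (by linarith) (by positivity)
  have e2 : s * u = u * ψ u - 3 * (ε / 4) * u := by rw [hs]; ring
  nlinarith

theorem DelayPair.tendsto_step {χ σ φ ψ : ℝ → ℝ} (h : DelayPair χ σ) (hχ0 : ∀ u, 0 < χ u)
    (hχ : Tendsto (fun t => Real.log (χ t) / t + φ t) atTop (𝓝 0))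
    (hlow : ∀ ε > 0, ∃ A > 0, ∀ᶠ u in atTop,
      ∀ t ∈ Icc (A * Real.log u) (A * Real.log u + 1), φ t + 1 / A ≤ ψ u + ε)
    (hup : ∀ ε > 0, ∃ δ > 0, ∃ t₀ : ℝ, ∀ᶠ u in atTop,
      ∀ t ≥ t₀, t * (ψ u - ε - φ t) ≤ (1 - δ) * Real.log u)
    (hψ : Tendsto ψ atTop atTop) (hψ2 : ∀ᶠ u in atTop, ψ u ≤ 2 * Real.log (Real.log u)) :
    Tendsto (fun u => Real.log (σ u) / u + ψ u) atTop (𝓝 0) := by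
  have hχ1 : ∀ ε > 0, ∀ᶠ t in atTop, Real.exp (-(t * (φ t + ε))) ≤ χ t := fun ε hε => by
    filter_upwards [hχ.eventually (eventually_gt_nhds (neg_lt_zero.mpr hε)), eventually_gt_atTop 0]
      with t ht ht0
    rw [← Real.le_log_iff_exp_le (hχ0 t)]
    have e : Real.log (χ t) / t * t = Real.log (χ t) := div_mul_cancel₀ _ ht0.ne'
    nlinarith
  have hχ2 : ∀ ε > 0, ∀ᶠ t in atTop, χ t ≤ Real.exp (-(t * (φ t - ε))) := fun ε hε => by
    filter_upwards [hχ.eventually (eventually_lt_nhds hε), eventually_gt_atTop 0]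
      with t ht ht0
    rw [← Real.log_le_iff_le_exp (hχ0 t)]
    have e : Real.log (χ t) / t * t = Real.log (χ t) := div_mul_cancel₀ _ ht0.ne'
    nlinarith
  rw [Metric.tendsto_nhds]
  intro ε hε
  filter_upwards [h.lower_step hχ1 hlow (hψ.eventually_ge_atTop 0) (half_pos hε),
    h.upper_step hχ2 hup hψ hψ2 (half_pos hε), eventually_gt_atTop 0] with u h1 h2 hu
  rw [← Real.le_log_iff_exp_le (h.pos u)] at h1
  rw [← Real.log_le_iff_le_exp (h.pos u)] at h2
  have e : Real.log (σ u) / u * u = Real.log (σ u) := div_mul_cancel₀ _ hu.ne'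
  rw [dist_zero_right, Real.norm_eq_abs, abs_lt]
  constructor <;> nlinarith

/-! ### Iterated logarithms and the decay of `σ_k` -/

theorem logIter_succ (k : ℕ) (u : ℝ) : logIter (k + 1) u = logIter k (Real.log u) :=
  Function.iterate_succ_apply _ _ _

theorem logIter_succ' (k : ℕ) (u : ℝ) : logIter (k + 1) u = Real.log (logIter k u) :=
  Function.iterate_succ_apply' _ _ _

theorem tendsto_logIter (k : ℕ) : Tendsto (logIter k) atTop atTop := by
  induction k with
  | zero => exact tendsto_id
  | succ k ih => exact (Real.tendsto_log_atTop.comp ih).congr fun u => (logIter_succ' k u).symm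

theorem logIter_succ_eventually_le (k : ℕ) : ∀ᶠ z in atTop, logIter (k + 1) z ≤ Real.log z := by
  induction k with
  | zero => exact Eventually.of_forall fun z => (logIter_succ' 0 z).le
  | succ k ih =>
    filter_upwards [ih, (tendsto_logIter (k + 1)).eventually_ge_atTop 0] with z h1 h2
    rw [logIter_succ']
    exact (Real.log_le_self h2).trans h1

theorem exists_monotoneOn_logIter (k : ℕ) : ∃ t₀, MonotoneOn (logIter k) (Ici t₀) := by
  induction k with
  | zero => exact ⟨0, fun _ _ _ _ h => h⟩
  | succ k ih =>
    obtain ⟨t₀, h⟩ := ih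
    obtain ⟨t₁, h1⟩ := eventually_atTop.mp ((tendsto_logIter k).eventually_gt_atTop 0)
    refine ⟨max t₀ t₁, fun a ha b hb hab => ?_⟩
    rw [mem_Ici, max_le_iff] at ha hb
    rw [logIter_succ', logIter_succ']
    exact Real.log_le_log (h1 a ha.2) (h ha.1 hb.1 hab)

theorem tendsto_log_sub_log {α : Type*} {l : Filter α} {a b : α → ℝ}
    (ha : Tendsto a l atTop) (hb : Tendsto b l atTop)
    (h : Tendsto (fun x => a x / b x) l (𝓝 1)) :
    Tendsto (fun x => Real.log (a x) - Real.log (b x)) l (𝓝 0) := by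
  have h1 := (Real.continuousAt_log one_ne_zero).tendsto.comp h
  rw [Real.log_one] at h1
  refine h1.congr' ?_
  filter_upwards [ha.eventually_gt_atTop 0, hb.eventually_gt_atTop 0] with x hax hbx
  exact Real.log_div hax.ne' hbx.ne'

theorem tendsto_div_of_tendsto_sub {α : Type*} {l : Filter α} {a b : α → ℝ} {c : ℝ}
    (hb : Tendsto b l atTop) (h : Tendsto (fun x => a x - b x) l (𝓝 c)) :
    Tendsto (fun x => a x / b x) l (𝓝 1) := by
  have h1 := (h.div_atTop hb).add_const 1
  rw [zero_add] at h1
  refine h1.congr' ?_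
  filter_upwards [hb.eventually_gt_atTop 0] with x hx
  field_simp
  ring

theorem tendsto_logIter_comp_sub {g : ℝ → ℝ} (hg : Tendsto g atTop atTop)
    (h : Tendsto (fun z => Real.log (g z) / Real.log z) atTop (𝓝 1)) (k : ℕ) :
    Tendsto (fun z => logIter (k + 2) (g z) - logIter (k + 2) z) atTop (𝓝 0) := by
  induction k with
  | zero =>
    exact tendsto_log_sub_log (Real.tendsto_log_atTop.comp hg) Real.tendsto_log_atTop h
  | succ k ih =>
    have := tendsto_log_sub_log ((tendsto_logIter (k + 2)).comp hg) (tendsto_logIter (k + 2))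
      (tendsto_div_of_tendsto_sub (tendsto_logIter (k + 2)) ih)
    exact this.congr fun z => by rw [logIter_succ' (k + 2), logIter_succ' (k + 2)]; rfl

/-- The decay rate `-(log σ_k(u)) / u` up to `o(1)`. -/
noncomputable def decayRate : ℕ → ℝ → ℝ
  | 0, u => Real.log u + Real.log (Real.log u) - 1
  | k + 1, u => logIter (k + 2) u + logIter (k + 3) u

theorem tendsto_decayRate_succ (k : ℕ) : Tendsto (decayRate (k + 1)) atTop atTop :=
  (tendsto_logIter (k + 2)).atTop_add_atTop (tendsto_logIter (k + 3))

theorem decayRate_succ_le (k : ℕ) :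
    ∀ᶠ u in atTop, decayRate (k + 1) u ≤ 2 * Real.log (Real.log u) := by
  filter_upwards [Real.tendsto_log_atTop.eventually (logIter_succ_eventually_le k),
    Real.tendsto_log_atTop.eventually (logIter_succ_eventually_le (k + 1))] with u h1 h2
  rw [decayRate, logIter_succ (k + 1), logIter_succ (k + 2)]
  linarith

theorem tendsto_log_affine_div_log {A : ℝ} (hA : 0 < A) :
    Tendsto (fun z => Real.log (A * z + 1) / Real.log z) atTop (𝓝 1) := by
  have hg : Tendsto (fun z : ℝ => A * z + 1) atTop atTop :=
    tendsto_atTop_add_const_right _ _ (tendsto_id.const_mul_atTop hA)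
  refine tendsto_div_of_tendsto_sub (c := Real.log A) Real.tendsto_log_atTop ?_
  have h1 : Tendsto (fun z : ℝ => A + z⁻¹) atTop (𝓝 (A + 0)) :=
    tendsto_const_nhds.add tendsto_inv_atTop_zero
  rw [add_zero] at h1
  refine ((Real.continuousAt_log hA.ne').tendsto.comp h1).congr' ?_
  filter_upwards [eventually_gt_atTop 0] with z hz
  simp only [Function.comp]
  rw [← Real.log_div (by positivity) hz.ne']
  congr 1
  field_simp

/-- In `∫ σ_k(t) e^{st} dt` with `s` slightly larger than the decay rate of `σ_{k+1}` at `u`, the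
integrand is large on an interval of length `1` at a constant multiple of `log u`. -/
theorem decayRate_lower (k : ℕ) {ε : ℝ} (hε : 0 < ε) : ∃ A > 0, ∀ᶠ u in atTop,
    ∀ t ∈ Icc (A * Real.log u) (A * Real.log u + 1),
      decayRate k t + 1 / A ≤ decayRate (k + 1) u + ε := by
  cases k with
  | zero =>
    refine ⟨1, one_pos, ?_⟩
    have hg : Tendsto (fun z : ℝ => 1 * z + 1) atTop atTop :=
      tendsto_atTop_add_const_right _ _ (tendsto_id.const_mul_atTop one_pos)
    have hg1 : Tendsto (fun z : ℝ => (1 * z + 1) / z) atTop (𝓝 1) :=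
      tendsto_div_of_tendsto_sub (c := 1) tendsto_id (tendsto_const_nhds.congr fun z => by simp)
    have h1 := tendsto_log_sub_log hg tendsto_id hg1
    have h2 := tendsto_log_sub_log (Real.tendsto_log_atTop.comp hg) Real.tendsto_log_atTop
      (tendsto_log_affine_div_log one_pos)
    have h3 := Real.tendsto_log_atTop.eventually
      ((h1.eventually (eventually_lt_nhds (half_pos hε))).and
        ((h2.eventually (eventually_lt_nhds (half_pos hε))).and (eventually_gt_atTop 1)))
    filter_upwards [h3] with u hu t ht
    obtain ⟨h4, h5, h6⟩ := hu
    simp only [one_mul, Function.comp, id] at h4 h5 ht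
    have e1 : Real.log t ≤ Real.log (Real.log u + 1) := Real.log_le_log (by linarith [ht.1]) ht.2
    have e2 : Real.log (Real.log t) ≤ Real.log (Real.log (Real.log u + 1)) :=
      Real.log_le_log (Real.log_pos (by linarith [ht.1])) e1
    have e3 : decayRate (0 + 1) u =
      Real.log (Real.log u) + Real.log (Real.log (Real.log u)) := rfl
    rw [e3, decayRate]
    linarith
  | succ k =>
    refine ⟨2 / ε, by positivity, ?_⟩
    have hA : 0 < 2 / ε := by positivity
    have hg : Tendsto (fun z : ℝ => 2 / ε * z + 1) atTop atTop :=
      tendsto_atTop_add_const_right _ _ (tendsto_id.const_mul_atTop hA)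
    have h1 := tendsto_logIter_comp_sub hg (tendsto_log_affine_div_log hA) k
    have h2 := tendsto_logIter_comp_sub hg (tendsto_log_affine_div_log hA) (k + 1)
    obtain ⟨t₁, hm1⟩ := exists_monotoneOn_logIter (k + 2)
    obtain ⟨t₂, hm2⟩ := exists_monotoneOn_logIter (k + 3)
    have hε4 : 0 < ε / 4 := by positivity
    have h3 := Real.tendsto_log_atTop.eventually
      ((h1.eventually (eventually_lt_nhds hε4)).and
        ((h2.eventually (eventually_lt_nhds hε4)).and
          ((tendsto_id.const_mul_atTop hA).eventually_ge_atTop (max t₁ t₂))))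
    filter_upwards [h3] with u hu t ht
    obtain ⟨h4, h5, h6⟩ := hu
    simp only [id, max_le_iff] at h6
    have e1 := hm1 (h6.1.trans ht.1) (h6.1.trans (by linarith)) ht.2
    have e2 := hm2 (h6.2.trans ht.1) (h6.2.trans (by linarith)) ht.2
    simp only [decayRate]
    rw [logIter_succ (k + 1 + 1) u, logIter_succ (k + 1 + 2) u, one_div_div]
    linarith

theorem mul_sub_log_le {t : ℝ} (ht : 0 < t) (c : ℝ) : t * (c - Real.log t) ≤ Real.exp (c - 1) := by
  have h1 := Real.add_one_le_exp (c - 1 - Real.log t)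
  rw [Real.exp_sub, Real.exp_log ht, le_div_iff₀ ht] at h1
  linarith

/-- In `∫ σ_k(t) e^{st} dt` with `s` slightly smaller than the decay rate of `σ_{k+1}` at `u`, the
integrand is at most a power of `u` with exponent less than `1`. -/
theorem decayRate_upper (k : ℕ) {ε : ℝ} (hε : 0 < ε) : ∃ δ > 0, ∃ t₀ : ℝ, ∀ᶠ u in atTop,
    ∀ t ≥ t₀, t * (decayRate (k + 1) u - ε - decayRate k t) ≤ (1 - δ) * Real.log u := by
  -- small `t`, up to `z / (log z)^2` with `z = log u`, contribute little
  let g : ℝ → ℝ := fun z => z / Real.log z ^ 2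
  have hlog2 : Tendsto (fun z : ℝ => Real.log z ^ 2 / z) atTop (𝓝 0) := by
    have : (fun z : ℝ => Real.log z ^ 2) =o[atTop] id := Real.isLittleO_pow_log_id_atTop
    exact this.tendsto_div_nhds_zero
  have hg : Tendsto g atTop atTop := by
    have h1 : Tendsto (fun z : ℝ => Real.log z ^ 2 / z) atTop (𝓝[>] 0) := by
      refine tendsto_nhdsWithin_iff.mpr ⟨hlog2, ?_⟩
      filter_upwards [eventually_gt_atTop 1] with z hz
      have := Real.log_pos hz
      exact Set.mem_Ioi.mpr (by positivity)
    exact (tendsto_inv_nhdsGT_zero.comp h1).congr fun z => by simp [g]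
  have hglog : Tendsto (fun z => Real.log (g z) / Real.log z) atTop (𝓝 1) := by
    have h1 : Tendsto (fun z : ℝ => 1 - 2 * (Real.log (Real.log z) / Real.log z)) atTop
        (𝓝 (1 - 2 * 0)) := tendsto_const_nhds.sub ((Real.isLittleO_log_id_atTop.tendsto_div_nhds_zero.comp
      Real.tendsto_log_atTop).const_mul 2)
    rw [mul_zero, sub_zero] at h1
    refine h1.congr' ?_
    filter_upwards [eventually_gt_atTop 1] with z hz
    have hl := Real.log_pos hz
    simp only [g]
    rw [Real.log_div (by linarith) (by positivity), Real.log_pow]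
    push_cast
    field_simp
  have hsmall : ∀ᶠ u : ℝ in atTop, ∀ t, 0 ≤ t → t ≤ g (Real.log u) → 0 ≤ decayRate k t →
      t * (decayRate (k + 1) u - ε - decayRate k t) ≤ (1 / 2) * Real.log u := by
    filter_upwards [decayRate_succ_le k, Real.tendsto_log_atTop.eventually_gt_atTop 1,
      (Real.tendsto_log_atTop.comp Real.tendsto_log_atTop).eventually_ge_atTop 4] with
      u h1 h2 h3 t ht htg hd
    set z := Real.log u
    simp only [Function.comp] at h3
    calc t * (decayRate (k + 1) u - ε - decayRate k t) ≤ t * (2 * Real.log z) :=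
          mul_le_mul_of_nonneg_left (by linarith) ht
      _ ≤ g z * (2 * Real.log z) := mul_le_mul_of_nonneg_right htg (by linarith)
      _ = 2 * z / Real.log z := by simp only [g]; field_simp
      _ ≤ (1 / 2) * z := by rw [div_le_iff₀ (by linarith)]; nlinarith
  have hloglog : Tendsto (fun z => logIter 2 (g z) - logIter 2 z) atTop (𝓝 0) :=
    tendsto_logIter_comp_sub hg hglog 0
  cases k with
  | zero =>
    refine ⟨min (1 / 2) (1 - Real.exp (-(ε / 2))), lt_min (by norm_num)
      (sub_pos.mpr (by rw [Real.exp_lt_one_iff]; linarith)), Real.exp 1, ?_⟩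
    have h3 := Real.tendsto_log_atTop.eventually
      ((hloglog.eventually (eventually_gt_nhds (neg_lt_zero.mpr (half_pos hε)))).and
        (hg.eventually_gt_atTop 1))
    filter_upwards [hsmall, h3, Real.tendsto_log_atTop.eventually_gt_atTop 1] with u h1 h2 hz t ht
    have ht0 : 0 < t := (Real.exp_pos 1).trans_le ht
    have hlogt : 1 ≤ Real.log t := by rwa [Real.le_log_iff_exp_le ht0]
    set z := Real.log u
    have hz0 : 0 < z := by linarith
    rcases le_total t (g z) with hle | hle
    · have hd : 0 ≤ decayRate 0 t := by
        rw [decayRate]; linarith [Real.log_nonneg hlogt]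
      refine (h1 t ht0.le hle hd).trans (mul_le_mul_of_nonneg_right ?_ hz0.le)
      linarith [min_le_left (1 / 2 : ℝ) (1 - Real.exp (-(ε / 2)))]
    · have e1 : Real.log (Real.log (g z)) ≤ Real.log (Real.log t) :=
        Real.log_le_log (Real.log_pos h2.2) (Real.log_le_log (by linarith [h2.2]) hle)
      have e2 := h2.1
      simp only [logIter, Function.iterate_succ, Function.iterate_zero, Function.comp, id] at e2
      have e3 : decayRate 1 u = Real.log z + Real.log (Real.log z) := rfl
      calc t * (decayRate (0 + 1) u - ε - decayRate 0 t)
          ≤ t * ((Real.log z + 1 - ε / 2) - Real.log t) := by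
            refine mul_le_mul_of_nonneg_left ?_ ht0.le
            rw [zero_add, e3, decayRate]; linarith
        _ ≤ Real.exp (Real.log z + 1 - ε / 2 - 1) := mul_sub_log_le ht0 _
        _ = Real.exp (-(ε / 2)) * z := by
            rw [show Real.log z + 1 - ε / 2 - 1 = -(ε / 2) + Real.log z by ring, Real.exp_add,
              Real.exp_log hz0]
        _ ≤ _ := by
            refine mul_le_mul_of_nonneg_right ?_ hz0.le
            linarith [min_le_right (1 / 2 : ℝ) (1 - Real.exp (-(ε / 2)))]
  | succ k =>
    obtain ⟨t₁, hm1⟩ := exists_monotoneOn_logIter (k + 2)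
    obtain ⟨t₂, hm2⟩ := exists_monotoneOn_logIter (k + 3)
    obtain ⟨t₃, ht₃⟩ := eventually_atTop.mp ((tendsto_decayRate_succ k).eventually_ge_atTop 0)
    have hd1 := tendsto_logIter_comp_sub hg hglog k
    have hd2 := tendsto_logIter_comp_sub hg hglog (k + 1)
    refine ⟨1 / 2, by norm_num, max t₃ 0, ?_⟩
    have h3 := Real.tendsto_log_atTop.eventually
      ((hd1.eventually (eventually_gt_nhds (neg_lt_zero.mpr (half_pos hε)))).and
        ((hd2.eventually (eventually_gt_nhds (neg_lt_zero.mpr (half_pos hε)))).and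
          (hg.eventually_ge_atTop (max t₁ t₂))))
    filter_upwards [hsmall, h3, Real.tendsto_log_atTop.eventually_gt_atTop 1] with u h1 h2 hz t ht
    obtain ⟨h4, h5, h6⟩ := h2
    rw [ge_iff_le, max_le_iff] at ht
    rw [max_le_iff] at h6
    set z := Real.log u with hzdef
    rcases le_total t (g z) with hle | hle
    · refine (h1 t ht.2 hle (ht₃ t ht.1)).trans_eq ?_
      ring
    · have e1 := hm1 h6.1 (h6.1.trans hle) hle
      have e2 := hm2 h6.2 (h6.2.trans hle) hle
      have e3 : decayRate (k + 1 + 1) u = logIter (k + 2) z + logIter (k + 3) z := by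
        rw [decayRate, logIter_succ (k + 1 + 1) u, logIter_succ (k + 1 + 2) u]
      have e4 : decayRate (k + 1) t = logIter (k + 2) t + logIter (k + 3) t := rfl
      have e5 : t * (decayRate (k + 1 + 1) u - ε - decayRate (k + 1) t) ≤ 0 := by
        refine mul_nonpos_of_nonneg_of_nonpos ht.2 ?_
        rw [e3, e4]
        have : logIter (k + 1 + 2) (g z) - logIter (k + 1 + 2) z =
          logIter (k + 3) (g z) - logIter (k + 3) z := rfl
        linarith
      refine e5.trans ?_
      linarith

theorem IsSigmaSequence.tendsto_log {σ : ℕ → ℝ → ℝ} (h : IsSigmaSequence σ) (k : ℕ) :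
    Tendsto (fun u => Real.log (extendLeft (σ k) u) / u + decayRate k u) atTop (𝓝 0) := by
  induction k with
  | zero => exact tendsto_log_dickman (h.delayPair 0)
  | succ k ih =>
    exact (h.delayPair (k + 1)).tendsto_step (h.delayPair k).pos ih
      (fun ε hε => decayRate_lower k hε) (fun ε hε => decayRate_upper k hε)
      (tendsto_decayRate_succ k) (decayRate_succ_le k)

theorem exists_rpow_form {σ b φ : ℝ → ℝ} {c : ℝ} (hσ : ∀ᶠ u in atTop, 0 < σ u)
    (hb : ∀ᶠ u in atTop, 0 < b u)
    (h : Tendsto (fun u => Real.log (σ u) / u + φ u) atTop (𝓝 0))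
    (hφ : ∀ᶠ u in atTop, φ u = Real.log (b u) - c) :
    ∃ δ : ℝ → ℝ, Tendsto δ atTop (𝓝 0) ∧ ∀ᶠ u in atTop, σ u = ((Real.exp c + δ u) / b u) ^ u := by
  refine ⟨fun u => Real.exp (Real.log (σ u) / u) * b u - Real.exp c, ?_, ?_⟩
  · have h1 := (Real.continuous_exp.tendsto _).comp (h.add_const c)
    rw [zero_add] at h1
    have h2 := h1.sub_const (Real.exp c)
    rw [sub_self] at h2
    refine h2.congr' ?_
    filter_upwards [hb, hφ] with u hu hu2
    simp only [Function.comp]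
    rw [hu2, show Real.log (σ u) / u + (Real.log (b u) - c) + c =
      Real.log (σ u) / u + Real.log (b u) by ring, Real.exp_add, Real.exp_log hu]
  · filter_upwards [hb, hσ, eventually_gt_atTop 0] with u hu hu2 hu0
    rw [add_sub_cancel, mul_div_assoc, div_self hu.ne', mul_one, ← Real.exp_mul,
      div_mul_cancel₀ _ hu0.ne', Real.exp_log hu2]

theorem IsSigmaSequence.asymptotic_zero {σ : ℕ → ℝ → ℝ} (h : IsSigmaSequence σ) :
    ∃ δ : ℝ → ℝ, Tendsto δ atTop (𝓝 0) ∧ ∀ᶠ u : ℝ in atTop,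
      σ 0 u = ((Real.exp 1 + δ u) / (u * Real.log u)) ^ u := by
  obtain ⟨δ, h1, h2⟩ := exists_rpow_form (c := 1) (b := fun u => u * Real.log u)
    (Eventually.of_forall (h.delayPair 0).pos)
    ((eventually_gt_atTop 1).mono fun u hu => mul_pos (by linarith) (Real.log_pos hu))
    (h.tendsto_log 0) ((eventually_gt_atTop 1).mono fun u hu => by
      rw [Real.log_mul (by linarith) (Real.log_pos hu).ne', decayRate])
  refine ⟨δ, h1, ?_⟩
  filter_upwards [h2, eventually_ge_atTop 0] with u hu hu0
  rwa [extendLeft_of_nonneg _ hu0] at hu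

theorem IsSigmaSequence.asymptotic_succ {σ : ℕ → ℝ → ℝ} (h : IsSigmaSequence σ) {k : ℕ}
    (hk : 1 ≤ k) : ∃ δ : ℝ → ℝ, Tendsto δ atTop (𝓝 0) ∧ ∀ᶠ u : ℝ in atTop,
      σ k u = ((1 + δ u) / (logIter k u * logIter (k + 1) u)) ^ u := by
  obtain ⟨j, rfl⟩ : ∃ j, k = j + 1 := ⟨k - 1, by omega⟩
  have hpos := ((tendsto_logIter (j + 1)).eventually_gt_atTop 0).and
    ((tendsto_logIter (j + 2)).eventually_gt_atTop 0)
  obtain ⟨δ, h1, h2⟩ := exists_rpow_form (c := 0) (b := fun u => logIter (j + 1) u * logIter (j + 2) u)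
    (Eventually.of_forall (h.delayPair (j + 1)).pos)
    (hpos.mono fun u hu => mul_pos hu.1 hu.2)
    (h.tendsto_log (j + 1)) (hpos.mono fun u hu => by
      rw [Real.log_mul hu.1.ne' hu.2.ne', decayRate, logIter_succ' (j + 1), logIter_succ' (j + 2),
        logIter_succ' (j + 1), sub_zero])
  refine ⟨δ, h1, ?_⟩
  filter_upwards [h2, eventually_ge_atTop 0] with u hu hu0
  rwa [extendLeft_of_nonneg _ hu0, Real.exp_zero] at hu

/-! ### Sums over primes -/

/-- The finite set of primes `p ≤ x`. -/
noncomputable def primesUpTo (x : ℝ) : Finset ℕ := (Finset.Icc 1 ⌊x⌋₊).filter Nat.Prime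

theorem mem_primesUpTo {x : ℝ} (hx : 0 ≤ x) {p : ℕ} :
    p ∈ primesUpTo x ↔ p.Prime ∧ (p : ℝ) ≤ x := by
  rw [primesUpTo, Finset.mem_filter, Finset.mem_Icc, Nat.le_floor_iff hx]
  exact ⟨fun h => ⟨h.2, h.1.2⟩, fun h => ⟨⟨h.1.one_le, h.2⟩, h.1⟩⟩

theorem primesUpTo_subset {x y : ℝ} (h : x ≤ y) : primesUpTo x ⊆ primesUpTo y :=
  Finset.filter_subset_filter _ (Finset.Icc_subset_Icc_right (Nat.floor_mono h))

theorem card_primesUpTo (x : ℝ) : (primesUpTo x).card = primePi x := by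
  rw [primePi, Nat.primeCounting, Nat.primeCounting', Nat.count_eq_card_filter_range, primesUpTo]
  congr 1
  ext p
  simp only [Finset.mem_filter, Finset.mem_Icc, Finset.mem_range]
  exact ⟨fun h => ⟨by omega, h.2⟩, fun h => ⟨⟨h.2.one_le, by omega⟩, h.2⟩⟩

theorem sum_sum_divisors (F : ℕ → ℕ → ℝ) (N : ℕ) :
    ∑ n ∈ Finset.Icc 1 N, ∑ d ∈ n.divisors, F d (n / d) =
      ∑ d ∈ Finset.Icc 1 N, ∑ m ∈ Finset.Icc 1 (N / d), F d m := by
  rw [Finset.sum_sigma', Finset.sum_sigma']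
  refine Finset.sum_nbij' (fun x => ⟨x.2, x.1 / x.2⟩) (fun x => ⟨x.1 * x.2, x.1⟩) ?_ ?_ ?_ ?_ ?_
  · rintro ⟨n, d⟩ h
    simp only [Finset.mem_sigma, Finset.mem_Icc, Nat.mem_divisors] at h ⊢
    have hd : 0 < d := Nat.pos_of_dvd_of_pos h.2.1 (by omega)
    have hdn := Nat.le_of_dvd (by omega) h.2.1
    exact ⟨⟨hd, hdn.trans h.1.2⟩, Nat.div_pos hdn hd, Nat.div_le_div_right h.1.2⟩
  · rintro ⟨d, m⟩ h
    simp only [Finset.mem_sigma, Finset.mem_Icc, Nat.mem_divisors] at h ⊢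
    have h1 : 0 < d * m := Nat.mul_pos (by omega) (by omega)
    refine ⟨⟨h1, ?_⟩, Dvd.intro _ rfl, h1.ne'⟩
    calc d * m ≤ d * (N / d) := Nat.mul_le_mul_left _ h.2.2
      _ ≤ N := Nat.mul_div_le _ _
  · rintro ⟨n, d⟩ h
    simp only [Finset.mem_sigma, Finset.mem_Icc, Nat.mem_divisors] at h
    simp [Nat.mul_div_cancel' h.2.1]
  · rintro ⟨d, m⟩ h
    simp only [Finset.mem_sigma, Finset.mem_Icc] at h
    simp [Nat.mul_div_cancel_left m (by omega : 0 < d)]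
  · rintro ⟨n, d⟩ h
    rfl

/-- The summatory function `∑_{n ≤ x} f(n)`. -/
noncomputable def summatory (f : ℕ → ℝ) (x : ℝ) : ℝ := ∑ n ∈ Finset.Icc 1 ⌊x⌋₊, f n

theorem sum_mul_log_eq {f : ℕ → ℝ} (hf : ∀ m n, 0 < m → 0 < n → f (m * n) = f m * f n) (x : ℝ) :
    ∑ n ∈ Finset.Icc 1 ⌊x⌋₊, f n * Real.log n =
      ∑ d ∈ Finset.Icc 1 ⌊x⌋₊, vonMangoldt d * f d * summatory f (x / d) := by
  have h1 := sum_sum_divisors (fun d m => vonMangoldt d * (f d * f m)) ⌊x⌋₊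
  have h2 : ∀ n ∈ Finset.Icc 1 ⌊x⌋₊, f n * Real.log n =
      ∑ d ∈ n.divisors, vonMangoldt d * (f d * f (n / d)) := fun n hn => by
    rw [← ArithmeticFunction.vonMangoldt_sum, Finset.mul_sum]
    refine Finset.sum_congr rfl fun d hd => ?_
    rw [Finset.mem_Icc] at hn
    have hdn := Nat.dvd_of_mem_divisors hd
    have hd0 : 0 < d := Nat.pos_of_dvd_of_pos hdn (by omega)
    rw [← hf d (n / d) hd0 (Nat.div_pos (Nat.le_of_dvd (by omega) hdn) hd0),
      Nat.mul_div_cancel' hdn, mul_comm]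
  rw [Finset.sum_congr rfl h2, h1]
  refine Finset.sum_congr rfl fun d _ => ?_
  rw [summatory, Nat.floor_div_natCast, Finset.mul_sum]
  exact Finset.sum_congr rfl fun m _ => by ring

theorem sum_log_div_le {x : ℝ} (hx : 1 ≤ x) :
    ∑ n ∈ Finset.Icc 1 ⌊x⌋₊, (Real.log x - Real.log n) ≤ 2 * x := by
  have hN : 1 ≤ ⌊x⌋₊ := Nat.one_le_floor_iff x |>.mpr hx
  set N := ⌊x⌋₊ with hNdef
  have hN0 : (0 : ℝ) < N := by exact_mod_cast hN
  have hNx : (N : ℝ) ≤ x := Nat.floor_le (by linarith)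
  have hxN : x < N + 1 := Nat.lt_floor_add_one x
  have h1 : ∑ n ∈ Finset.Icc 1 N, Real.log n = Real.log (N.factorial : ℝ) := by
    clear_value N
    clear hN hNdef hN0 hNx hxN
    induction N with
    | zero => simp
    | succ n ih =>
      have hn : ((n + 1 : ℕ) : ℝ) ≠ 0 := by positivity
      have hn' : (n.factorial : ℝ) ≠ 0 := by positivity
      rw [Finset.sum_Icc_succ_top (by omega), ih, Nat.factorial_succ, Nat.cast_mul,
        Real.log_mul hn hn', add_comm]
  have h2 := Stirling.le_log_factorial_stirling (n := N) (by omega)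
  have h3 : 0 ≤ Real.log (N : ℝ) := Real.log_natCast_nonneg N
  have h4 : 0 ≤ Real.log (2 * Real.pi) := Real.log_nonneg (by linarith [Real.pi_gt_three])
  rw [Finset.sum_sub_distrib, h1]
  simp only [Finset.sum_const, Nat.card_Icc, nsmul_eq_mul, Nat.add_sub_cancel]
  have h5 : Real.log x - Real.log N ≤ x / N - 1 := by
    rw [← Real.log_div (by linarith) hN0.ne']
    exact Real.log_le_sub_one_of_pos (by positivity)
  have h6 : (N : ℝ) * (Real.log x - Real.log N) ≤ x - N := by
    calc (N : ℝ) * (Real.log x - Real.log N) ≤ N * (x / N - 1) := by gcongr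
      _ = x - N := by field_simp
  nlinarith

/-- The identity `log = Λ * 1` in summatory form: for completely multiplicative `f` with values in
`[0, 1]`, `M(x) log x` agrees with `∑_{d ≤ x} Λ(d) f(d) M(x/d)` up to `O(x)`. -/
theorem abs_summatory_mul_log_sub_le {f : ℕ → ℝ}
    (hf : ∀ m n, 0 < m → 0 < n → f (m * n) = f m * f n) (hf0 : ∀ n, 0 ≤ f n) (hf1 : ∀ n, f n ≤ 1)
    {x : ℝ} (hx : 1 ≤ x) :
    |summatory f x * Real.log x -
      ∑ d ∈ Finset.Icc 1 ⌊x⌋₊, vonMangoldt d * f d * summatory f (x / d)| ≤ 2 * x := by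
  rw [← sum_mul_log_eq hf, summatory, Finset.sum_mul, ← Finset.sum_sub_distrib]
  have h0 : ∀ n ∈ Finset.Icc 1 ⌊x⌋₊, 0 ≤ Real.log x - Real.log n := fun n hn => by
    rw [Finset.mem_Icc] at hn
    have h1 : (n : ℝ) ≤ x := (Nat.le_floor_iff (by linarith)).mp hn.2
    have h2 : (0 : ℝ) < n := by exact_mod_cast hn.1
    exact sub_nonneg.mpr (Real.log_le_log h2 h1)
  rw [abs_of_nonneg]
  · refine le_trans (Finset.sum_le_sum fun n hn => ?_) (sum_log_div_le hx)
    rw [← mul_sub]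
    exact mul_le_of_le_one_left (h0 n hn) (hf1 n)
  · refine Finset.sum_nonneg fun n hn => ?_
    rw [← mul_sub]
    exact mul_nonneg (hf0 n) (h0 n hn)

theorem log_four_le_two : Real.log 4 ≤ 2 := by
  rw [show (4 : ℝ) = 2 ^ 2 by norm_num, Real.log_pow]
  have := Real.log_two_lt_d9
  push_cast
  linarith

theorem sum_vonMangoldt_le {x : ℝ} (hx : 0 ≤ x) :
    ∑ d ∈ Finset.Icc 1 ⌊x⌋₊, vonMangoldt d ≤ 6 * x := by
  have h1 := Chebyshev.psi_le_const_mul_self hx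
  rw [Chebyshev.psi] at h1
  refine le_trans (le_of_eq ?_) (h1.trans ?_)
  · rfl
  · gcongr
    linarith [log_four_le_two]

/-- Mertens' first theorem, for the von Mangoldt function. -/
theorem abs_sum_vonMangoldt_div_sub_log_le {x : ℝ} (hx : 1 ≤ x) :
    |∑ d ∈ Finset.Icc 1 ⌊x⌋₊, vonMangoldt d / d - Real.log x| ≤ 10 := by
  have hx0 : 0 < x := by linarith
  have h1 := abs_summatory_mul_log_sub_le (f := fun _ => 1) (fun _ _ _ _ => by simp)
    (fun _ => zero_le_one) (fun _ => le_rfl) hx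
  have hM : ∀ z : ℝ, summatory (fun _ => 1) z = ⌊z⌋₊ := fun z => by simp [summatory]
  simp only [hM, mul_one] at h1
  set S := ∑ d ∈ Finset.Icc 1 ⌊x⌋₊, vonMangoldt d / d
  have h2 : ∑ d ∈ Finset.Icc 1 ⌊x⌋₊, vonMangoldt d * (⌊x / d⌋₊ : ℝ) ≤ x * S := by
    rw [Finset.mul_sum]
    refine Finset.sum_le_sum fun d hd => ?_
    have : (⌊x / d⌋₊ : ℝ) ≤ x / d := Nat.floor_le (by positivity)
    calc vonMangoldt d * (⌊x / d⌋₊ : ℝ) ≤ vonMangoldt d * (x / d) :=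
          mul_le_mul_of_nonneg_left this ArithmeticFunction.vonMangoldt_nonneg
      _ = x * (vonMangoldt d / d) := by ring
  have h3 : x * S ≤ ∑ d ∈ Finset.Icc 1 ⌊x⌋₊, vonMangoldt d * (⌊x / d⌋₊ : ℝ) + 6 * x := by
    refine le_trans ?_ (add_le_add_right (sum_vonMangoldt_le hx0.le) _)
    rw [Finset.mul_sum, ← Finset.sum_add_distrib]
    refine Finset.sum_le_sum fun d hd => ?_
    have : x / d ≤ ⌊x / d⌋₊ + 1 := (Nat.lt_floor_add_one _).le
    calc x * (vonMangoldt d / d) = vonMangoldt d * (x / d) := by ring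
      _ ≤ vonMangoldt d * (⌊x / d⌋₊ + 1) :=
        mul_le_mul_of_nonneg_left this ArithmeticFunction.vonMangoldt_nonneg
      _ = _ := by ring
  rw [abs_le] at h1
  have h4 : (⌊x⌋₊ : ℝ) ≤ x := Nat.floor_le hx0.le
  have h5 : x < ⌊x⌋₊ + 1 := Nat.lt_floor_add_one x
  have h6 : 0 ≤ Real.log x := Real.log_nonneg hx
  have h7 : Real.log x ≤ x := Real.log_le_self hx0.le
  rw [abs_le]
  constructor
  · have : x * (Real.log x - 10) ≤ x * S := by nlinarith
    linarith [le_of_mul_le_mul_left this hx0]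
  · have : x * S ≤ x * (Real.log x + 10) := by nlinarith
    linarith [le_of_mul_le_mul_left this hx0]

/-- Proper prime powers contribute a bounded amount to `∑ Λ(d) f(d) / d`. -/
theorem exists_prime_power_bound : ∃ C > 0, ∀ f : ℕ → ℝ, (∀ n, 0 ≤ f n) → (∀ n, f n ≤ 1) → ∀ x : ℝ,
    |∑ d ∈ Finset.Icc 1 ⌊x⌋₊, vonMangoldt d * f d / d -
      ∑ p ∈ primesUpTo x, f p * (Real.log p / p)| ≤ C := by
  let g : ℕ → ℝ := fun n => (if n.Prime then 0 else vonMangoldt n) / n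
  have hg0 : ∀ n, 0 ≤ g n := fun n => by
    have := ArithmeticFunction.vonMangoldt_nonneg (n := n)
    simp only [g]
    split_ifs <;> positivity
  have hs : Summable g := by
    have := ArithmeticFunction.vonMangoldt.summable_residueClass_non_primes_div (q := 1) 0
    refine this.congr fun n => ?_
    have : (n : ZMod 1) = 0 := Subsingleton.elim _ _
    simp [g, ArithmeticFunction.vonMangoldt.residueClass, this]
  have hs0 : 0 ≤ ∑' n, g n := tsum_nonneg hg0
  refine ⟨(∑' n, g n) + 1, by linarith, fun f hf0 hf1 x => ?_⟩
  have h1 : ∑ d ∈ Finset.Icc 1 ⌊x⌋₊, vonMangoldt d * f d / d -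
      ∑ p ∈ primesUpTo x, f p * (Real.log p / p) = ∑ d ∈ Finset.Icc 1 ⌊x⌋₊, f d * g d := by
    rw [primesUpTo, Finset.sum_filter, ← Finset.sum_sub_distrib]
    refine Finset.sum_congr rfl fun d _ => ?_
    simp only [g]
    split_ifs with hp
    · rw [ArithmeticFunction.vonMangoldt_apply_prime hp]; ring
    · ring
  rw [h1, abs_of_nonneg (Finset.sum_nonneg fun d _ => mul_nonneg (hf0 d) (hg0 d))]
  have h2 : ∑ d ∈ Finset.Icc 1 ⌊x⌋₊, f d * g d ≤ ∑ d ∈ Finset.Icc 1 ⌊x⌋₊, g d :=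
    Finset.sum_le_sum fun d _ => mul_le_of_le_one_left (hg0 d) (hf1 d)
  linarith [hs.sum_le_tsum (Finset.Icc 1 ⌊x⌋₊) fun d _ => hg0 d]

/-- Mertens' first theorem. -/
theorem exists_mertens : ∃ C > 0, ∀ x : ℝ, 1 ≤ x →
    |∑ p ∈ primesUpTo x, Real.log p / p - Real.log x| ≤ C := by
  obtain ⟨C, hC, h⟩ := exists_prime_power_bound
  refine ⟨C + 10, by linarith, fun x hx => ?_⟩
  have h1 := h (fun _ => 1) (fun _ => zero_le_one) (fun _ => le_rfl) x
  have h2 := abs_sum_vonMangoldt_div_sub_log_le hx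
  simp only [mul_one, one_mul] at h1
  rw [abs_le] at *
  constructor <;> linarith

theorem primePi_le {x : ℝ} (hx : 1 < x) : (primePi x : ℝ) ≤ 6 * (x / Real.log x) := by
  have h1 := Chebyshev.pi_le_log4_mul_div hx
  have hx0 : 0 < x := by linarith
  have hl : 0 < Real.log x := Real.log_pos hx
  rw [Real.log_sqrt hx0.le] at h1
  have h2 : Real.sqrt x ≤ 2 * (x / Real.log x) := by
    have hs : 0 < Real.sqrt x := Real.sqrt_pos.mpr hx0
    have e1 : Real.log (Real.sqrt x) ≤ Real.sqrt x := Real.log_le_self hs.le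
    rw [Real.log_sqrt hx0.le] at e1
    rw [← mul_div_assoc, le_div_iff₀ hl]
    nlinarith [Real.mul_self_sqrt hx0.le]
  have h3 : Real.log 4 * x / (Real.log x / 2) ≤ 4 * (x / Real.log x) := by
    rw [show Real.log 4 * x / (Real.log x / 2) = (2 * Real.log 4) * (x / Real.log x) by field_simp]
    have : 0 < x / Real.log x := by positivity
    exact mul_le_mul_of_nonneg_right (by linarith [log_four_le_two]) this.le
  have h4 : (primePi x : ℝ) ≤ Real.log 4 * x / (Real.log x / 2) + Real.sqrt x := h1
  linarith

/-- The primes in `(z, z²]` carry a fixed amount of `∑ 1/p`. -/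
theorem eventually_sum_inv_primes : ∀ᶠ z : ℝ in atTop,
    1 / 4 ≤ ∑ p ∈ primesUpTo (z ^ 2) \ primesUpTo z, (1 : ℝ) / p := by
  obtain ⟨C, hC, h⟩ := exists_mertens
  filter_upwards [Real.tendsto_log_atTop.eventually_ge_atTop (4 * C), eventually_gt_atTop 1]
    with z h1 hz
  have hl : 0 < Real.log z := Real.log_pos hz
  have hzz : z ≤ z ^ 2 := by nlinarith
  have h2 := abs_le.mp (h z hz.le)
  have h3 := abs_le.mp (h (z ^ 2) (by nlinarith))
  rw [← Finset.sum_sdiff (primesUpTo_subset hzz), Real.log_pow] at h3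
  push_cast at h3
  have h4 : ∑ p ∈ primesUpTo (z ^ 2) \ primesUpTo z, Real.log p / p ≤
      (2 * Real.log z) * ∑ p ∈ primesUpTo (z ^ 2) \ primesUpTo z, (1 : ℝ) / p := by
    rw [Finset.mul_sum]
    refine Finset.sum_le_sum fun p hp => ?_
    have hp1 := (mem_primesUpTo (by positivity)).mp (Finset.sdiff_subset hp)
    have hp0 : (0 : ℝ) < p := by exact_mod_cast hp1.1.pos
    rw [mul_one_div]
    gcongr
    calc Real.log p ≤ Real.log (z ^ 2) := Real.log_le_log hp0 hp1.2
      _ = 2 * Real.log z := by rw [Real.log_pow]; norm_num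
  by_contra! hlt
  nlinarith

/-! ### Weak convergence of weighted point sets -/

/-- If the distribution function of a weighted finite point set is within `η` of `∫_0^b χ`, then
sums of a test function over the points are close to its integral against `χ`. Here `N` is the
number of pieces of a partition of `[0, u]` on which the test function varies by at most `ω`. -/
theorem abs_sum_sub_integral_le {ι : Type*} (s : Finset ι) (v w : ι → ℝ) {χ g : ℝ → ℝ}
    (hχ : IsKernel χ) (hg : Continuous g) {u ω η : ℝ} {N : ℕ} (hN : 0 < N) (hu : 0 ≤ u)
    (hw : ∀ i ∈ s, 0 ≤ w i) (hv : ∀ i ∈ s, v i ∈ Icc 0 u)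
    (hcdf : ∀ b ∈ Icc 0 u, |∑ i ∈ s with v i ≤ b, w i - ∫ t in (0 : ℝ)..b, χ t| ≤ η)
    (hg1 : ∀ a ∈ Icc 0 u, |g a| ≤ 1)
    (hω : ∀ a ∈ Icc 0 u, ∀ b ∈ Icc 0 u, |a - b| ≤ u / N → |g a - g b| ≤ ω) :
    |∑ i ∈ s, w i * g (v i) - ∫ t in (0 : ℝ)..u, g t * χ t| ≤ ω * (2 * u + η) + (2 * N + 1) * η := by
  set h := u / N with hh
  have hN0 : (0 : ℝ) < N := by exact_mod_cast hN
  have hh0 : 0 ≤ h := by positivity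
  have hNh : N * h = u := by rw [hh]; field_simp
  let F : ℝ → ℝ := fun b => ∑ i ∈ s with v i ≤ b, w i
  let I : ℝ → ℝ := fun b => ∫ t in (0 : ℝ)..b, χ t
  have hω0 : 0 ≤ ω := by
    have := hω 0 ⟨le_rfl, hu⟩ 0 ⟨le_rfl, hu⟩ (by simpa using hh0)
    simpa using this
  have key : ∀ j : ℕ, j ≤ N →
      |∑ i ∈ s with v i ≤ j * h, w i * g (v i) - ∫ t in (0 : ℝ)..(j * h), g t * χ t| ≤
        ω * (F (j * h) + I (j * h)) + (2 * j + 1) * η := by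
    intro j
    induction j with
    | zero =>
      intro _
      have h0 := hcdf 0 ⟨le_rfl, hu⟩
      simp only [Nat.cast_zero, zero_mul, intervalIntegral.integral_same, sub_zero, mul_zero,
        zero_add, one_mul, F, I, add_zero] at h0 ⊢
      have hnn : 0 ≤ ∑ i ∈ s with v i ≤ 0, w i :=
        Finset.sum_nonneg fun i hi => hw i (Finset.mem_filter.mp hi).1
      have h1 : |∑ i ∈ s with v i ≤ 0, w i * g (v i)| ≤ ∑ i ∈ s with v i ≤ 0, w i := by
        refine (Finset.abs_sum_le_sum_abs _ _).trans (Finset.sum_le_sum fun i hi => ?_)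
        have hi' := (Finset.mem_filter.mp hi).1
        rw [abs_mul, abs_of_nonneg (hw i hi')]
        exact mul_le_of_le_one_right (hw i hi') (hg1 _ (hv i hi'))
      rw [abs_of_nonneg hnn] at h0
      have := mul_nonneg hω0 hnn
      linarith
    | succ j ih =>
      intro hjN
      have ih := ih (by omega)
      set b := (j : ℝ) * h with hb
      have hbh : ((j + 1 : ℕ) : ℝ) * h = b + h := by push_cast; ring
      have hjN' : ((j + 1 : ℕ) : ℝ) * h ≤ u := by
        rw [← hNh]
        exact mul_le_mul_of_nonneg_right (by exact_mod_cast hjN) hh0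
      rw [hbh] at hjN' ⊢
      have hb0 : 0 ≤ b := by positivity
      have hbm : b ∈ Icc 0 u := ⟨hb0, by linarith⟩
      have hbhm : b + h ∈ Icc 0 u := ⟨by linarith, hjN'⟩
      have hsplit : ∀ q : ι → ℝ, ∑ i ∈ s with v i ≤ b + h, q i =
          ∑ i ∈ s with v i ≤ b, q i + ∑ i ∈ s with b < v i ∧ v i ≤ b + h, q i := fun q => by
        rw [← Finset.sum_filter_add_sum_filter_not (s.filter fun i => v i ≤ b + h)
          (fun i => v i ≤ b), Finset.filter_filter, Finset.filter_filter]
        congr 1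
        · refine Finset.sum_congr (Finset.filter_congr fun i _ => ?_) fun _ _ => rfl
          exact ⟨fun h => h.2, fun h => ⟨by linarith, h⟩⟩
        · refine Finset.sum_congr (Finset.filter_congr fun i _ => ?_) fun _ _ => rfl
          rw [not_le, and_comm]
      set S := s.filter fun i => b < v i ∧ v i ≤ b + h with hS
      have hgχ : ∀ a c, IntervalIntegrable (fun t => g t * χ t) volume a c :=
        hχ.intervalIntegrable_mul hg
      have hint : ∫ t in (0 : ℝ)..(b + h), g t * χ t =
          (∫ t in (0 : ℝ)..b, g t * χ t) + ∫ t in b..(b + h), g t * χ t :=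
        (intervalIntegral.integral_add_adjacent_intervals (hgχ _ _) (hgχ _ _)).symm
      have hI : I (b + h) = I b + ∫ t in b..(b + h), χ t :=
        (intervalIntegral.integral_add_adjacent_intervals (hχ.intervalIntegrable _ _)
          (hχ.intervalIntegrable _ _)).symm
      have hF : F (b + h) = F b + ∑ i ∈ S, w i := hsplit w
      have e1 : |∑ i ∈ S, w i * g (v i) - g b * ∑ i ∈ S, w i| ≤ ω * ∑ i ∈ S, w i := by
        rw [Finset.mul_sum, Finset.mul_sum, ← Finset.sum_sub_distrib]
        refine (Finset.abs_sum_le_sum_abs _ _).trans (Finset.sum_le_sum fun i hi => ?_)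
        obtain ⟨hi1, hi2, hi3⟩ := Finset.mem_filter.mp hi
        rw [mul_comm (g b), ← mul_sub, abs_mul, abs_of_nonneg (hw i hi1), mul_comm]
        refine mul_le_mul_of_nonneg_right (hω _ (hv i hi1) _ hbm ?_) (hw i hi1)
        rw [abs_of_pos (by linarith)]; linarith
      have e2 : |(∫ t in b..(b + h), g t * χ t) - g b * ∫ t in b..(b + h), χ t| ≤
          ω * ∫ t in b..(b + h), χ t := by
        rw [← intervalIntegral.integral_const_mul, ← intervalIntegral.integral_const_mul,
          ← intervalIntegral.integral_sub (hgχ _ _) ((hχ.intervalIntegrable _ _).const_mul _)]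
        refine (intervalIntegral.abs_integral_le_integral_abs (by linarith)).trans ?_
        refine intervalIntegral.integral_mono_on (by linarith)
          ((hgχ _ _).sub ((hχ.intervalIntegrable _ _).const_mul _)).abs
          ((hχ.intervalIntegrable _ _).const_mul _) fun t ht => ?_
        rw [← sub_mul, abs_mul, abs_of_nonneg (hχ.nonneg t)]
        refine mul_le_mul_of_nonneg_right (hω _ ⟨by linarith [ht.1], by linarith [ht.2]⟩ _ hbm ?_)
          (hχ.nonneg t)
        rw [abs_of_nonneg (by linarith [ht.1])]; linarith [ht.2]
      have e3 : |g b * (∑ i ∈ S, w i - ∫ t in b..(b + h), χ t)| ≤ 2 * η := by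
        rw [abs_mul]
        have c1 : |F b - I b| ≤ η := hcdf b hbm
        have c2 : |F (b + h) - I (b + h)| ≤ η := hcdf (b + h) hbhm
        rw [hF, hI] at c2
        have c3 : |∑ i ∈ S, w i - ∫ t in b..(b + h), χ t| ≤ 2 * η := by
          rw [abs_le] at *
          constructor <;> linarith
        calc _ ≤ 1 * |∑ i ∈ S, w i - ∫ t in b..(b + h), χ t| :=
              mul_le_mul_of_nonneg_right (hg1 b hbm) (abs_nonneg _)
          _ ≤ 2 * η := by rw [one_mul]; exact c3
      rw [hsplit, hint, hF, hI]
      rw [mul_sub] at e3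
      rw [abs_le] at *
      push_cast
      constructor <;> linarith
  have h1 := key N le_rfl
  rw [hNh] at h1
  have h2 : ∀ q : ι → ℝ, ∑ i ∈ s with v i ≤ u, q i = ∑ i ∈ s, q i := fun q => by
    rw [Finset.filter_true_of_mem fun i hi => (hv i hi).2]
  rw [h2] at h1
  have h3 : I u ≤ u := by
    have : ∫ t in (0 : ℝ)..u, χ t ≤ ∫ _ in (0 : ℝ)..u, (1 : ℝ) :=
      intervalIntegral.integral_mono_on hu (hχ.intervalIntegrable _ _) intervalIntegrable_const
        fun t _ => hχ.le_one t
    simpa using this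
  have h4 : F u - I u ≤ η := (le_abs_self _).trans (hcdf u ⟨hu, le_rfl⟩)
  refine h1.trans (add_le_add_left (mul_le_mul_of_nonneg_left ?_ hω0) _)
  linarith

/-! ### Mean values of multiplicative functions -/

/-- The distribution of the weights `Λ(d) f(d) / d`, in the logarithmic scale with unit `log y`, is
within `η` of the measure with density `χ`, on the interval `[0, U]`. -/
def CdfClose (χ : ℝ → ℝ) (f : ℕ → ℝ) (y U η : ℝ) : Prop :=
  ∀ t ∈ Icc (1 : ℝ) (y ^ U), |∑ d ∈ Finset.Icc 1 ⌊t⌋₊, vonMangoldt d * f d / d -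
    Real.log y * ∫ v in (0 : ℝ)..(Real.log t / Real.log y), χ v| ≤ η * Real.log y

/-- Under `CdfClose`, sums over `d ≤ x` of a test function of `log d / log y` with weights
`Λ(d) f(d) / d` are close to integrals of the test function against `χ`. -/
theorem CdfClose.abs_sum_sub_le {χ g : ℝ → ℝ} {f : ℕ → ℝ} {y U η ω x : ℝ} {N : ℕ}
    (h : CdfClose χ f y U η) (hχ : IsKernel χ) (hg : Continuous g) (hf : ∀ n, 0 ≤ f n)
    (hN : 0 < N) (hy : 1 < y) (hx : x ∈ Icc (1 : ℝ) (y ^ U))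
    (hg1 : ∀ a ∈ Icc 0 (Real.log x / Real.log y), |g a| ≤ 1)
    (hω : ∀ a ∈ Icc 0 (Real.log x / Real.log y), ∀ b ∈ Icc 0 (Real.log x / Real.log y),
      |a - b| ≤ Real.log x / Real.log y / N → |g a - g b| ≤ ω) :
    |∑ d ∈ Finset.Icc 1 ⌊x⌋₊, vonMangoldt d * f d / d * g (Real.log d / Real.log y) -
      Real.log y * ∫ v in (0 : ℝ)..(Real.log x / Real.log y), g v * χ v| ≤
      (ω * (2 * (Real.log x / Real.log y) + η) + (2 * N + 1) * η) * Real.log y := by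
  have hL : 0 < Real.log y := Real.log_pos hy
  have hx0 : 0 < x := by linarith [hx.1]
  set L := Real.log y
  set u := Real.log x / L with hu
  have hu0 : 0 ≤ u := div_nonneg (Real.log_nonneg hx.1) hL.le
  have key := abs_sum_sub_integral_le (Finset.Icc 1 ⌊x⌋₊) (fun d => Real.log d / L)
    (fun d => vonMangoldt d * f d / d / L) hχ hg (η := η) (ω := ω) hN hu0 ?_ ?_ ?_ hg1 hω
  · have e : ∑ d ∈ Finset.Icc 1 ⌊x⌋₊, vonMangoldt d * f d / d * g (Real.log d / L) -
        L * ∫ v in (0 : ℝ)..u, g v * χ v =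
        (∑ d ∈ Finset.Icc 1 ⌊x⌋₊, vonMangoldt d * f d / d / L * g (Real.log d / L) -
          ∫ v in (0 : ℝ)..u, g v * χ v) * L := by
      rw [sub_mul, Finset.sum_mul, mul_comm L]
      congr 1
      refine Finset.sum_congr rfl fun d _ => ?_
      field_simp
    rw [e, abs_mul, abs_of_pos hL]
    exact mul_le_mul_of_nonneg_right key hL.le
  · intro d _
    have := ArithmeticFunction.vonMangoldt_nonneg (n := d)
    have := hf d
    positivity
  · intro d hd
    rw [Finset.mem_Icc, Nat.le_floor_iff hx0.le] at hd
    have hd1 : (1 : ℝ) ≤ d := by exact_mod_cast hd.1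
    exact ⟨div_nonneg (Real.log_nonneg hd1) hL.le,
      div_le_div_of_nonneg_right (Real.log_le_log (by linarith) hd.2) hL.le⟩
  · intro b hb
    have hyb : Real.log (y ^ b) = b * L := Real.log_rpow (by linarith) b
    have hyb0 : 0 < y ^ b := Real.rpow_pos_of_pos (by linarith) b
    have hbx : y ^ b ≤ x := by
      rw [← Real.log_le_log_iff hyb0 hx0, hyb]
      calc b * L ≤ u * L := mul_le_mul_of_nonneg_right hb.2 hL.le
        _ = Real.log x := by rw [hu]; field_simp
    have h1 := h (y ^ b) ⟨Real.one_le_rpow hy.le hb.1, hbx.trans hx.2⟩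
    rw [hyb, mul_div_assoc, div_self hL.ne', mul_one] at h1
    have h2 : (Finset.Icc 1 ⌊x⌋₊).filter (fun d : ℕ => Real.log d / L ≤ b) =
        Finset.Icc 1 ⌊y ^ b⌋₊ := by
      ext d
      simp only [Finset.mem_filter, Finset.mem_Icc, Nat.le_floor_iff hx0.le,
        Nat.le_floor_iff hyb0.le]
      constructor
      · rintro ⟨⟨h3, h4⟩, h5⟩
        have hd : (0 : ℝ) < d := by exact_mod_cast h3
        rw [div_le_iff₀ hL, ← hyb, Real.log_le_log_iff hd hyb0] at h5
        exact ⟨h3, h5⟩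
      · rintro ⟨h3, h4⟩
        have hd : (0 : ℝ) < d := by exact_mod_cast h3
        refine ⟨⟨h3, h4.trans hbx⟩, ?_⟩
        rw [div_le_iff₀ hL, ← hyb]
        exact Real.log_le_log hd h4
    rw [h2]
    have e : ∑ d ∈ Finset.Icc 1 ⌊y ^ b⌋₊, vonMangoldt d * f d / d / L - ∫ t in (0 : ℝ)..b, χ t =
        (∑ d ∈ Finset.Icc 1 ⌊y ^ b⌋₊, vonMangoldt d * f d / d - L * ∫ t in (0 : ℝ)..b, χ t) / L := by
      rw [sub_div, Finset.sum_div, mul_div_assoc, mul_div_cancel₀ _ hL.ne']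
    rw [e, abs_div, abs_of_pos hL, div_le_iff₀ hL]
    exact h1

/-- Sums of test functions with a common modulus of continuity `κ ↦ ε` against the weights
`Λ(d) f(d) / d` are close to integrals against `χ`, uniformly. -/
theorem exists_test_function_bound {U ε κ : ℝ} (hU : 0 ≤ U) (hε : 0 < ε) (hκ : 0 < κ) :
    ∃ η > 0, ∀ (χ g : ℝ → ℝ) (f : ℕ → ℝ) (y x : ℝ), CdfClose χ f y U η → IsKernel χ →
      Continuous g → (∀ n, 0 ≤ f n) → 1 < y → x ∈ Icc (1 : ℝ) (y ^ U) →
      (∀ a ∈ Icc 0 (Real.log x / Real.log y), |g a| ≤ 1) →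
      (∀ a ∈ Icc 0 (Real.log x / Real.log y), ∀ b ∈ Icc 0 (Real.log x / Real.log y),
        |a - b| ≤ κ → |g a - g b| ≤ ε) →
      |∑ d ∈ Finset.Icc 1 ⌊x⌋₊, vonMangoldt d * f d / d * g (Real.log d / Real.log y) -
        Real.log y * ∫ v in (0 : ℝ)..(Real.log x / Real.log y), g v * χ v| ≤
        (2 * U + 2) * ε * Real.log y := by
  obtain ⟨N, hN⟩ := exists_nat_gt (U / κ)
  have hN0 : (0 : ℝ) < N := (div_nonneg hU hκ.le).trans_lt hN
  refine ⟨min 1 (ε / (2 * N + 1)), lt_min one_pos (by positivity),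
    fun χ g f y x hcdf hχ hg hf hy hx hg1 hω => ?_⟩
  have hL : 0 < Real.log y := Real.log_pos hy
  have hu : Real.log x / Real.log y ≤ U := by
    rw [div_le_iff₀ hL, ← Real.log_rpow (by linarith)]
    exact Real.log_le_log (by linarith [hx.1]) hx.2
  refine (hcdf.abs_sum_sub_le hχ hg hf (by exact_mod_cast hN0) hy hx hg1
    fun a ha b hb hab => hω a ha b hb (hab.trans ?_)).trans
      (mul_le_mul_of_nonneg_right ?_ hL.le)
  · rw [div_le_iff₀ hN0]
    rw [div_lt_iff₀ hκ] at hN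
    linarith
  · have h1 := min_le_left 1 (ε / (2 * N + 1))
    have h2 : (2 * (N : ℝ) + 1) * min 1 (ε / (2 * N + 1)) ≤ ε := by
      have := min_le_right 1 (ε / (2 * (N : ℝ) + 1))
      rwa [le_div_iff₀ (by positivity), mul_comm] at this
    nlinarith

theorem isKernel_one : IsKernel fun _ => 1 :=
  ⟨measurable_const, fun _ => zero_le_one, fun _ => le_rfl, fun _ _ => rfl⟩

theorem cdfClose_one {y U η : ℝ} (hy : 1 < y) (h : 10 ≤ η * Real.log y) :
    CdfClose (fun _ => 1) (fun _ => 1) y U η := fun t ht => by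
  have hL : 0 < Real.log y := Real.log_pos hy
  have h1 := abs_sum_vonMangoldt_div_sub_log_le ht.1
  simp only [mul_one, intervalIntegral.integral_const, sub_zero, smul_eq_mul]
  rw [mul_div_cancel₀ _ hL.ne']
  exact h1.trans h

theorem exists_modulus {σ : ℝ → ℝ} (hσ : Continuous σ) (U : ℝ) {ε : ℝ} (hε : 0 < ε) :
    ∃ κ > 0, ∀ a ∈ Icc 0 U, ∀ b ∈ Icc 0 U, |a - b| ≤ κ → |σ a - σ b| ≤ ε := by
  have h := isCompact_Icc.uniformContinuousOn_of_continuous (hσ.continuousOn (s := Icc 0 U))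
  obtain ⟨δ, hδ, h1⟩ := Metric.uniformContinuousOn_iff.mp h ε hε
  refine ⟨δ / 2, by positivity, fun a ha b hb hab => ?_⟩
  have := h1 a ha b hb (by rw [Real.dist_eq]; linarith)
  rw [Real.dist_eq] at this
  exact this.le

theorem abs_sub_le_one_of_mem {a b : ℝ} (ha : 0 ≤ a) (ha' : a ≤ 1) (hb : 0 ≤ b) (hb' : b ≤ 1) :
    |a - b| ≤ 1 := by
  rw [abs_le]; constructor <;> linarith

/-- **Mean values via delay equations.** Let `f` be completely multiplicative with values in
`[0, 1]` and `f(n) = 1` for `n ≤ y`. If the values `f(p)` are distributed like `χ` in the scale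
`log y`, then the mean value of `f` up to `x` is close to `σ(log x / log y)`. -/
theorem DelayPair.exists_mean_value {χ σ : ℝ → ℝ} (h : DelayPair χ σ) {U ε : ℝ} (hU : 1 ≤ U)
    (hε : 0 < ε) : ∃ η > 0, ∃ Y : ℝ, 1 < Y ∧ ∀ y ≥ Y, ∀ f : ℕ → ℝ,
      (∀ m n, 0 < m → 0 < n → f (m * n) = f m * f n) → (∀ n, 0 ≤ f n) → (∀ n, f n ≤ 1) →
      (∀ n : ℕ, 0 < n → (n : ℝ) ≤ y → f n = 1) → CdfClose χ f y U η →
      ∀ x ∈ Icc (1 : ℝ) (y ^ U),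
        |summatory f x / x - σ (Real.log x / Real.log y)| ≤ 1 / x + ε := by
  have hE : 0 < Real.exp (4 * U) := Real.exp_pos _
  -- `ε₁` is the error allowed in one step of the iteration below
  set ε₁ := ε / (3 * Real.exp (4 * U)) with hε₁
  have hε₁0 : 0 < ε₁ := by positivity
  have hU2 : 0 < 2 * U + 2 := by linarith
  obtain ⟨κ, hκ, hmod⟩ := exists_modulus h.continuous U
    (by positivity : 0 < ε₁ / 2 / (2 * U + 2))
  obtain ⟨κ', hκ', hmod'⟩ := exists_modulus (σ := fun v => Real.exp (-4 * v)) (by fun_prop) U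
    (by positivity : 0 < 1 / 4 / (2 * U + 2))
  obtain ⟨η, hη, htest⟩ := exists_test_function_bound (U := U) (by linarith)
    (by positivity : 0 < ε₁ / 2 / (2 * U + 2)) hκ
  obtain ⟨η', hη', htest'⟩ := exists_test_function_bound (U := U) (by linarith)
    (by positivity : 0 < 1 / 4 / (2 * U + 2)) hκ'
  refine ⟨η, hη, Real.exp (10 / η' + 16 / ε₁ + 1), Real.one_lt_exp_iff.mpr (by positivity),
    fun y hy f hmul hf0 hf1 hfy hcdf => ?_⟩
  have hy1 : 1 < y := lt_of_lt_of_le (Real.one_lt_exp_iff.mpr (by positivity)) hy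
  have hy0 : 0 < y := by linarith
  have hLbig : 10 / η' + 16 / ε₁ + 1 ≤ Real.log y := by
    rwa [Real.le_log_iff_exp_le hy0]
  set L := Real.log y with hLdef
  have hL : 0 < L := Real.log_pos hy1
  have hLη : 10 ≤ η' * L := by
    have : 10 / η' ≤ L := by linarith [show 0 < 16 / ε₁ by positivity]
    rwa [div_le_iff₀ hη', mul_comm] at this
  have hLε : 8 ≤ ε₁ / 2 * L := by
    have : 16 / ε₁ ≤ L := by linarith [show 0 < 10 / η' by positivity]
    rw [div_le_iff₀ hε₁0] at this
    linarith
  have hone := cdfClose_one (U := U) hy1 hLη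
  have hlogU : ∀ x ∈ Icc (1 : ℝ) (y ^ U), Real.log x / L ∈ Icc 0 U := fun x hx => by
    refine ⟨div_nonneg (Real.log_nonneg hx.1) hL.le, ?_⟩
    rw [div_le_iff₀ hL, hLdef, ← Real.log_rpow hy0]
    exact Real.log_le_log (by linarith [hx.1]) hx.2
  let e : ℝ → ℝ := fun z => summatory f z / z - σ (Real.log z / L)
  have hM0 : ∀ z, 0 ≤ summatory f z := fun z => Finset.sum_nonneg fun n _ => hf0 n
  have hM1 : ∀ z, 1 ≤ z → summatory f z ≤ z := fun z hz => by
    calc summatory f z ≤ ∑ n ∈ Finset.Icc 1 ⌊z⌋₊, (1 : ℝ) := Finset.sum_le_sum fun n _ => hf1 n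
      _ = ⌊z⌋₊ := by simp
      _ ≤ z := Nat.floor_le (by linarith)
  have he1 : ∀ z, 1 ≤ z → |e z| ≤ 1 := fun z hz =>
    abs_sub_le_one_of_mem (div_nonneg (hM0 z) (by linarith))
      ((div_le_one (by linarith)).mpr (hM1 z hz)) (h.nonneg _) (h.le_one _)
  have hesmall : ∀ z, 1 ≤ z → z ≤ y → |e z| ≤ 1 / z := fun z hz hzy => by
    have h1 : summatory f z = ⌊z⌋₊ := by
      rw [summatory, Finset.sum_congr rfl fun n hn => ?_]
      · rw [Finset.sum_const, Nat.card_Icc, Nat.add_sub_cancel, nsmul_eq_mul, mul_one]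
      · rw [Finset.mem_Icc, Nat.le_floor_iff (by linarith)] at hn
        exact hfy n hn.1 (hn.2.trans hzy)
    have h2 : σ (Real.log z / L) = 1 :=
      h.eq_one _ ((div_le_one hL).mpr (Real.log_le_log (by linarith) hzy))
    have hz0 : 0 < z := by linarith
    have h3 : (⌊z⌋₊ : ℝ) ≤ z := Nat.floor_le hz0.le
    have h4 : z < ⌊z⌋₊ + 1 := Nat.lt_floor_add_one z
    change |summatory f z / z - σ (Real.log z / L)| ≤ 1 / z
    rw [h1, h2, show (⌊z⌋₊ : ℝ) / z - 1 = -((z - ⌊z⌋₊) / z) by field_simp; ring, abs_neg,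
      abs_of_nonneg (div_nonneg (by linarith) hz0.le)]
    gcongr
    linarith
  -- one step of the iteration: a bound `1 / z + B e^{4 log z / L}` for the error improves itself
  have hstep : ∀ B : ℝ, 0 ≤ B →
      (∀ z ∈ Icc (1 : ℝ) (y ^ U), |e z| ≤ 1 / z + B * Real.exp (4 * (Real.log z / L))) →
      ∀ z ∈ Icc (1 : ℝ) (y ^ U), |e z| ≤ 1 / z + (B / 2 + ε₁) * Real.exp (4 * (Real.log z / L)) := by
    intro B hB hbound x hx
    have hx0 : 0 < x := by linarith [hx.1]
    rcases le_or_gt x y with hxy | hxy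
    · exact (hesmall x hx.1 hxy).trans (le_add_of_nonneg_right (by positivity))
    set u := Real.log x / L with hu
    have huU : u ∈ Icc 0 U := hlogU x hx
    have hLx : L ≤ Real.log x := Real.log_le_log hy0 hxy.le
    have hlogx : Real.log x = L * u := by rw [hu, mul_div_cancel₀ _ hL.ne']
    have hd : ∀ d ∈ Finset.Icc 1 ⌊x⌋₊, (1 : ℝ) ≤ d ∧ (d : ℝ) ≤ x := fun d hd => by
      rw [Finset.mem_Icc, Nat.le_floor_iff hx0.le] at hd
      exact ⟨by exact_mod_cast hd.1, hd.2⟩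
    have hlogd : ∀ d ∈ Finset.Icc 1 ⌊x⌋₊, Real.log (x / d) / L = u - Real.log d / L := fun d h => by
      rw [Real.log_div hx0.ne' (by linarith [(hd d h).1]), sub_div]
    have t1 := abs_summatory_mul_log_sub_le hmul hf0 hf1 hx.1
    have t2 := htest χ (fun v => σ (u - v)) f y x hcdf h.kernel
      (h.continuous.comp (by fun_prop)) hf0 hy1 hx
      (fun a _ => by rw [abs_of_nonneg (h.nonneg _)]; exact h.le_one _)
      (fun a ha b hb hab => hmod _ ⟨by linarith [ha.2], by linarith [ha.1, huU.2]⟩ _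
        ⟨by linarith [hb.2], by linarith [hb.1, huU.2]⟩
        (by rw [show u - a - (u - b) = -(a - b) by ring, abs_neg]; exact hab))
    rw [← h.integral_eq u huU.1] at t2
    have t3 := htest' (fun _ => 1) (fun v => Real.exp (-4 * v)) (fun _ => 1) y x hone isKernel_one
      (by fun_prop) (fun _ => zero_le_one) hy1 hx
      (fun a ha => by
        rw [abs_of_pos (Real.exp_pos _)]; exact Real.exp_le_one_iff.mpr (by linarith [ha.1]))
      (fun a ha b hb hab => hmod' a ⟨ha.1, ha.2.trans huU.2⟩ b ⟨hb.1, hb.2.trans huU.2⟩ hab)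
    have t4 : ∫ v in (0 : ℝ)..u, Real.exp (-4 * v) * 1 ≤ 1 / 4 :=
      isKernel_one.integral_exp_neg_le (by norm_num) huU.1
    have e1 : (2 * U + 2) * (ε₁ / 2 / (2 * U + 2)) * L = ε₁ / 2 * L := by field_simp
    have e2 : (2 * U + 2) * (1 / 4 / (2 * U + 2)) * L = L / 4 := by field_simp
    rw [e1] at t2
    rw [e2] at t3
    have t5 : ∑ d ∈ Finset.Icc 1 ⌊x⌋₊, vonMangoldt d / d * Real.exp (-4 * (Real.log d / L)) ≤ L / 2 := by
      have := (abs_le.mp t3).2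
      simp only [mul_one] at this t4
      nlinarith
    have hΛ : ∀ d : ℕ, 0 ≤ vonMangoldt d / d := fun d => by
      have := ArithmeticFunction.vonMangoldt_nonneg (n := d)
      positivity
    -- the sum over `d` of the errors at `x / d`
    have t6 : |∑ d ∈ Finset.Icc 1 ⌊x⌋₊, vonMangoldt d * f d / d * e (x / d)| ≤
        6 + B * Real.exp (4 * u) * (L / 2) := by
      calc |∑ d ∈ Finset.Icc 1 ⌊x⌋₊, vonMangoldt d * f d / d * e (x / d)|
          ≤ ∑ d ∈ Finset.Icc 1 ⌊x⌋₊, |vonMangoldt d * f d / d * e (x / d)| :=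
            Finset.abs_sum_le_sum_abs _ _
        _ ≤ ∑ d ∈ Finset.Icc 1 ⌊x⌋₊, (vonMangoldt d / x +
            B * Real.exp (4 * u) * (vonMangoldt d / d * Real.exp (-4 * (Real.log d / L)))) := by
            refine Finset.sum_le_sum fun d hd' => ?_
            obtain ⟨hd1, hdx⟩ := hd d hd'
            have hd0 : (0 : ℝ) < d := by linarith
            have c1 := hbound (x / d) ⟨(one_le_div hd0).mpr hdx,
              (div_le_self hx0.le hd1).trans hx.2⟩
            rw [hlogd d hd'] at c1
            rw [show vonMangoldt d * f d / d = (vonMangoldt d / d) * f d by ring, abs_mul,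
              abs_of_nonneg (mul_nonneg (hΛ d) (hf0 d))]
            calc vonMangoldt d / d * f d * |e (x / d)|
                ≤ vonMangoldt d / d * (1 / (x / d) + B * Real.exp (4 * (u - Real.log d / L))) :=
                  mul_le_mul (mul_le_of_le_one_right (hΛ d) (hf1 d)) c1 (abs_nonneg _) (hΛ d)
              _ = _ := by
                  rw [show 4 * (u - Real.log d / L) = 4 * u + -4 * (Real.log d / L) by ring,
                    Real.exp_add]
                  field_simp
        _ = (∑ d ∈ Finset.Icc 1 ⌊x⌋₊, vonMangoldt d) / x + B * Real.exp (4 * u) *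
            ∑ d ∈ Finset.Icc 1 ⌊x⌋₊, vonMangoldt d / d * Real.exp (-4 * (Real.log d / L)) := by
            rw [Finset.sum_add_distrib, Finset.sum_div, Finset.mul_sum]
        _ ≤ _ := by
            refine add_le_add ?_ (mul_le_mul_of_nonneg_left t5 (by positivity))
            rw [div_le_iff₀ hx0]
            exact sum_vonMangoldt_le hx0.le
    have t7 : ∑ d ∈ Finset.Icc 1 ⌊x⌋₊, vonMangoldt d * f d / d * e (x / d) =
        (∑ d ∈ Finset.Icc 1 ⌊x⌋₊, vonMangoldt d * f d * summatory f (x / d)) / x -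
        ∑ d ∈ Finset.Icc 1 ⌊x⌋₊, vonMangoldt d * f d / d * σ (u - Real.log d / L) := by
      rw [Finset.sum_div, ← Finset.sum_sub_distrib]
      refine Finset.sum_congr rfl fun d hd' => ?_
      have hd0 : (d : ℝ) ≠ 0 := by linarith [(hd d hd').1]
      simp only [e]
      rw [hlogd d hd']
      field_simp
    have t8 : |summatory f x / x * Real.log x -
        (∑ d ∈ Finset.Icc 1 ⌊x⌋₊, vonMangoldt d * f d * summatory f (x / d)) / x| ≤ 2 := by
      rw [show summatory f x / x * Real.log x -
        (∑ d ∈ Finset.Icc 1 ⌊x⌋₊, vonMangoldt d * f d * summatory f (x / d)) / x =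
        (summatory f x * Real.log x -
          ∑ d ∈ Finset.Icc 1 ⌊x⌋₊, vonMangoldt d * f d * summatory f (x / d)) / x by ring,
        abs_div, abs_of_pos hx0, div_le_iff₀ hx0]
      exact t1
    have t9 : Real.log x * |e x| ≤ 8 + B * Real.exp (4 * u) * (L / 2) + ε₁ / 2 * L := by
      rw [← abs_of_nonneg (hL.le.trans hLx), ← abs_mul]
      have : Real.log x * e x = summatory f x / x * Real.log x - L * (u * σ u) := by
        simp only [e]
        rw [← hu, hlogx]; ring
      rw [this]
      rw [t7] at t6
      rw [abs_le] at *
      constructor <;> linarith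
    have hexp1 : 1 ≤ Real.exp (4 * u) := Real.one_le_exp (by linarith [huU.1])
    have t10 : L * |e x| ≤ L * ((B / 2 + ε₁) * Real.exp (4 * u)) := by
      have := mul_le_mul_of_nonneg_right hLx (abs_nonneg (e x))
      nlinarith [mul_pos hL hε₁0]
    have t11 := le_of_mul_le_mul_left t10 hL
    have : 0 < 1 / x := by positivity
    linarith
  have hiter : ∀ n : ℕ, ∀ z ∈ Icc (1 : ℝ) (y ^ U),
      |e z| ≤ 1 / z + ((1 / 2) ^ n + 2 * ε₁) * Real.exp (4 * (Real.log z / L)) := by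
    intro n
    induction n with
    | zero =>
      intro z hz
      have h1 : 1 ≤ Real.exp (4 * (Real.log z / L)) :=
        Real.one_le_exp (by linarith [(hlogU z hz).1])
      have h2 : 0 < 1 / z := by have := hz.1; positivity
      rw [pow_zero]
      nlinarith [he1 z hz.1]
    | succ n ih =>
      intro z hz
      refine (hstep _ (by positivity) ih z hz).trans_eq ?_
      rw [pow_succ]; ring
  intro x hx
  obtain ⟨n, hn⟩ := exists_pow_lt_of_lt_one hε₁0 (by norm_num : (1 / 2 : ℝ) < 1)
  refine (hiter n x hx).trans (add_le_add_right ?_ _)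
  calc ((1 / 2) ^ n + 2 * ε₁) * Real.exp (4 * (Real.log x / L)) ≤ (3 * ε₁) * Real.exp (4 * U) := by
        refine mul_le_mul (by linarith) (Real.exp_le_exp.mpr ?_) (Real.exp_pos _).le (by positivity)
        linarith [(hlogU x hx).2]
    _ = ε := by rw [hε₁]; field_simp

/-! ### From counts of primes to logarithmic weights -/

theorem primesUpTo_eq_filter_floor (x : ℝ) (c : ℕ → ℝ) :
    ∑ n ∈ Finset.Icc 0 ⌊x⌋₊, (if n.Prime then c n else 0) = ∑ p ∈ primesUpTo x, c p := by
  rw [primesUpTo, Finset.sum_filter, ← Finset.add_sum_Ioc_eq_sum_Icc (Nat.zero_le _)]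
  simp only [Nat.not_prime_zero, if_false, zero_add]
  rfl

/-- Partial summation: if `∑_{p ≤ s} a_p = O(η s / log s)` for `s ≥ y` and `a_p = 0` for `p ≤ y`,
then `∑_{p ≤ t} a_p log p / p = O(η log t)`. -/
theorem abs_sum_log_div_le {a : ℕ → ℝ} {y t η : ℝ} (hy : Real.exp 1 ≤ y) (hyt : y ≤ t) (hη : 0 ≤ η)
    (ha : ∀ p : ℕ, (p : ℝ) ≤ y → a p = 0)
    (hA : ∀ s ∈ Icc y t, |∑ p ∈ primesUpTo s, a p| ≤ η * (s / Real.log s)) :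
    |∑ p ∈ primesUpTo t, a p * (Real.log p / p)| ≤ η * (1 + Real.log t) := by
  have hy1 : 1 < y := lt_of_lt_of_le (by linarith [Real.add_one_lt_exp one_ne_zero]) hy
  have hy0 : 0 < y := by linarith
  let c : ℕ → ℝ := fun n => if n.Prime then a n else 0
  have hzero : ∀ s ≤ y, ∑ n ∈ Finset.Icc 0 ⌊s⌋₊, c n = 0 := fun s hs => by
    refine Finset.sum_eq_zero fun n hn => ?_
    rw [Finset.mem_Icc] at hn
    have h1 : (n : ℝ) ≤ y := (Nat.cast_le.mpr (hn.2.trans (Nat.floor_mono hs))).trans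
      (Nat.floor_le hy0.le)
    simp [c, ha n h1]
  have hderiv : ∀ s ∈ Icc y t, HasDerivAt (fun s => Real.log s / s) ((1 - Real.log s) / s ^ 2) s :=
    fun s hs => by
      have hs0 : s ≠ 0 := by linarith [hs.1]
      have := (Real.hasDerivAt_log hs0).div (hasDerivAt_id s) hs0
      refine this.congr_deriv ?_
      simp [hs0]
  have hcont : ContinuousOn (fun s : ℝ => (1 - Real.log s) / s ^ 2) (Icc y t) := fun s hs => by
    have hs0 : s ≠ 0 := by linarith [hs.1]
    have : ContinuousAt (fun s : ℝ => (1 - Real.log s) / s ^ 2) s :=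
      ((Real.continuousAt_log hs0).const_sub 1).div (continuousAt_id.pow 2) (pow_ne_zero 2 hs0)
    exact this.continuousWithinAt
  have hint : IntegrableOn (deriv fun s => Real.log s / s) (Icc y t) :=
    (hcont.integrableOn_Icc).congr_fun (fun s hs => ((hderiv s hs).deriv).symm) measurableSet_Icc
  have habel := sum_mul_eq_sub_sub_integral_mul c (f := fun s => Real.log s / s) hy0.le hyt
    (fun s hs => (hderiv s hs).differentiableAt) hint
  rw [hzero y le_rfl, mul_zero, sub_zero] at habel
  have hlhs : ∑ k ∈ Finset.Ioc ⌊y⌋₊ ⌊t⌋₊, Real.log k / k * c k =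
      ∑ p ∈ primesUpTo t, a p * (Real.log p / p) := by
    rw [← primesUpTo_eq_filter_floor t]
    have hsub : Finset.Ioc ⌊y⌋₊ ⌊t⌋₊ ⊆ Finset.Icc 0 ⌊t⌋₊ := fun n hn => by
      rw [Finset.mem_Ioc] at hn; exact Finset.mem_Icc.mpr ⟨Nat.zero_le _, hn.2⟩
    rw [← Finset.sum_subset hsub]
    · refine Finset.sum_congr rfl fun n _ => ?_
      simp only [c]; split_ifs <;> ring
    · intro n hn hn'
      rw [Finset.mem_Icc] at hn
      rw [Finset.mem_Ioc, not_and, not_le] at hn'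
      have h1 : n ≤ ⌊y⌋₊ := by
        by_contra! hlt
        exact absurd (hn' hlt) (not_lt.mpr hn.2)
      rw [ha n ((Nat.cast_le.mpr h1).trans (Nat.floor_le hy0.le))]
      simp
  rw [hlhs] at habel
  rw [habel]
  have hlogt : 1 ≤ Real.log t := by
    rw [Real.le_log_iff_exp_le (by linarith)]; linarith
  have hA' : ∀ s ∈ Icc y t, |∑ n ∈ Finset.Icc 0 ⌊s⌋₊, c n| ≤ η * (s / Real.log s) := fun s hs => by
    rw [primesUpTo_eq_filter_floor s]; exact hA s hs
  have b1 : |Real.log t / t * ∑ n ∈ Finset.Icc 0 ⌊t⌋₊, c n| ≤ η := by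
    have ht0 : 0 < t := by linarith
    rw [abs_mul, abs_of_nonneg (by positivity)]
    calc Real.log t / t * |∑ n ∈ Finset.Icc 0 ⌊t⌋₊, c n|
        ≤ Real.log t / t * (η * (t / Real.log t)) :=
          mul_le_mul_of_nonneg_left (hA' t ⟨hyt, le_rfl⟩) (by positivity)
      _ = η := by field_simp
  have b2 : |∫ s in Ioc y t, deriv (fun s => Real.log s / s) s * ∑ n ∈ Finset.Icc 0 ⌊s⌋₊, c n| ≤
      η * Real.log t := by
    have hii : IntegrableOn (fun s : ℝ => η * s⁻¹) (Ioc y t) := by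
      refine (ContinuousOn.integrableOn_Icc fun s hs => ?_).mono_set Ioc_subset_Icc_self
      have hs0 : s ≠ 0 := by linarith [hs.1]
      exact ((continuousAt_inv₀ hs0).const_mul η).continuousWithinAt
    have hle : ‖∫ s in Ioc y t, deriv (fun s => Real.log s / s) s * ∑ n ∈ Finset.Icc 0 ⌊s⌋₊, c n‖ ≤
        ∫ s in Ioc y t, η * s⁻¹ := by
      refine norm_integral_le_of_norm_le hii ?_
      refine (ae_restrict_iff' measurableSet_Ioc).mpr (Eventually.of_forall fun s hs => ?_)
      have hs' : s ∈ Icc y t := Ioc_subset_Icc_self hs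
      have hs0 : 0 < s := by linarith [hs.1]
      have hlogs : 1 ≤ Real.log s := by
        rw [Real.le_log_iff_exp_le hs0]; linarith [hs.1]
      rw [(hderiv s hs').deriv, norm_mul, Real.norm_eq_abs, Real.norm_eq_abs, abs_div,
        abs_of_nonpos (by linarith : 1 - Real.log s ≤ 0), abs_of_pos (by positivity : 0 < s ^ 2)]
      calc -(1 - Real.log s) / s ^ 2 * |∑ n ∈ Finset.Icc 0 ⌊s⌋₊, c n|
          ≤ Real.log s / s ^ 2 * (η * (s / Real.log s)) := by
            refine mul_le_mul ?_ (hA' s hs') (abs_nonneg _) (by positivity)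
            gcongr; linarith
        _ = η * s⁻¹ := by field_simp
    rw [Real.norm_eq_abs, ← intervalIntegral.integral_of_le hyt, ← intervalIntegral.integral_of_le hyt,
      intervalIntegral.integral_const_mul, integral_inv_of_pos hy0 (by linarith),
      Real.log_div (by linarith) hy0.ne'] at hle
    rw [← intervalIntegral.integral_of_le hyt]
    refine hle.trans (mul_le_mul_of_nonneg_left ?_ hη)
    linarith [Real.log_pos hy1]
  calc _ ≤ |Real.log t / t * ∑ n ∈ Finset.Icc 0 ⌊t⌋₊, c n| +
      |∫ s in Ioc y t, deriv (fun s => Real.log s / s) s * ∑ n ∈ Finset.Icc 0 ⌊s⌋₊, c n| := abs_sub _ _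
    _ ≤ η * (1 + Real.log t) := by linarith

/-- If the primes up to `s`, counted with the weights `f`, have density about `σ(log s / log y)`, then
`f p` may be replaced by `σ(log p / log y)` on average over `p ≤ s`: by continuity of `σ` the two
arguments differ noticeably only for `p ≤ δ s`, and these primes are few. -/
theorem abs_sum_sub_card_mul_le {f : ℕ → ℝ} {σ : ℝ → ℝ} (hσ : IsKernel σ) {η' ω κ δ y s U : ℝ}
    (hy : 1 < y) (hδ : 0 < δ) (hδ1 : δ < 1) (hs : y ≤ s) (hsU : s ≤ y ^ U)
    (hδs : δ⁻¹ ^ 2 ≤ s) (hκ : Real.log δ⁻¹ ≤ κ * Real.log y) (hη' : 0 ≤ η') (hω : 0 ≤ ω)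
    (hmod : ∀ a ∈ Icc 0 U, ∀ b ∈ Icc 0 U, |a - b| ≤ κ → |σ a - σ b| ≤ ω)
    (hcount : |∑ p ∈ primesUpTo s, f p - primePi s * σ (Real.log s / Real.log y)| ≤
      η' * primePi s) :
    |∑ p ∈ primesUpTo s, (f p - σ (Real.log p / Real.log y))| ≤
      (6 * η' + 6 * ω + 12 * δ) * (s / Real.log s) := by
  have hL : 0 < Real.log y := Real.log_pos hy
  have hs1 : 1 < s := hy.trans_le hs
  have hs0 : 0 < s := by linarith
  set L := Real.log y
  have hlogs : 0 < Real.log s := Real.log_pos hs1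
  have hlogU : ∀ z : ℝ, 1 ≤ z → z ≤ s → Real.log z / L ∈ Icc 0 U := fun z hz hzs => by
    refine ⟨div_nonneg (Real.log_nonneg hz) hL.le, ?_⟩
    rw [div_le_iff₀ hL, ← Real.log_rpow (by linarith)]
    exact Real.log_le_log (by linarith) (hzs.trans hsU)
  have hπ := primePi_le hs1
  have hδs' : δ⁻¹ ≤ δ * s := by
    rw [inv_eq_one_div, div_le_iff₀ hδ]
    rw [inv_pow, inv_eq_one_div, div_le_iff₀ (by positivity)] at hδs
    nlinarith
  have hδs1 : 1 < δ * s := (one_lt_inv₀ hδ |>.mpr hδ1).trans_le hδs'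
  have hπδ : (primePi (δ * s) : ℝ) ≤ 12 * δ * (s / Real.log s) := by
    refine (primePi_le hδs1).trans ?_
    have h1 : Real.log s ≤ 2 * Real.log (δ * s) := by
      have h2 : s ≤ (δ * s) ^ 2 := by
        rw [inv_pow, inv_eq_one_div, div_le_iff₀ (by positivity)] at hδs
        nlinarith
      calc Real.log s ≤ Real.log ((δ * s) ^ 2) := Real.log_le_log hs0 h2
        _ = 2 * Real.log (δ * s) := by rw [Real.log_pow]; norm_num
    have h3 : 0 < Real.log (δ * s) := Real.log_pos hδs1
    calc 6 * (δ * s / Real.log (δ * s)) ≤ 6 * (δ * s / (Real.log s / 2)) := by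
          gcongr; linarith
      _ = 12 * δ * (s / Real.log s) := by field_simp; ring
  have hdiff : |∑ p ∈ primesUpTo s, (σ (Real.log s / L) - σ (Real.log p / L))| ≤
      ω * primePi s + primePi (δ * s) := by
    refine (Finset.abs_sum_le_sum_abs _ _).trans ?_
    have hpt : ∀ p ∈ primesUpTo s, |σ (Real.log s / L) - σ (Real.log p / L)| ≤
        ω + (if (p : ℝ) ≤ δ * s then 1 else 0) := fun p hp => by
      obtain ⟨hpp, hps⟩ := (mem_primesUpTo hs0.le).mp hp
      have hp1 : (1 : ℝ) ≤ p := by exact_mod_cast hpp.one_le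
      split_ifs with hle
      · have := abs_sub_le_one_of_mem (hσ.nonneg (Real.log s / L)) (hσ.le_one _)
          (hσ.nonneg (Real.log p / L)) (hσ.le_one _)
        linarith
      · rw [add_zero]
        refine hmod _ (hlogU s hs1.le le_rfl) _ (hlogU p hp1 hps) ?_
        rw [← sub_div, abs_of_nonneg (div_nonneg (sub_nonneg.mpr (Real.log_le_log (by linarith) hps))
          hL.le), div_le_iff₀ hL]
        have : Real.log (δ * s) ≤ Real.log p := Real.log_le_log (by positivity) (not_le.mp hle).le
        rw [Real.log_mul hδ.ne' hs0.ne'] at this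
        rw [Real.log_inv] at hκ
        linarith
    refine (Finset.sum_le_sum hpt).trans ?_
    rw [Finset.sum_add_distrib, Finset.sum_const, nsmul_eq_mul, card_primesUpTo, ← Finset.sum_filter,
      Finset.sum_const, nsmul_eq_mul, mul_one, mul_comm]
    refine add_le_add_right ?_ _
    rw [← card_primesUpTo]
    refine Nat.cast_le.mpr (Finset.card_le_card fun p hp => ?_)
    rw [Finset.mem_filter, mem_primesUpTo hs0.le] at hp
    exact (mem_primesUpTo (by positivity)).mpr ⟨hp.1.1, hp.2⟩
  have hsplit : ∑ p ∈ primesUpTo s, (f p - σ (Real.log p / L)) =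
      (∑ p ∈ primesUpTo s, f p - primePi s * σ (Real.log s / L)) +
        ∑ p ∈ primesUpTo s, (σ (Real.log s / L) - σ (Real.log p / L)) := by
    rw [Finset.sum_sub_distrib, Finset.sum_sub_distrib, Finset.sum_const, card_primesUpTo,
      nsmul_eq_mul]
    ring
  rw [hsplit]
  refine (abs_add_le _ _).trans ?_
  have h1 := mul_le_mul_of_nonneg_left hπ hη'
  have h2 := mul_le_mul_of_nonneg_left hπ hω
  linarith

/-- If among the primes up to `t` the proportion with `f(p) = 1` is close to `σ(log t / log y)`,
then the weights `Λ(d) f(d) / d` have a distribution close to `σ` in the scale `log y`. -/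
theorem DelayPair.exists_cdfClose {χ σ : ℝ → ℝ} (h : DelayPair χ σ) {U η : ℝ} (hU : 1 ≤ U)
    (hη : 0 < η) : ∃ η' > 0, ∃ Y : ℝ, 1 < Y ∧ ∀ y ≥ Y, ∀ f : ℕ → ℝ,
      (∀ n, 0 ≤ f n) → (∀ n, f n ≤ 1) → (∀ n : ℕ, (n : ℝ) ≤ y → f n = 1) →
      (∀ s ∈ Icc y (y ^ U), |∑ p ∈ primesUpTo s, f p - primePi s * σ (Real.log s / Real.log y)| ≤
        η' * primePi s) → CdfClose σ f y U η := by
  obtain ⟨C, hC, hpp⟩ := exists_prime_power_bound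
  have hU2 : 0 < 2 * U + 2 := by linarith
  obtain ⟨κ₁, hκ₁, hmod₁⟩ := exists_modulus h.continuous U
    (by positivity : 0 < η / 4 / (2 * U + 2))
  obtain ⟨η₁, hη₁, htest⟩ := exists_test_function_bound (U := U) (by linarith)
    (by positivity : 0 < η / 4 / (2 * U + 2)) hκ₁
  set τ := η / (4 * (1 + U)) with hτ
  have hτ0 : 0 < τ := by positivity
  obtain ⟨κ, hκ, hmod⟩ := exists_modulus h.continuous U (by positivity : 0 < τ / 18)
  set δ := min (τ / 36) (1 / 2) with hδ
  have hδ0 : 0 < δ := by positivity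
  have hδ1 : δ < 1 := (min_le_right _ _).trans_lt (by norm_num)
  have hδτ : δ ≤ τ / 36 := min_le_left _ _
  set B := 10 / η₁ + 4 * (2 * C) / η + 2 * Real.log δ⁻¹ + Real.log δ⁻¹ / κ + 1 with hB
  have hlogδ : 0 < Real.log δ⁻¹ := Real.log_pos (one_lt_inv₀ hδ0 |>.mpr hδ1)
  refine ⟨τ / 18, by positivity, Real.exp B, Real.one_lt_exp_iff.mpr (by positivity),
    fun y hy f hf0 hf1 hfy hcount t ht => ?_⟩
  have hB1 : 1 ≤ B := by
    have : 0 ≤ 10 / η₁ + 4 * (2 * C) / η + 2 * Real.log δ⁻¹ + Real.log δ⁻¹ / κ := by positivity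
    linarith
  have hye : Real.exp 1 ≤ y := (Real.exp_le_exp.mpr hB1).trans hy
  have hy1 : 1 < y := lt_of_lt_of_le (by linarith [Real.add_one_lt_exp one_ne_zero]) hye
  have hy0 : 0 < y := by linarith
  have hLB : B ≤ Real.log y := by rwa [Real.le_log_iff_exp_le hy0]
  have hL : 0 < Real.log y := Real.log_pos hy1
  set L := Real.log y with hLdef
  have p1 : 0 < 10 / η₁ := by positivity
  have p2 : 0 < 4 * (2 * C) / η := by positivity
  have p3 : 0 < Real.log δ⁻¹ / κ := by positivity
  have hL1 : 10 ≤ η₁ * L := by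
    have : 10 / η₁ ≤ L := by linarith
    rwa [div_le_iff₀ hη₁, mul_comm] at this
  have hL2 : 2 * C ≤ η / 4 * L := by
    have : 4 * (2 * C) / η ≤ L := by linarith
    rw [div_le_iff₀ hη] at this
    linarith
  have hL3 : Real.log δ⁻¹ ≤ κ * L := by
    have : Real.log δ⁻¹ / κ ≤ L := by linarith
    rwa [div_le_iff₀ hκ, mul_comm] at this
  have hδy : δ⁻¹ ^ 2 ≤ y := by
    rw [← Real.log_le_log_iff (by positivity) hy0, Real.log_pow]
    push_cast
    linarith
  have ht0 : 0 < t := by linarith [ht.1]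
  -- the primes, with `f(p)` replaced by `σ(log p / log y)`
  have e1 : |∑ p ∈ primesUpTo t, (f p - σ (Real.log p / L)) * (Real.log p / p)| ≤ η / 4 * L := by
    have hvan : ∀ p : ℕ, (p : ℝ) ≤ y → f p - σ (Real.log p / L) = 0 := fun p hp => by
      rw [hfy p hp, h.eq_one, sub_self]
      rw [div_le_one hL]
      rcases Nat.eq_zero_or_pos p with rfl | hp0
      · simpa using hL.le
      · exact Real.log_le_log (by exact_mod_cast hp0) hp
    rcases le_total t y with hty | hyt
    · rw [Finset.sum_eq_zero fun p hp => ?_]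
      · simp only [abs_zero]; positivity
      · rw [hvan p (((mem_primesUpTo ht0.le).mp hp).2.trans hty), zero_mul]
    · refine (abs_sum_log_div_le hye hyt hτ0.le hvan fun s hs => ?_).trans ?_
      · refine (abs_sum_sub_card_mul_le h.isKernel hy1 hδ0 hδ1 hs.1 (hs.2.trans ht.2)
          (hδy.trans hs.1) hL3 (by positivity) (by positivity) hmod
          (hcount s ⟨hs.1, hs.2.trans ht.2⟩)).trans ?_
        have : 0 < s / Real.log s :=
          div_pos (by linarith [hs.1]) (Real.log_pos (by linarith [hs.1]))
        refine mul_le_mul_of_nonneg_right ?_ this.le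
        linarith
      · have h1 : Real.log t ≤ U * L := by
          rw [← Real.log_rpow hy0]
          exact Real.log_le_log ht0 ht.2
        have h2 : 1 ≤ L := by linarith
        calc τ * (1 + Real.log t) ≤ τ * ((1 + U) * L) := by gcongr; linarith
          _ = η / 4 * L := by rw [hτ]; field_simp
  have e2 := hpp f hf0 hf1 t
  have e3 := hpp (fun d => σ (Real.log d / L)) (fun _ => h.nonneg _) (fun _ => h.le_one _) t
  have hu : Real.log t / L ≤ U := by
    rw [div_le_iff₀ hL, ← Real.log_rpow hy0]
    exact Real.log_le_log ht0 ht.2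
  have e4 := htest (fun _ => 1) σ (fun _ => 1) y t (cdfClose_one hy1 hL1) isKernel_one h.continuous
    (fun _ => zero_le_one) hy1 ht
    (fun a _ => by rw [abs_of_nonneg (h.nonneg _)]; exact h.le_one _)
    (fun a ha b hb hab => hmod₁ a ⟨ha.1, ha.2.trans hu⟩ b ⟨hb.1, hb.2.trans hu⟩ hab)
  have e5 : (2 * U + 2) * (η / 4 / (2 * U + 2)) * L = η / 4 * L := by field_simp
  rw [e5] at e4
  simp only [mul_one] at e4
  have e6 : ∑ d ∈ Finset.Icc 1 ⌊t⌋₊, vonMangoldt d / d * σ (Real.log d / L) =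
      ∑ d ∈ Finset.Icc 1 ⌊t⌋₊, vonMangoldt d * σ (Real.log d / L) / d :=
    Finset.sum_congr rfl fun d _ => by ring
  rw [e6] at e4
  simp only [sub_mul] at e1
  rw [Finset.sum_sub_distrib] at e1
  rw [abs_le] at *
  constructor <;> linarith

/-- The weights `Λ(d) / d` of the `y`-smooth numbers are distributed like `1_{[0,1]}`. -/
theorem exists_cdfClose_indicator {U η : ℝ} (hη : 0 < η) :
    ∃ Y : ℝ, 1 < Y ∧ ∀ y ≥ Y, ∀ f : ℕ → ℝ, (∀ n, 0 ≤ f n) → (∀ n, f n ≤ 1) →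
      (∀ n : ℕ, (n : ℝ) ≤ y → f n = 1) → (∀ p : ℕ, p.Prime → y < p → f p = 0) →
      CdfClose (Set.indicator (Icc (0 : ℝ) 1) fun _ => 1) f y U η := by
  obtain ⟨C, hC, hpp⟩ := exists_prime_power_bound
  obtain ⟨C', hC', hm⟩ := exists_mertens
  refine ⟨Real.exp ((C + C') / η), Real.one_lt_exp_iff.mpr (by positivity),
    fun y hy f hf0 hf1 hfy hfy' t ht => ?_⟩
  have hy1 : 1 < y := lt_of_lt_of_le (Real.one_lt_exp_iff.mpr (by positivity)) hy
  have hy0 : 0 < y := by linarith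
  have hL : 0 < Real.log y := Real.log_pos hy1
  have hLB : C + C' ≤ η * Real.log y := by
    have : (C + C') / η ≤ Real.log y := by rwa [Real.le_log_iff_exp_le hy0]
    rwa [div_le_iff₀ hη, mul_comm] at this
  set L := Real.log y with hLdef
  have ht0 : 0 < t := by linarith [ht.1]
  have e2 := hpp f hf0 hf1 t
  have e1 : ∑ p ∈ primesUpTo t, f p * (Real.log p / p) =
      ∑ p ∈ primesUpTo (min t y), Real.log p / p := by
    rw [← Finset.sum_subset (primesUpTo_subset (min_le_left t y))]
    · refine Finset.sum_congr rfl fun p hp => ?_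
      rw [mem_primesUpTo (by positivity), le_min_iff] at hp
      rw [hfy p hp.2.2, one_mul]
    · intro p hp hp'
      rw [mem_primesUpTo ht0.le] at hp
      rw [mem_primesUpTo (by positivity), le_min_iff] at hp'
      rw [hfy' p hp.1 (by by_contra! hle; exact hp' ⟨hp.1, hp.2, hle⟩), zero_mul]
  have e3 := hm (min t y) (le_min ht.1 hy1.le)
  have e4 : L * ∫ v in (0 : ℝ)..(Real.log t / L), Set.indicator (Icc (0 : ℝ) 1) (fun _ => (1 : ℝ)) v =
      Real.log (min t y) := by
    have hlt : 0 ≤ Real.log t := Real.log_nonneg ht.1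
    have hint : ∀ c : ℝ, 0 ≤ c → c ≤ 1 →
        ∫ v in (0 : ℝ)..c, Set.indicator (Icc (0 : ℝ) 1) (fun _ => (1 : ℝ)) v = c := fun c hc hc1 => by
      rw [intervalIntegral.integral_congr (g := fun _ => 1) fun v hv => ?_]
      · simp
      · rw [uIcc_of_le hc] at hv
        exact IsKernel.indicator.eq_one v ⟨hv.1, hv.2.trans hc1⟩
    rcases le_total t y with hty | hyt
    · rw [min_eq_left hty, hint _ (by positivity) ((div_le_one hL).mpr (Real.log_le_log ht0 hty)),
        mul_div_cancel₀ _ hL.ne']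
    · rw [min_eq_right hyt]
      have hu1 : 1 ≤ Real.log t / L := (one_le_div hL).mpr (Real.log_le_log hy0 hyt)
      have := integral_indicator_kernel (fun _ => 1) hu1
      simp only [one_mul, intervalIntegral.integral_const, sub_sub_cancel, smul_eq_mul,
        mul_one] at this
      rw [this, mul_one]
  rw [e4]
  rw [e1] at e2
  rw [abs_le] at *
  constructor <;> linarith

/-! ### Sequences with a level of distribution -/

/-- The sequence `(a i)_{i ∈ A}` has level of distribution `D` with densities `W(d)` and relative
error `η`. -/
def LevelBound (A : Finset ℕ) (a : ℕ → ℕ) (W : ℕ → ℝ) (D η : ℝ) : Prop :=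
  ∑ d ∈ Finset.Icc 1 ⌊D⌋₊, |((A.filter fun i => d ∣ a i).card : ℝ) - W d * A.card| ≤ η * A.card

theorem card_fiber_mul_le_two (Q : Finset ℕ) (hQ : ∀ q ∈ Q, q.Prime) (d : ℕ) :
    (((Q ×ˢ Q).filter fun z : ℕ × ℕ => z.1 * z.2 = d).card : ℝ) ≤ 2 := by
  rcases Finset.eq_empty_or_nonempty ((Q ×ˢ Q).filter fun z : ℕ × ℕ => z.1 * z.2 = d) with h | ⟨z, hz⟩
  · rw [h]; norm_num
  rw [Finset.mem_filter, Finset.mem_product] at hz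
  have hsub : ((Q ×ˢ Q).filter fun z : ℕ × ℕ => z.1 * z.2 = d) ⊆ {(z.1, z.2), (z.2, z.1)} := by
    rintro ⟨q, r⟩ hw
    rw [Finset.mem_filter, Finset.mem_product] at hw
    simp only at hw
    have hq := hQ q hw.1.1
    have h1 := hQ z.1 hz.1.1
    have h2 := hQ z.2 hz.1.2
    have hdvd : q ∣ z.1 * z.2 := by rw [hz.2, ← hw.2]; exact Dvd.intro _ rfl
    have heq : q * r = z.1 * z.2 := by rw [hw.2, hz.2]
    simp only [Finset.mem_insert, Finset.mem_singleton, Prod.mk.injEq]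
    rcases (Nat.Prime.dvd_mul hq).mp hdvd with h | h
    · left
      have e := (Nat.prime_dvd_prime_iff_eq hq h1).mp h
      exact ⟨e, by rw [e] at heq; exact Nat.eq_of_mul_eq_mul_left h1.pos heq⟩
    · right
      have e := (Nat.prime_dvd_prime_iff_eq hq h2).mp h
      exact ⟨e, by rw [e, mul_comm z.1] at heq; exact Nat.eq_of_mul_eq_mul_left h2.pos heq⟩
  exact_mod_cast (Finset.card_le_card hsub).trans Finset.card_le_two

/-- **Second moment method.** The variance of the number of primes of `Q` dividing `a i` bounds the
number of `i` for which no prime of `Q` divides `a i`. -/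
theorem LevelBound.card_no_prime_factor_mul_le {A : Finset ℕ} {a : ℕ → ℕ} {W : ℕ → ℝ} {D η : ℝ}
    (h : LevelBound A a W D η) (hW0 : ∀ d, 0 ≤ W d)
    (hWm : ∀ q r : ℕ, q.Prime → r.Prime → q ≠ r → W (q * r) = W q * W r)
    (Q : Finset ℕ) (hQ : ∀ q ∈ Q, q.Prime) (hQD : ∀ q ∈ Q, ∀ r ∈ Q, q * r ≤ ⌊D⌋₊) :
    ((A.filter fun i => ∀ q ∈ Q, ¬ q ∣ a i).card : ℝ) * (∑ q ∈ Q, W q) ^ 2 ≤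
      A.card * (∑ q ∈ Q, W q + 3 * η + 2 * (∑ q ∈ Q, W q) * η) := by
  set V := ∑ q ∈ Q, W q with hV
  have hV0 : 0 ≤ V := Finset.sum_nonneg fun q _ => hW0 q
  let cnt : ℕ → ℝ := fun d => ((A.filter fun i => d ∣ a i).card : ℝ)
  let E : ℕ → ℝ := fun d => cnt d - W d * A.card
  have hcnt : ∀ d, cnt d = ∑ i ∈ A, if d ∣ a i then (1 : ℝ) else 0 := fun d => by
    simp only [cnt]; rw [Finset.card_filter]; push_cast; rfl
  let P := (Q ×ˢ Q).filter fun z : ℕ × ℕ => z.1 ≠ z.2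
  have hE1 : |∑ q ∈ Q, E q| ≤ η * A.card := by
    refine (Finset.abs_sum_le_sum_abs _ _).trans (le_trans ?_ h)
    refine Finset.sum_le_sum_of_subset_of_nonneg (fun q hq => ?_) fun _ _ _ => abs_nonneg _
    exact Finset.mem_Icc.mpr ⟨(hQ q hq).one_le,
      (Nat.le_mul_of_pos_right q (hQ q hq).pos).trans (hQD q hq q hq)⟩
  have hE2 : |∑ z ∈ P, E (z.1 * z.2)| ≤ 2 * (η * A.card) := by
    refine (Finset.abs_sum_le_sum_abs _ _).trans ?_
    rw [Finset.sum_comp (fun d => |E d|) fun z : ℕ × ℕ => z.1 * z.2]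
    calc ∑ d ∈ P.image fun z : ℕ × ℕ => z.1 * z.2,
          (P.filter fun z : ℕ × ℕ => z.1 * z.2 = d).card • |E d|
        ≤ ∑ d ∈ P.image fun z : ℕ × ℕ => z.1 * z.2, 2 * |E d| := by
          refine Finset.sum_le_sum fun d _ => ?_
          rw [nsmul_eq_mul]
          refine mul_le_mul_of_nonneg_right (le_trans ?_ (card_fiber_mul_le_two Q hQ d)) (abs_nonneg _)
          exact_mod_cast Finset.card_le_card
            (Finset.filter_subset_filter _ (Finset.filter_subset _ _))
      _ ≤ ∑ d ∈ Finset.Icc 1 ⌊D⌋₊, 2 * |E d| := by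
          refine Finset.sum_le_sum_of_subset_of_nonneg (fun d hd => ?_) fun _ _ _ => by positivity
          obtain ⟨z, hz, rfl⟩ := Finset.mem_image.mp hd
          have hz := Finset.mem_product.mp (Finset.mem_filter.mp hz).1
          exact Finset.mem_Icc.mpr ⟨Nat.mul_pos (hQ _ hz.1).pos (hQ _ hz.2).pos, hQD _ hz.1 _ hz.2⟩
      _ = 2 * ∑ d ∈ Finset.Icc 1 ⌊D⌋₊, |E d| := by rw [Finset.mul_sum]
      _ ≤ _ := mul_le_mul_of_nonneg_left h zero_le_two
  let ω : ℕ → ℝ := fun i => ∑ q ∈ Q, if q ∣ a i then (1 : ℝ) else 0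
  have hω1 : ∑ i ∈ A, ω i = V * A.card + ∑ q ∈ Q, E q := by
    simp only [ω]
    rw [Finset.sum_comm, hV, Finset.sum_mul, ← Finset.sum_add_distrib]
    refine Finset.sum_congr rfl fun q _ => ?_
    rw [← hcnt]; simp only [E]; ring
  have hω2 : ∑ i ∈ A, ω i ^ 2 = ∑ q ∈ Q, cnt q + ∑ z ∈ P, cnt (z.1 * z.2) := by
    have e1 : ∀ i, ω i ^ 2 = (∑ q ∈ Q, if q ∣ a i then (1 : ℝ) else 0) +
        ∑ z ∈ P, if z.1 * z.2 ∣ a i then (1 : ℝ) else 0 := fun i => by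
      simp only [ω]
      rw [sq, Finset.sum_mul_sum, ← Finset.sum_product',
        ← Finset.sum_filter_add_sum_filter_not (Q ×ˢ Q) (fun z : ℕ × ℕ => z.1 = z.2)]
      congr 1
      · refine Finset.sum_nbij' (fun z => z.1) (fun q => (q, q)) ?_ ?_ ?_ ?_ ?_
        · intro z hz
          exact (Finset.mem_product.mp (Finset.mem_filter.mp hz).1).1
        · intro q hq
          exact Finset.mem_filter.mpr ⟨Finset.mem_product.mpr ⟨hq, hq⟩, rfl⟩
        · rintro ⟨q, r⟩ hz
          have : q = r := (Finset.mem_filter.mp hz).2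
          rw [this]
        · intro q _; rfl
        · rintro ⟨q, r⟩ hz
          have : q = r := (Finset.mem_filter.mp hz).2
          subst this
          split_ifs <;> simp
      · refine Finset.sum_congr rfl fun z hz => ?_
        have hz1 := Finset.mem_product.mp (Finset.mem_filter.mp hz).1
        have hne : z.1 ≠ z.2 := (Finset.mem_filter.mp hz).2
        have hcop : Nat.Coprime z.1 z.2 :=
          (Nat.coprime_primes (hQ _ hz1.1) (hQ _ hz1.2)).mpr hne
        have hiff : z.1 * z.2 ∣ a i ↔ z.1 ∣ a i ∧ z.2 ∣ a i :=
          ⟨fun h => ⟨(Dvd.intro _ rfl).trans h, (Dvd.intro_left _ rfl).trans h⟩,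
            fun h => hcop.mul_dvd_of_dvd_of_dvd h.1 h.2⟩
        simp only [hiff]
        by_cases h1 : z.1 ∣ a i <;> by_cases h2 : z.2 ∣ a i <;> simp [h1, h2]
    simp only [e1]
    rw [Finset.sum_add_distrib, Finset.sum_comm]
    congr 1
    · exact Finset.sum_congr rfl fun q _ => (hcnt q).symm
    · rw [Finset.sum_comm]
      exact Finset.sum_congr rfl fun z _ => (hcnt _).symm
  have hP : ∑ z ∈ P, cnt (z.1 * z.2) ≤ V ^ 2 * A.card + ∑ z ∈ P, E (z.1 * z.2) := by
    have e1 : ∑ z ∈ P, cnt (z.1 * z.2) =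
        (∑ z ∈ P, W z.1 * W z.2) * A.card + ∑ z ∈ P, E (z.1 * z.2) := by
      rw [Finset.sum_mul, ← Finset.sum_add_distrib]
      refine Finset.sum_congr rfl fun z hz => ?_
      have hz1 := Finset.mem_product.mp (Finset.mem_filter.mp hz).1
      simp only [E]
      rw [hWm _ _ (hQ _ hz1.1) (hQ _ hz1.2) (Finset.mem_filter.mp hz).2]
      ring
    have e2 : ∑ z ∈ P, W z.1 * W z.2 ≤ V ^ 2 := by
      rw [sq, hV, Finset.sum_mul_sum, ← Finset.sum_product']
      exact Finset.sum_le_sum_of_subset_of_nonneg (Finset.filter_subset _ _)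
        fun z _ _ => mul_nonneg (hW0 _) (hW0 _)
    rw [e1]
    gcongr
  have hQc : ∑ q ∈ Q, cnt q = V * A.card + ∑ q ∈ Q, E q := by
    rw [← hω1]
    simp only [ω]
    rw [Finset.sum_comm]
    exact Finset.sum_congr rfl fun q _ => hcnt q
  have hvar : ∑ i ∈ A, (ω i - V) ^ 2 = ∑ i ∈ A, ω i ^ 2 - 2 * V * ∑ i ∈ A, ω i + V ^ 2 * A.card := by
    rw [Finset.mul_sum, ← Finset.sum_sub_distrib, mul_comm (V ^ 2), ← nsmul_eq_mul,
      ← Finset.sum_const, ← Finset.sum_add_distrib]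
    exact Finset.sum_congr rfl fun i _ => by ring
  have hbad : ((A.filter fun i => ∀ q ∈ Q, ¬ q ∣ a i).card : ℝ) * V ^ 2 ≤ ∑ i ∈ A, (ω i - V) ^ 2 := by
    rw [← nsmul_eq_mul, ← Finset.sum_const]
    refine le_trans (Finset.sum_le_sum fun i hi => ?_)
      (Finset.sum_le_sum_of_subset_of_nonneg (Finset.filter_subset _ _) fun i _ _ => sq_nonneg _)
    have : ω i = 0 := Finset.sum_eq_zero fun q hq => by
      rw [if_neg ((Finset.mem_filter.mp hi).2 q hq)]
    rw [this]; simp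
  have h1 := abs_le.mp hE1
  have h2 := abs_le.mp hE2
  have h3 : -(2 * V * ∑ q ∈ Q, E q) ≤ 2 * V * (η * A.card) := by nlinarith
  rw [hvar, hω2, hω1, hQc] at hbad
  nlinarith

/-- The primes in `(z, z^{2^m}]` carry at least `m / 4` of `∑ 1/p`. -/
theorem exists_sum_inv_primes_ge : ∃ Z : ℝ, 1 < Z ∧ ∀ z ≥ Z, ∀ m : ℕ,
    (m : ℝ) / 4 ≤ ∑ p ∈ primesUpTo (z ^ 2 ^ m) \ primesUpTo z, (1 : ℝ) / p := by
  obtain ⟨Z, hZ⟩ := eventually_atTop.mp eventually_sum_inv_primes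
  refine ⟨max Z 2, lt_max_of_lt_right one_lt_two, fun z hz m => ?_⟩
  have hz1 : 1 ≤ z := by linarith [(le_max_right Z 2).trans hz]
  induction m with
  | zero => simp
  | succ m ih =>
    have hzm : z ≤ z ^ 2 ^ m := le_self_pow₀ hz1 (by positivity)
    have h1 := hZ (z ^ 2 ^ m) (((le_max_left Z 2).trans hz).trans hzm)
    rw [← pow_mul, ← pow_succ] at h1
    have h2 : z ^ 2 ^ m ≤ z ^ 2 ^ (m + 1) :=
      pow_le_pow_right₀ hz1 (Nat.pow_le_pow_right two_pos (Nat.le_succ m))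
    have h3 : primesUpTo (z ^ 2 ^ (m + 1)) \ primesUpTo z =
        (primesUpTo (z ^ 2 ^ (m + 1)) \ primesUpTo (z ^ 2 ^ m)) ∪
          (primesUpTo (z ^ 2 ^ m) \ primesUpTo z) := by
      have s1 := primesUpTo_subset h2
      have s2 := primesUpTo_subset hzm
      ext p
      simp only [Finset.mem_sdiff, Finset.mem_union]
      have := @s1 p
      have := @s2 p
      tauto
    rw [h3, Finset.sum_union]
    · push_cast
      linarith
    · rw [Finset.disjoint_left]
      intro p hp hp'
      exact (Finset.mem_sdiff.mp hp).2 (Finset.mem_sdiff.mp hp').1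

/-- In a sequence with level of distribution `x^{1-ε}`, few members have no prime factor in the long
interval `(x^ε, x^c]`. -/
theorem exists_few_without_prime_factor {c η : ℝ} (hc : 0 < c) (hc4 : c ≤ 1 / 4) (hη : 0 < η) :
    ∃ ε : ℝ, 0 < ε ∧ ε ≤ 1 / 4 ∧ ∃ X : ℝ, ∀ x ≥ X, ∀ (A : Finset ℕ) (a : ℕ → ℕ) (W : ℕ → ℝ),
      (∀ d, 0 ≤ W d) → (∀ q r : ℕ, q.Prime → r.Prime → q ≠ r → W (q * r) = W q * W r) →
      (∀ q : ℕ, q.Prime → 1 / (q : ℝ) ≤ W q) → LevelBound A a W (x ^ (1 - ε)) η →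
      ∀ S ⊆ A, (∀ i ∈ S, ∀ q : ℕ, q.Prime → x ^ ε < q → (q : ℝ) ≤ x ^ c → ¬ q ∣ a i) →
        (S.card : ℝ) ≤ 6 * η * A.card := by
  obtain ⟨Z, hZ1, hZ⟩ := exists_sum_inv_primes_ge
  obtain ⟨m, hm⟩ := exists_nat_gt (4 * max (1 / η) 1)
  have h2m : (1 : ℝ) ≤ 2 ^ m := one_le_pow₀ one_le_two
  refine ⟨c / 2 ^ m, by positivity, (div_le_self hc.le h2m).trans hc4, max 1 (Z ^ (2 ^ m / c : ℝ)), fun x hx A a W hW0 hWm hWq hlev S hSA hS => ?_⟩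
  have hx1 : 1 ≤ x := (le_max_left _ _).trans hx
  have hx0 : 0 < x := by linarith
  set ε := c / 2 ^ m with hε
  have hzZ : Z ≤ x ^ ε := by
    have h1 : Z ^ (2 ^ m / c : ℝ) ≤ x := (le_max_right _ _).trans hx
    have h2 := Real.rpow_le_rpow (by positivity) h1 (by positivity : 0 ≤ ε)
    rw [← Real.rpow_mul (by linarith), hε, div_mul_div_cancel₀ hc.ne', div_self (by positivity),
      Real.rpow_one] at h2
    exact h2
  have hpow : (x ^ ε) ^ 2 ^ m = x ^ c := by
    rw [← Real.rpow_natCast, ← Real.rpow_mul hx0.le, hε]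
    congr 1
    push_cast
    field_simp
  have hV := hZ _ hzZ m
  rw [hpow] at hV
  set Q := primesUpTo (x ^ c) \ primesUpTo (x ^ ε) with hQdef
  have hQ : ∀ q ∈ Q, q.Prime ∧ x ^ ε < q ∧ (q : ℝ) ≤ x ^ c := fun q hq => by
    rw [hQdef, Finset.mem_sdiff, mem_primesUpTo (by positivity), mem_primesUpTo (by positivity)] at hq
    exact ⟨hq.1.1, by by_contra! hle; exact hq.2 ⟨hq.1.1, hle⟩, hq.1.2⟩
  have hεc : ε ≤ c := div_le_self hc.le h2m
  have key := hlev.card_no_prime_factor_mul_le hW0 hWm Q (fun q hq => (hQ q hq).1)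
    fun q hq r hr => by
      rw [Nat.le_floor_iff (by positivity)]
      push_cast
      calc (q : ℝ) * r ≤ x ^ c * x ^ c :=
            mul_le_mul (hQ q hq).2.2 (hQ r hr).2.2 (by positivity) (by positivity)
        _ = x ^ (c + c) := (Real.rpow_add hx0 _ _).symm
        _ ≤ x ^ (1 - ε) := Real.rpow_le_rpow_of_exponent_le hx1 (by linarith)
  set V := ∑ q ∈ Q, W q
  have hVge : max (1 / η) 1 ≤ V := by
    have h1 : ∑ q ∈ Q, (1 : ℝ) / q ≤ V := Finset.sum_le_sum fun q hq => hWq q (hQ q hq).1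
    linarith
  have hV1 : 1 ≤ V := (le_max_right _ _).trans hVge
  have hVη : 1 ≤ V * η := by
    have : 1 / η ≤ V := (le_max_left _ _).trans hVge
    rwa [div_le_iff₀ hη] at this
  have hsub : (S.card : ℝ) ≤ ((A.filter fun i => ∀ q ∈ Q, ¬ q ∣ a i).card : ℝ) := by
    refine Nat.cast_le.mpr (Finset.card_le_card fun i hi => ?_)
    exact Finset.mem_filter.mpr
      ⟨hSA hi, fun q hq => hS i hi q (hQ q hq).1 (hQ q hq).2.1 (hQ q hq).2.2⟩
  refine hsub.trans ?_
  have hA : (0 : ℝ) ≤ A.card := Nat.cast_nonneg _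
  have h1 : V + 3 * η + 2 * V * η ≤ 6 * η * V ^ 2 := by nlinarith
  have h2 : ((A.filter fun i => ∀ q ∈ Q, ¬ q ∣ a i).card : ℝ) * V ^ 2 ≤ (6 * η * A.card) * V ^ 2 := by
    refine key.trans ?_
    nlinarith
  exact le_of_mul_le_mul_right h2 (by positivity)

/-! ### Functions of the rough part of an integer -/

/-- `d` is `y`-rough: all its prime factors exceed `y`. -/
def IsRough (y : ℝ) (d : ℕ) : Prop := ∀ q : ℕ, q.Prime → q ∣ d → y < q

open Classical in
/-- The `y`-rough divisors of `n`. -/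
noncomputable def roughDivisors (y : ℝ) (n : ℕ) : Finset ℕ := n.divisors.filter fun d => IsRough y d

theorem mem_roughDivisors {y : ℝ} {n d : ℕ} : d ∈ roughDivisors y n ↔ (d ∣ n ∧ n ≠ 0) ∧ IsRough y d := by
  classical
  simp only [roughDivisors, Finset.mem_filter, Nat.mem_divisors, ne_eq]

theorem IsRough.of_dvd {y : ℝ} {m n : ℕ} (h : IsRough y n) (hmn : m ∣ n) : IsRough y m :=
  fun q hq hqm => h q hq (hqm.trans hmn)

theorem roughDivisors_of_isRough {y : ℝ} {n : ℕ} (h : IsRough y n) :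
    roughDivisors y n = n.divisors := by
  classical
  exact Finset.filter_true_of_mem fun d hd => h.of_dvd (Nat.dvd_of_mem_divisors hd)

theorem roughDivisors_mul {y : ℝ} {p n : ℕ} (hp : p.Prime) (hpy : (p : ℝ) ≤ y) (hn : 0 < n) :
    roughDivisors y (p * n) = roughDivisors y n := by
  ext d
  rw [mem_roughDivisors, mem_roughDivisors]
  constructor
  · rintro ⟨⟨h1, _⟩, h2⟩
    have hcop : Nat.Coprime d p := by
      rw [Nat.coprime_comm, Nat.Prime.coprime_iff_not_dvd hp]
      exact fun h => absurd (h2 p hp h) (not_lt.mpr hpy)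
    exact ⟨⟨hcop.dvd_of_dvd_mul_left h1, hn.ne'⟩, h2⟩
  · rintro ⟨⟨h1, _⟩, h2⟩
    exact ⟨⟨h1.mul_left p, (Nat.mul_pos hp.pos hn).ne'⟩, h2⟩

/-- Induction over the smooth part of a positive integer. -/
theorem induction_on_smooth_part {y : ℝ} {P : ℕ → Prop} (hrough : ∀ n, 0 < n → IsRough y n → P n)
    (hmul : ∀ p n : ℕ, p.Prime → (p : ℝ) ≤ y → 0 < n → P n → P (p * n)) (n : ℕ) (hn : 0 < n) : P n := by
  induction n using Nat.strong_induction_on with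
  | _ n ih =>
    by_cases h : IsRough y n
    · exact hrough n hn h
    · rw [IsRough] at h
      push Not at h
      obtain ⟨p, hp, ⟨m, rfl⟩, hpy⟩ := h
      have hm : 0 < m := Nat.pos_of_mul_pos_left hn
      exact hmul p m hp hpy hm (ih m (lt_mul_of_one_lt_left hm hp.one_lt) hm)

/-- A `y`-rough number up to `y ^ k` has at most `k` prime factors, counted with multiplicity. -/
theorem IsRough.card_divisors_le {y : ℝ} (hy : 1 ≤ y) (k : ℕ) {n : ℕ} (hn : 0 < n) (h : IsRough y n)
    (hnk : (n : ℝ) ≤ y ^ k) : n.divisors.card ≤ 2 ^ k := by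
  induction k generalizing n with
  | zero =>
    have : n = 1 := by
      have : n ≤ 1 := by exact_mod_cast (by simpa using hnk : (n : ℝ) ≤ 1)
      omega
    simp [this]
  | succ k ih =>
    by_cases hn1 : n = 1
    · simp [hn1, Nat.one_le_two_pow]
    obtain ⟨p, hp, m, rfl⟩ := Nat.exists_prime_and_dvd hn1
    have hm : 0 < m := Nat.pos_of_mul_pos_left hn
    have hpy := h p hp (Dvd.intro _ rfl)
    have hmk : (m : ℝ) ≤ y ^ k := by
      have h1 : y * m ≤ y * y ^ k := by
        calc y * m ≤ p * m := by gcongr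
          _ ≤ y ^ (k + 1) := by exact_mod_cast hnk
          _ = y * y ^ k := by ring
      exact le_of_mul_le_mul_left h1 (by linarith)
    have h2 := ih hm (h.of_dvd (Dvd.intro_left _ rfl)) hmk
    have hsub : (p * m).divisors ⊆ m.divisors ∪ m.divisors.image (p * ·) := by
      intro d hd
      have hdd := Nat.dvd_of_mem_divisors hd
      rw [Finset.mem_union, Finset.mem_image]
      by_cases hpd : p ∣ d
      · obtain ⟨e, rfl⟩ := hpd
        exact Or.inr ⟨e, Nat.mem_divisors.mpr ⟨Nat.dvd_of_mul_dvd_mul_left hp.pos hdd, hm.ne'⟩, rfl⟩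
      · have hcop : Nat.Coprime d p := by
          rw [Nat.coprime_comm, Nat.Prime.coprime_iff_not_dvd hp]; exact hpd
        exact Or.inl (Nat.mem_divisors.mpr ⟨hcop.dvd_of_dvd_mul_left hdd, hm.ne'⟩)
    calc (p * m).divisors.card ≤ (m.divisors ∪ m.divisors.image (p * ·)).card :=
          Finset.card_le_card hsub
      _ ≤ m.divisors.card + (m.divisors.image (p * ·)).card := Finset.card_union_le _ _
      _ ≤ m.divisors.card + m.divisors.card := Nat.add_le_add_left Finset.card_image_le _
      _ ≤ 2 ^ (k + 1) := by rw [pow_succ]; omega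

theorem card_roughDivisors_le {y : ℝ} (hy : 1 ≤ y) (k : ℕ) {n : ℕ} (hn : 0 < n)
    (hnk : (n : ℝ) ≤ y ^ k) : (roughDivisors y n).card ≤ 2 ^ k := by
  refine induction_on_smooth_part (y := y)
    (P := fun n => (n : ℝ) ≤ y ^ k → (roughDivisors y n).card ≤ 2 ^ k) ?_ ?_ n hn hnk
  · intro n hn h hnk
    rw [roughDivisors_of_isRough h]
    exact h.card_divisors_le hy k hn hnk
  · intro p n hp hpy hn ih hnk
    rw [roughDivisors_mul hp hpy hn]
    refine ih (le_trans ?_ hnk)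
    exact_mod_cast Nat.le_mul_of_pos_left n hp.pos

/-- The Möbius transform `μ * f`. -/
noncomputable def moebiusTransform (f : ℕ → ℝ) (d : ℕ) : ℝ :=
  ∑ z ∈ d.divisorsAntidiagonal, (ArithmeticFunction.moebius z.1 : ℝ) * f z.2

theorem sum_divisors_moebiusTransform (f : ℕ → ℝ) {n : ℕ} (hn : 0 < n) :
    ∑ d ∈ n.divisors, moebiusTransform f d = f n :=
  (ArithmeticFunction.sum_eq_iff_sum_mul_moebius_eq (f := moebiusTransform f) (g := f)).mpr
    (fun _ _ => rfl) n hn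

/-- A function of the `y`-rough part of `n` is a sum over the `y`-rough divisors of `n`. -/
theorem sum_roughDivisors_moebiusTransform {f : ℕ → ℝ} {y : ℝ}
    (hf : ∀ p n : ℕ, p.Prime → (p : ℝ) ≤ y → 0 < n → f (p * n) = f n) {n : ℕ} (hn : 0 < n) :
    ∑ d ∈ roughDivisors y n, moebiusTransform f d = f n := by
  refine induction_on_smooth_part (y := y)
    (P := fun n => ∑ d ∈ roughDivisors y n, moebiusTransform f d = f n) ?_ ?_ n hn
  · intro n hn h
    rw [roughDivisors_of_isRough h, sum_divisors_moebiusTransform f hn]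
  · intro p n hp hpy hn ih
    rw [roughDivisors_mul hp hpy hn, ih, hf p n hp hpy hn]

theorem abs_moebiusTransform_le {f : ℕ → ℝ} (hf0 : ∀ n, 0 ≤ f n) (hf1 : ∀ n, f n ≤ 1) (d : ℕ) :
    |moebiusTransform f d| ≤ d.divisors.card := by
  rw [moebiusTransform]
  refine (Finset.abs_sum_le_sum_abs _ _).trans ?_
  have h1 : ∀ z ∈ d.divisorsAntidiagonal,
      |(ArithmeticFunction.moebius z.1 : ℝ) * f z.2| ≤ 1 := fun z _ => by
    rw [abs_mul]
    have h2 : |(ArithmeticFunction.moebius z.1 : ℝ)| ≤ 1 := by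
      exact_mod_cast ArithmeticFunction.abs_moebius_le_one
    have h3 : |f z.2| ≤ 1 := by rw [abs_of_nonneg (hf0 _)]; exact hf1 _
    exact mul_le_one₀ h2 (abs_nonneg _) h3
  refine (Finset.sum_le_sum h1).trans ?_
  rw [Finset.sum_const, nsmul_eq_mul, mul_one]
  refine Nat.cast_le.mpr (le_of_eq ?_)
  rw [← Nat.map_div_right_divisors, Finset.card_map]

/-- Each of the at most `k` prime factors of a rough number exceeds `y`, and so decreases `φ(n) / n`
by at most the factor `1 - 1 / y`. -/
theorem IsRough.mul_pow_le_totient {y : ℝ} (hy : 1 < y) (k : ℕ) {n : ℕ} (hn : 0 < n)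
    (h : IsRough y n) (hnk : (n : ℝ) ≤ y ^ k) : (n : ℝ) * (1 - 1 / y) ^ k ≤ n.totient := by
  have hy1 : 1 / y < 1 := by rw [div_lt_one (by linarith)]; exact hy
  have hb0 : 0 < 1 - 1 / y := by linarith
  have hb1 : 1 - 1 / y ≤ 1 := by have : 0 < 1 / y := by positivity
                                 linarith
  induction k generalizing n with
  | zero =>
    have : n = 1 := by
      have : n ≤ 1 := by exact_mod_cast (by simpa using hnk : (n : ℝ) ≤ 1)
      omega
    simp [this]
  | succ k ih =>
    by_cases hn1 : n = 1
    · subst hn1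
      simpa using pow_le_one₀ (n := k + 1) hb0.le hb1
    obtain ⟨p, hp, m, rfl⟩ := Nat.exists_prime_and_dvd hn1
    have hm : 0 < m := Nat.pos_of_mul_pos_left hn
    have hpy := h p hp (Dvd.intro _ rfl)
    have hp0 : (0 : ℝ) < p := by linarith
    have hmk : (m : ℝ) ≤ y ^ k := by
      have h1 : y * m ≤ y * y ^ k := by
        calc y * m ≤ p * m := by gcongr
          _ ≤ y ^ (k + 1) := by exact_mod_cast hnk
          _ = y * y ^ k := by ring
      exact le_of_mul_le_mul_left h1 (by linarith)
    have h2 := ih hm (h.of_dvd (Dvd.intro_left _ rfl)) hmk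
    have h3 : (p - 1) * m.totient ≤ (p * m).totient := by
      rw [← Nat.totient_prime hp]
      exact Nat.totient_super_multiplicative p m
    have h4 : ((p : ℝ) - 1) * m.totient ≤ (p * m).totient := by
      have : (((p - 1) * m.totient : ℕ) : ℝ) ≤ (p * m).totient := by exact_mod_cast h3
      rwa [Nat.cast_mul, Nat.cast_sub hp.one_le, Nat.cast_one] at this
    have h5 : (p : ℝ) * (1 - 1 / y) ≤ p - 1 := by
      have : 1 ≤ p * (1 / y) := by
        rw [mul_one_div, le_div_iff₀ (by linarith)]; linarith
      linarith
    refine le_trans ?_ h4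
    push_cast
    calc (p : ℝ) * m * (1 - 1 / y) ^ (k + 1) = (p * (1 - 1 / y)) * (m * (1 - 1 / y) ^ k) := by ring
      _ ≤ ((p : ℝ) - 1) * m.totient := by
        refine mul_le_mul h5 h2 (by positivity) ?_
        have : (1 : ℝ) ≤ p := by exact_mod_cast hp.one_le
        linarith

/-! ### Shifted primes under the Elliott–Halberstam conjecture -/

open Classical in
/-- The conjectural mean value of the function of the `y`-rough part with Möbius transform `h`, over
a sequence with densities `W` and level of distribution `D`. -/
noncomputable def roughMean (h W : ℕ → ℝ) (y D : ℝ) : ℝ :=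
  ∑ d ∈ ((Finset.Icc 1 ⌊D⌋₊).filter fun d => IsRough y d), h d * W d

/-- A function of the rough part of `a i` is expanded over the rough divisors; those up to `D` are
handled by the level of distribution, and the indices with a larger one are few by `hbad`. -/
theorem LevelBound.abs_sum_sub_roughMean_le {A : Finset ℕ} {a : ℕ → ℕ} {W : ℕ → ℝ}
    {D η β x y : ℝ} {k : ℕ} (h : LevelBound A a W D η) (hy : 1 ≤ y) (hD : 0 ≤ D) (hDx : D ≤ x)
    (hxy : x ≤ y ^ k) (ha : ∀ i ∈ A, 0 < a i ∧ (a i : ℝ) ≤ x)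
    (hbad : ∀ S ⊆ A, (∀ i ∈ S, ∃ d ∈ roughDivisors y (a i), D < d) → (S.card : ℝ) ≤ β * A.card)
    {f : ℕ → ℝ} (hf0 : ∀ n, 0 ≤ f n) (hf1 : ∀ n, f n ≤ 1)
    (hf : ∀ p n : ℕ, p.Prime → (p : ℝ) ≤ y → 0 < n → f (p * n) = f n) :
    |∑ i ∈ A, f (a i) - A.card * roughMean (moebiusTransform f) W y D| ≤
      (2 ^ k * η + 4 ^ k * β) * A.card := by
  classical
  set μf := moebiusTransform f with hμf
  let R := ((Finset.Icc 1 ⌊D⌋₊).filter fun d => IsRough y d)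
  have hμ : ∀ d, 0 < d → IsRough y d → (d : ℝ) ≤ x → |μf d| ≤ 2 ^ k := fun d hd hr hdx => by
    refine (abs_moebiusTransform_le hf0 hf1 d).trans ?_
    exact_mod_cast hr.card_divisors_le hy k hd (hdx.trans hxy)
  let S := A.filter fun i => ∃ d ∈ roughDivisors y (a i), D < d
  -- the truncated divisor sum
  let g : ℕ → ℝ := fun i => ∑ d ∈ (roughDivisors y (a i)).filter (fun d : ℕ => (d : ℝ) ≤ D), μf d
  have e1 : |∑ i ∈ A, f (a i) - ∑ i ∈ A, g i| ≤ 4 ^ k * (β * A.card) := by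
    rw [← Finset.sum_sub_distrib]
    have hpt : ∀ i ∈ A, |f (a i) - g i| ≤ if i ∈ S then 4 ^ k else 0 := fun i hi => by
      have hsplit : f (a i) - g i =
          ∑ d ∈ (roughDivisors y (a i)).filter (fun d : ℕ => ¬ (d : ℝ) ≤ D), μf d := by
        rw [← sum_roughDivisors_moebiusTransform hf (ha i hi).1,
          ← Finset.sum_filter_add_sum_filter_not (roughDivisors y (a i)) (fun d : ℕ => (d : ℝ) ≤ D)]
        simp only [g, hμf]
        ring
      rw [hsplit]
      split_ifs with hiS
      · refine (Finset.abs_sum_le_sum_abs _ _).trans ?_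
        calc ∑ d ∈ (roughDivisors y (a i)).filter (fun d : ℕ => ¬ (d : ℝ) ≤ D), |μf d|
            ≤ ∑ d ∈ (roughDivisors y (a i)).filter (fun d : ℕ => ¬ (d : ℝ) ≤ D), (2 : ℝ) ^ k := by
              refine Finset.sum_le_sum fun d hd => ?_
              have hd' := mem_roughDivisors.mp (Finset.mem_filter.mp hd).1
              have hda := Nat.le_of_dvd (ha i hi).1 hd'.1.1
              exact hμ d (Nat.pos_of_dvd_of_pos hd'.1.1 (ha i hi).1) hd'.2
                ((Nat.cast_le.mpr hda).trans (ha i hi).2)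
          _ ≤ (2 : ℝ) ^ k * 2 ^ k := by
              rw [Finset.sum_const, nsmul_eq_mul]
              refine mul_le_mul_of_nonneg_right ?_ (by positivity)
              exact_mod_cast (Finset.card_filter_le _ _).trans
                (card_roughDivisors_le hy k (ha i hi).1 ((ha i hi).2.trans hxy))
          _ = 4 ^ k := by rw [← mul_pow]; norm_num
      · rw [Finset.filter_false_of_mem, Finset.sum_empty, abs_zero]
        intro d hd hdD
        exact hiS (Finset.mem_filter.mpr ⟨hi, d, hd, not_le.mp hdD⟩)
    refine (Finset.abs_sum_le_sum_abs _ _).trans ((Finset.sum_le_sum hpt).trans ?_)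
    rw [← Finset.sum_filter, Finset.sum_const, nsmul_eq_mul, mul_comm]
    refine mul_le_mul_of_nonneg_left ?_ (by positivity)
    refine hbad _ (Finset.filter_subset _ _) fun i hi => ?_
    exact (Finset.mem_filter.mp (Finset.mem_filter.mp hi).2).2
  have e2 : ∑ i ∈ A, g i = ∑ d ∈ R, μf d * ((A.filter fun i => d ∣ a i).card : ℝ) := by
    have e3 : ∀ i ∈ A, g i = ∑ d ∈ R, if d ∣ a i then μf d else 0 := fun i hi => by
      rw [← Finset.sum_filter]
      refine Finset.sum_congr ?_ fun _ _ => rfl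
      ext d
      simp only [R, Finset.mem_filter, mem_roughDivisors, Finset.mem_Icc, Nat.le_floor_iff hD]
      constructor
      · rintro ⟨⟨⟨h1, _⟩, h2⟩, h3⟩
        exact ⟨⟨⟨Nat.pos_of_dvd_of_pos h1 (ha i hi).1, h3⟩, h2⟩, h1⟩
      · rintro ⟨⟨⟨_, h3⟩, h2⟩, h1⟩
        exact ⟨⟨⟨h1, (ha i hi).1.ne'⟩, h2⟩, h3⟩
    rw [Finset.sum_congr rfl e3, Finset.sum_comm]
    refine Finset.sum_congr rfl fun d _ => ?_
    rw [← Finset.sum_filter, Finset.sum_const, nsmul_eq_mul, mul_comm]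
  have e4 : |∑ i ∈ A, g i - A.card * roughMean μf W y D| ≤ 2 ^ k * (η * A.card) := by
    have e5 : ∑ i ∈ A, g i - A.card * roughMean μf W y D =
        ∑ d ∈ R, μf d * (((A.filter fun i => d ∣ a i).card : ℝ) - W d * A.card) := by
      rw [e2, roughMean, Finset.mul_sum, ← Finset.sum_sub_distrib]
      exact Finset.sum_congr rfl fun d _ => by ring
    rw [e5]
    refine (Finset.abs_sum_le_sum_abs _ _).trans ?_
    calc ∑ d ∈ R, |μf d * (((A.filter fun i => d ∣ a i).card : ℝ) - W d * A.card)|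
        ≤ ∑ d ∈ R, 2 ^ k * |((A.filter fun i => d ∣ a i).card : ℝ) - W d * A.card| := by
          refine Finset.sum_le_sum fun d hd => ?_
          rw [abs_mul]
          have hd' := Finset.mem_filter.mp hd
          rw [Finset.mem_Icc, Nat.le_floor_iff hD] at hd'
          exact mul_le_mul_of_nonneg_right (hμ d hd'.1.1 hd'.2 (hd'.1.2.trans hDx)) (abs_nonneg _)
      _ ≤ ∑ d ∈ Finset.Icc 1 ⌊D⌋₊,
            2 ^ k * |((A.filter fun i => d ∣ a i).card : ℝ) - W d * A.card| :=
          Finset.sum_le_sum_of_subset_of_nonneg (Finset.filter_subset _ _)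
            fun _ _ _ => by positivity
      _ = 2 ^ k * ∑ d ∈ Finset.Icc 1 ⌊D⌋₊,
            |((A.filter fun i => d ∣ a i).card : ℝ) - W d * A.card| := by rw [Finset.mul_sum]
      _ ≤ _ := mul_le_mul_of_nonneg_left h (by positivity)
  have e6 := abs_add_le (∑ i ∈ A, f (a i) - ∑ i ∈ A, g i) (∑ i ∈ A, g i - A.card * roughMean μf W y D)
  rw [sub_add_sub_cancel] at e6
  linarith

/-- A large rough divisor leaves no room for medium-sized prime factors. -/
theorem not_dvd_of_large_rough_divisor {x y ε c : ℝ} {n d q : ℕ} (hx : 0 < x)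
    (hxc : x ^ c ≤ y) (hn : 0 < n) (hnx : (n : ℝ) ≤ x) (hd : d ∈ roughDivisors y n)
    (hdD : x ^ (1 - ε) < d) (hq : q.Prime) (hqε : x ^ ε < q) (hqc : (q : ℝ) ≤ x ^ c) : ¬ q ∣ n := by
  intro hqn
  obtain ⟨⟨⟨m, rfl⟩, _⟩, hr⟩ := mem_roughDivisors.mp hd
  rcases (Nat.Prime.dvd_mul hq).mp hqn with h | h
  · exact absurd (hr q hq h) (not_lt.mpr (hqc.trans hxc))
  · have hm : 0 < m := Nat.pos_of_mul_pos_left hn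
    have h1 : (q : ℝ) ≤ m := by exact_mod_cast Nat.le_of_dvd hm h
    have h2 : (d : ℝ) * m ≤ x := by exact_mod_cast hnx
    have h3 : x ^ (1 - ε) * x ^ ε < d * m :=
      mul_lt_mul hdD (by linarith) (by positivity) (by positivity)
    rw [← Real.rpow_add hx, sub_add_cancel, Real.rpow_one] at h3
    linarith

theorem levelBound_integers {x D η : ℝ} (hη : D ≤ η * ⌊x⌋₊) (hD : 0 ≤ D) :
    LevelBound (Finset.Icc 1 ⌊x⌋₊) id (fun d => 1 / (d : ℝ)) D η := by
  rw [LevelBound, Nat.card_Icc, Nat.add_sub_cancel]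
  refine le_trans ?_ hη
  calc _ ≤ ∑ d ∈ Finset.Icc 1 ⌊D⌋₊, (1 : ℝ) := by
        refine Finset.sum_le_sum fun d hd => ?_
        have hd0 : (0 : ℝ) < d := by exact_mod_cast (Finset.mem_Icc.mp hd).1
        have h1 : ((Finset.Icc 1 ⌊x⌋₊).filter fun i => d ∣ id i).card = ⌊x⌋₊ / d :=
          Nat.Ioc_filter_dvd_card_eq_div ⌊x⌋₊ d
        rw [h1, one_div_mul_eq_div]
        have h2 : ((⌊x⌋₊ / d : ℕ) : ℝ) ≤ ⌊x⌋₊ / d := Nat.cast_div_le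
        have h3 : (⌊x⌋₊ : ℝ) / d < (⌊x⌋₊ / d : ℕ) + 1 := by
          rw [div_lt_iff₀ hd0]
          exact_mod_cast Nat.lt_mul_of_div_lt (Nat.lt_succ_self _) (Finset.mem_Icc.mp hd).1
        rw [abs_le]
        constructor <;> linarith
    _ = ⌊D⌋₊ := by simp
    _ ≤ D := Nat.floor_le hD

theorem levelBound_shifted_primes {x ε η : ℝ}
    (h : ∑ d ∈ Finset.Icc 1 ⌊x ^ (1 - ε)⌋₊,
      |(primePiOne x d : ℝ) - (primePi x : ℝ) / (Nat.totient d : ℝ)| ≤ η * primePi x) :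
    LevelBound (primesUpTo x) (fun p => p - 1) (fun d => 1 / (d.totient : ℝ)) (x ^ (1 - ε)) η := by
  rw [LevelBound, card_primesUpTo]
  refine le_trans (le_of_eq (Finset.sum_congr rfl fun d _ => ?_)) h
  have h1 : (primesUpTo x).filter (fun p => d ∣ p - 1) =
      (Finset.Icc 1 ⌊x⌋₊).filter (fun p => p.Prime ∧ p ≡ 1 [MOD d]) := by
    rw [primesUpTo, Finset.filter_filter]
    refine Finset.filter_congr fun p hp => and_congr_right fun hpp => ?_
    rw [Nat.ModEq.comm, Nat.modEq_iff_dvd' hpp.one_le]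
  rw [h1, primePiOne, one_div_mul_eq_div]

/-- The densities `1 / φ(d)` and `1 / d` of the shifted primes and of the integers nearly agree for
rough `d`, and so do the corresponding means. -/
theorem abs_roughMean_sub_le {h : ℕ → ℝ} {x y D : ℝ} {k : ℕ} (hy : 1 < y) (hky : 2 * (k : ℝ) ≤ y)
    (hD : 1 ≤ D) (hDx : D ≤ x) (hxy : x ≤ y ^ k)
    (hh : ∀ d, 0 < d → IsRough y d → (d : ℝ) ≤ x → |h d| ≤ 2 ^ k) :
    |roughMean h (fun d => 1 / (d.totient : ℝ)) y D - roughMean h (fun d => 1 / (d : ℝ)) y D| ≤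
      2 ^ k * (2 * k / y) * (1 + k * Real.log y) := by
  classical
  have hy0 : 0 < y := by linarith
  rw [roughMean, roughMean, ← Finset.sum_sub_distrib]
  refine (Finset.abs_sum_le_sum_abs _ _).trans ?_
  have hk2 : (k : ℝ) / y ≤ 1 / 2 := by rw [div_le_iff₀ hy0]; linarith
  have hber : 1 - k / y ≤ (1 - 1 / y) ^ k := by
    have h1 : 1 / y ≤ 1 := by rw [div_le_one hy0]; exact hy.le
    have := one_add_mul_le_pow (a := -(1 / y)) (by linarith) k
    calc 1 - k / y = 1 + k * -(1 / y) := by ring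
      _ ≤ (1 + -(1 / y)) ^ k := this
      _ = _ := by rw [← sub_eq_add_neg]
  have hpt : ∀ d ∈ ((Finset.Icc 1 ⌊D⌋₊).filter fun d => IsRough y d),
      |h d * (1 / (d.totient : ℝ)) - h d * (1 / (d : ℝ))| ≤ 2 ^ k * (2 * k / y) * (d : ℝ)⁻¹ := by
    intro d hd
    rw [Finset.mem_filter, Finset.mem_Icc, Nat.le_floor_iff (by linarith)] at hd
    obtain ⟨⟨hd1, hdD⟩, hr⟩ := hd
    have hd0 : (0 : ℝ) < d := by exact_mod_cast hd1
    have hφ0 : (0 : ℝ) < d.totient := by exact_mod_cast Nat.totient_pos.mpr hd1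
    have hφ := hr.mul_pow_le_totient hy k hd1 ((hdD.trans hDx).trans hxy)
    have hφd : (d.totient : ℝ) ≤ d := by exact_mod_cast Nat.totient_le d
    have h1 : (d : ℝ) * (1 - k / y) ≤ d.totient :=
      (mul_le_mul_of_nonneg_left hber hd0.le).trans hφ
    rw [← mul_sub, abs_mul, mul_assoc]
    refine mul_le_mul (hh d hd1 hr (hdD.trans hDx)) ?_ (abs_nonneg _) (by positivity)
    rw [abs_of_nonneg (sub_nonneg.mpr (one_div_le_one_div_of_le hφ0 hφd)), sub_le_iff_le_add,
      div_le_iff₀ hφ0]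
    have hky0 : 0 ≤ (k : ℝ) / y := by positivity
    calc (1 : ℝ) ≤ (1 - k / y) * (1 + 2 * (k / y)) := by nlinarith
      _ = (d : ℝ)⁻¹ * (1 + 2 * (k / y)) * (d * (1 - k / y)) := by field_simp
      _ ≤ (d : ℝ)⁻¹ * (1 + 2 * (k / y)) * d.totient :=
          mul_le_mul_of_nonneg_left h1 (by positivity)
      _ = (2 * k / y * (d : ℝ)⁻¹ + 1 / d) * d.totient := by ring
  refine (Finset.sum_le_sum hpt).trans ?_
  rw [← Finset.mul_sum]
  refine mul_le_mul_of_nonneg_left ?_ (by positivity)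
  have h1 : ∑ d ∈ ((Finset.Icc 1 ⌊D⌋₊).filter fun d => IsRough y d), (d : ℝ)⁻¹ ≤
      ∑ d ∈ Finset.Icc 1 ⌊D⌋₊, (d : ℝ)⁻¹ :=
    Finset.sum_le_sum_of_subset_of_nonneg (Finset.filter_subset _ _) fun _ _ _ => by positivity
  have h2 : ∑ d ∈ Finset.Icc 1 ⌊D⌋₊, (d : ℝ)⁻¹ ≤ 1 + Real.log D := by
    have := harmonic_floor_le_one_add_log D hD
    rw [harmonic_eq_sum_Icc] at this
    push_cast at this
    exact this
  have h3 : Real.log D ≤ k * Real.log y := by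
    rw [← Real.log_pow]
    exact Real.log_le_log (by linarith) (hDx.trans hxy)
  linarith

theorem eventually_rpow_le_mul_floor {ε η : ℝ} (hε : 0 < ε) (hη : 0 < η) :
    ∀ᶠ x : ℝ in atTop, x ^ (1 - ε) ≤ η * ⌊x⌋₊ := by
  have h1 := (tendsto_rpow_neg_atTop hε).eventually_le_const (u := η / 2) (by linarith)
  filter_upwards [h1, eventually_ge_atTop 2] with x hx hx2
  have hx0 : 0 < x := by linarith
  have hfl : x / 2 ≤ ⌊x⌋₊ := by
    have := Nat.lt_floor_add_one x
    linarith
  calc x ^ (1 - ε) = x ^ (-ε) * x := by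
        rw [sub_eq_neg_add, Real.rpow_add hx0, Real.rpow_one]
    _ ≤ η / 2 * x := by gcongr
    _ = η * (x / 2) := by ring
    _ ≤ η * ⌊x⌋₊ := by gcongr

theorem tendsto_const_div_mul_log (a b k : ℝ) :
    Tendsto (fun y : ℝ => a * (b / y) * (1 + k * Real.log y)) atTop (𝓝 0) := by
  have h1 : Tendsto (fun y : ℝ => y⁻¹) atTop (𝓝 0) := tendsto_inv_atTop_zero
  have h2 : Tendsto (fun y : ℝ => Real.log y / y) atTop (𝓝 0) :=
    Real.isLittleO_log_id_atTop.tendsto_div_nhds_zero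
  have h3 := (h1.const_mul (a * b)).add (h2.const_mul (a * b * k))
  simp only [mul_zero, add_zero] at h3
  refine h3.congr fun y => ?_
  simp only [div_eq_mul_inv]
  ring

theorem abs_summatory_div_sub_div_floor_le {f : ℕ → ℝ} (hf0 : ∀ n, 0 ≤ f n) (hf1 : ∀ n, f n ≤ 1)
    {x : ℝ} (hx : 1 ≤ x) : |summatory f x / ⌊x⌋₊ - summatory f x / x| ≤ 1 / x := by
  have hN : (1 : ℝ) ≤ ⌊x⌋₊ := by exact_mod_cast Nat.le_floor (by simpa using hx)
  have hNx : (⌊x⌋₊ : ℝ) ≤ x := Nat.floor_le (by linarith)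
  have hxN := Nat.lt_floor_add_one x
  have hx0 : 0 < x := by linarith
  have hS0 : 0 ≤ summatory f x := Finset.sum_nonneg fun n _ => hf0 n
  have hS1 : summatory f x ≤ ⌊x⌋₊ := by
    calc summatory f x ≤ ∑ n ∈ Finset.Icc 1 ⌊x⌋₊, (1 : ℝ) := Finset.sum_le_sum fun n _ => hf1 n
      _ = ⌊x⌋₊ := by simp
  have h1 : summatory f x / ⌊x⌋₊ - summatory f x / x =
      (summatory f x / ⌊x⌋₊) * ((x - ⌊x⌋₊) / x) := by
    field_simp
  have h2 : summatory f x / ⌊x⌋₊ ≤ 1 := by rw [div_le_one (by linarith)]; exact hS1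
  rw [h1, abs_of_nonneg (by have : 0 ≤ x - ⌊x⌋₊ := by linarith
                            positivity)]
  calc _ ≤ 1 * ((x - ⌊x⌋₊) / x) := by
        refine mul_le_mul_of_nonneg_right h2 ?_
        have : 0 ≤ x - ⌊x⌋₊ := by linarith
        positivity
    _ ≤ 1 / x := by rw [one_mul]; gcongr; linarith

/-- **Transference.** Under the Elliott–Halberstam conjecture, a function of the `y`-rough part has
the same mean over the shifted primes `p - 1` as over the integers, for `x ≤ y ^ U`. -/
theorem exists_transference (hEH : WeakElliottHalberstam) {U η : ℝ} (hU : 1 ≤ U) (hη : 0 < η) :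
    ∃ Y : ℝ, 1 < Y ∧ ∀ y ≥ Y, ∀ x ∈ Icc y (y ^ U), ∀ f : ℕ → ℝ, (∀ n, 0 ≤ f n) → (∀ n, f n ≤ 1) →
      (∀ p n : ℕ, p.Prime → (p : ℝ) ≤ y → 0 < n → f (p * n) = f n) →
      |∑ p ∈ primesUpTo x, f (p - 1) - primePi x * (summatory f x / x)| ≤ η * primePi x := by
  set k := ⌈U⌉₊ with hk
  set C : ℝ := 2 ^ k + 4 ^ k * 6 with hC
  have hC0 : 0 < C := by positivity
  set η₀ := η / (4 * C) with hη₀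
  have hη₀0 : 0 < η₀ := by positivity
  have hCη : C * η₀ = η / 4 := by rw [hη₀]; field_simp
  set c := 1 / (4 * U) with hc
  have hU0 : 0 < U := by linarith
  have hc0 : 0 < c := by positivity
  have hc4 : c ≤ 1 / 4 := by
    rw [hc]; exact one_div_le_one_div_of_le (by norm_num) (by linarith)
  obtain ⟨ε, hε0, hε4, X, hX⟩ := exists_few_without_prime_factor hc0 hc4 hη₀0
  obtain ⟨X₁, hX₁⟩ := eventually_atTop.mp ((hEH ε hε0).bound hη₀0)
  obtain ⟨X₂, hX₂⟩ := eventually_atTop.mp (eventually_rpow_le_mul_floor hε0 hη₀0)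
  obtain ⟨Y₁, hY₁⟩ := eventually_atTop.mp
    ((tendsto_const_div_mul_log (2 ^ k) (2 * k) k).eventually_le_const
      (u := η / 4) (by linarith))
  refine ⟨max (max (max X X₁) (max X₂ Y₁)) (max (max 2 (4 / η)) (2 * k)),
    lt_max_of_lt_right (lt_max_of_lt_left (lt_max_of_lt_left (by norm_num))), ?_⟩
  intro y hy x hx f hf0 hf1 hf
  simp only [ge_iff_le, max_le_iff] at hy
  obtain ⟨⟨⟨hyX, hyX₁⟩, hyX₂, hyY₁⟩, ⟨hy2, hyη⟩, hyk⟩ := hy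
  obtain ⟨hyx, hxU⟩ := hx
  have hy0 : 0 < y := by linarith
  have hy1 : 1 ≤ y := by linarith
  have hx0 : 0 < x := by linarith
  have hx1 : 1 ≤ x := by linarith
  have hxk : x ≤ y ^ k := by
    refine hxU.trans ?_
    rw [← Real.rpow_natCast]
    exact Real.rpow_le_rpow_of_exponent_le hy1 (Nat.le_ceil U)
  have hxc : x ^ c ≤ y := by
    calc x ^ c ≤ (y ^ U) ^ c := Real.rpow_le_rpow hx0.le hxU hc0.le
      _ = y ^ (1 / 4 : ℝ) := by
        rw [← Real.rpow_mul hy0.le, hc]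
        congr 1
        field_simp
      _ ≤ y ^ (1 : ℝ) := Real.rpow_le_rpow_of_exponent_le hy1 (by norm_num)
      _ = y := Real.rpow_one y
  set D := x ^ (1 - ε) with hD
  have hD1 : 1 ≤ D := Real.one_le_rpow hx1 (by linarith)
  have hDx : D ≤ x := by
    calc D ≤ x ^ (1 : ℝ) := Real.rpow_le_rpow_of_exponent_le hx1 (by linarith)
      _ = x := Real.rpow_one x
  set N : ℝ := (⌊x⌋₊ : ℝ) with hN
  have hN1 : 1 ≤ N := by
    rw [hN]; exact_mod_cast Nat.le_floor (by simpa using hx1)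
  -- the two level-of-distribution statements
  have hlevN : LevelBound (Finset.Icc 1 ⌊x⌋₊) id (fun d => 1 / (d : ℝ)) D η₀ :=
    levelBound_integers (hX₂ x (hyX₂.trans hyx)) (by linarith)
  have hlevP : LevelBound (primesUpTo x) (fun p => p - 1) (fun d => 1 / (d.totient : ℝ)) D η₀ := by
    refine levelBound_shifted_primes ?_
    have := hX₁ x (hyX₁.trans hyx)
    rw [Real.norm_of_nonneg (Finset.sum_nonneg fun _ _ => abs_nonneg _),
      Real.norm_of_nonneg (Nat.cast_nonneg _)] at this
    exact this
  -- the means along both sequences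
  have haN : ∀ i ∈ Finset.Icc 1 ⌊x⌋₊, 0 < id i ∧ ((id i : ℕ) : ℝ) ≤ x := fun i hi =>
    ⟨(Finset.mem_Icc.mp hi).1, (Nat.le_floor_iff hx0.le).mp (Finset.mem_Icc.mp hi).2⟩
  have haP : ∀ p ∈ primesUpTo x, 0 < p - 1 ∧ ((p - 1 : ℕ) : ℝ) ≤ x := fun p hp => by
    rw [mem_primesUpTo hx0.le] at hp
    refine ⟨Nat.sub_pos_of_lt hp.1.one_lt, le_trans ?_ hp.2⟩
    exact_mod_cast Nat.sub_le p 1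
  have hbad : ∀ (A : Finset ℕ) (a : ℕ → ℕ) (W : ℕ → ℝ), (∀ d, 0 ≤ W d) →
      (∀ q r : ℕ, q.Prime → r.Prime → q ≠ r → W (q * r) = W q * W r) →
      (∀ q : ℕ, q.Prime → 1 / (q : ℝ) ≤ W q) → LevelBound A a W D η₀ →
      (∀ i ∈ A, 0 < a i ∧ (a i : ℝ) ≤ x) →
      ∀ S ⊆ A, (∀ i ∈ S, ∃ d ∈ roughDivisors y (a i), D < d) →
        (S.card : ℝ) ≤ 6 * η₀ * A.card := by
    intro A a W hW0 hWm hWq hlev ha S hSA hS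
    refine hX x (hyX.trans hyx) A a W hW0 hWm hWq hlev S hSA fun i hi q hq hqε hqc => ?_
    obtain ⟨d, hd, hdD⟩ := hS i hi
    exact not_dvd_of_large_rough_divisor hx0 hxc (ha i (hSA hi)).1 (ha i (hSA hi)).2 hd hdD hq hqε hqc
  have hmN := hlevN.abs_sum_sub_roughMean_le hy1 (by linarith) hDx hxk haN
    (hbad _ _ _ (fun d => by positivity) (fun q r _ _ _ => by push_cast; rw [one_div_mul_one_div])
      (fun q _ => le_rfl) hlevN haN) hf0 hf1 hf
  have hmP := hlevP.abs_sum_sub_roughMean_le hy1 (by linarith) hDx hxk haP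
    (hbad _ _ _ (fun d => by positivity)
      (fun q r hq hr hqr => by
        rw [Nat.totient_mul ((Nat.coprime_primes hq hr).mpr hqr)]
        push_cast
        rw [one_div_mul_one_div])
      (fun q hq => one_div_le_one_div_of_le (by exact_mod_cast Nat.totient_pos.mpr hq.pos)
        (by exact_mod_cast Nat.totient_le q)) hlevP haP) hf0 hf1 hf
  have hR := abs_roughMean_sub_le (h := moebiusTransform f) (x := x) (y := y) (D := D) (k := k)
    (by linarith) hyk hD1 hDx hxk fun d hd hr hdx => by
      refine (abs_moebiusTransform_le hf0 hf1 d).trans ?_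
      exact_mod_cast hr.card_divisors_le hy1 k hd (hdx.trans hxk)
  have hRδ := hR.trans (hY₁ y hyY₁)
  have hfl := abs_summatory_div_sub_div_floor_le hf0 hf1 hx1
  have hxη : 1 / x ≤ η / 4 := by
    rw [div_le_iff₀ hx0]
    rw [div_le_iff₀ hη] at hyη
    nlinarith
  set R₁ := roughMean (moebiusTransform f) (fun d => 1 / (d.totient : ℝ)) y D
  set R₂ := roughMean (moebiusTransform f) (fun d => 1 / (d : ℝ)) y D
  rw [card_primesUpTo] at hmP
  have hCC : 2 ^ k * η₀ + 4 ^ k * (6 * η₀) = η / 4 := by rw [← hCη, hC]; ring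
  rw [hCC] at hmN hmP
  rw [Nat.card_Icc, Nat.add_sub_cancel] at hmN
  have hmN' : |summatory f x / N - R₂| ≤ η / 4 := by
    have e : summatory f x / N - R₂ = (summatory f x - N * R₂) / N := by
      field_simp
    rw [e, abs_div, abs_of_pos (by linarith : 0 < N), div_le_iff₀ (by linarith)]
    exact hmN
  have hmean : |R₁ - summatory f x / x| ≤ 3 * (η / 4) := by
    have h1 := hfl.trans hxη
    rw [abs_le] at hRδ h1 hmN' ⊢
    constructor <;> linarith [hRδ.1, hRδ.2, h1.1, h1.2, hmN'.1, hmN'.2]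
  set P : ℝ := (primePi x : ℝ) with hP
  have hP0 : 0 ≤ P := Nat.cast_nonneg _
  have hfin : |P * R₁ - P * (summatory f x / x)| ≤ 3 * (η / 4) * P := by
    rw [← mul_sub, abs_mul, abs_of_nonneg hP0, mul_comm]
    exact mul_le_mul_of_nonneg_right hmean hP0
  have := abs_add_le (∑ p ∈ primesUpTo x, f (p - 1) - P * R₁) (P * R₁ - P * (summatory f x / x))
  rw [sub_add_sub_cancel] at this
  linarith

/-! ### Prime factors of iterated totients -/

/-- `n` is `y`-smooth: all its prime factors are at most `y`. -/
def IsSmooth (y : ℝ) (n : ℕ) : Prop := ∀ p : ℕ, p.Prime → p ∣ n → (p : ℝ) ≤ y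

theorem phiIter_succ (k n : ℕ) : phiIter (k + 1) n = (phiIter k n).totient :=
  Function.iterate_succ_apply' _ _ _

theorem phiIter_succ' (k n : ℕ) : phiIter (k + 1) n = phiIter k n.totient :=
  Function.iterate_succ_apply _ _ _

theorem phiIter_pos (k : ℕ) {n : ℕ} (hn : 0 < n) : 0 < phiIter k n := by
  induction k with
  | zero => exact hn
  | succ k ih => rw [phiIter_succ]; exact Nat.totient_pos.mpr ih

theorem phiIter_le (k n : ℕ) : phiIter k n ≤ n := by
  induction k with
  | zero => exact le_rfl
  | succ k ih => rw [phiIter_succ]; exact (Nat.totient_le _).trans ih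

theorem phiIter_dvd (k : ℕ) {m n : ℕ} (h : m ∣ n) : phiIter k m ∣ phiIter k n := by
  induction k with
  | zero => exact h
  | succ k ih => rw [phiIter_succ, phiIter_succ]; exact Nat.totient_dvd_of_dvd ih

theorem IsSmooth.of_dvd {y : ℝ} {m n : ℕ} (h : IsSmooth y n) (hmn : m ∣ n) : IsSmooth y m :=
  fun p hp hpm => h p hp (hpm.trans hmn)

theorem IsSmooth.mul {y : ℝ} {m n : ℕ} (hm : IsSmooth y m) (hn : IsSmooth y n) : IsSmooth y (m * n) :=
  fun p hp hpmn => ((Nat.Prime.dvd_mul hp).mp hpmn).elim (hm p hp) (hn p hp)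

theorem isSmooth_of_le {y : ℝ} {n : ℕ} (hn : 0 < n) (h : (n : ℝ) ≤ y) : IsSmooth y n :=
  fun _ _ hpn => (Nat.cast_le.mpr (Nat.le_of_dvd hn hpn)).trans h

/-- A smooth factor of the argument contributes a smooth factor to the totient. -/
theorem IsSmooth.exists_totient_mul {y : ℝ} {s : ℕ} (hs : 0 < s) (h : IsSmooth y s) (n : ℕ) :
    ∃ t, 0 < t ∧ IsSmooth y t ∧ (s * n).totient = t * n.totient := by
  induction s using induction_on_primes with
  | zero => exact absurd hs (lt_irrefl 0)
  | one => exact ⟨1, one_pos, h, by simp⟩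
  | prime_mul p s hp ih =>
    obtain ⟨t, ht0, ht, e⟩ := ih (Nat.pos_of_mul_pos_left hs) (h.of_dvd (Dvd.intro_left _ rfl))
    have hpy : (p : ℝ) ≤ y := h p hp (Dvd.intro _ rfl)
    rw [mul_assoc]
    by_cases hd : p ∣ s * n
    · refine ⟨p * t, Nat.mul_pos hp.pos ht0, (isSmooth_of_le hp.pos hpy).mul ht, ?_⟩
      rw [Nat.totient_mul_of_prime_of_dvd hp hd, e, mul_assoc]
    · refine ⟨(p - 1) * t, Nat.mul_pos (Nat.sub_pos_of_lt hp.one_lt) ht0,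
        (isSmooth_of_le (Nat.sub_pos_of_lt hp.one_lt) (le_trans ?_ hpy)).mul ht, ?_⟩
      · exact_mod_cast Nat.sub_le p 1
      · rw [Nat.totient_mul_of_prime_of_not_dvd hp hd, e, mul_assoc]

theorem IsSmooth.exists_phiIter_mul {y : ℝ} {s : ℕ} (hs : 0 < s) (h : IsSmooth y s) (k n : ℕ) :
    ∃ t, 0 < t ∧ IsSmooth y t ∧ phiIter k (s * n) = t * phiIter k n := by
  induction k with
  | zero => exact ⟨s, hs, h, rfl⟩
  | succ k ih =>
    obtain ⟨t, ht0, ht, e⟩ := ih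
    obtain ⟨t', ht0', ht', e'⟩ := ht.exists_totient_mul ht0 (phiIter k n)
    exact ⟨t', ht0', ht', by rw [phiIter_succ, e, e', ← phiIter_succ]⟩

/-- Whether `φ_k(n)` is `y`-smooth depends only on the `y`-rough part of `n`. -/
theorem isSmooth_phiIter_mul_iff {y : ℝ} {p : ℕ} (hp : p.Prime) (hpy : (p : ℝ) ≤ y) (k n : ℕ) :
    IsSmooth y (phiIter k (p * n)) ↔ IsSmooth y (phiIter k n) := by
  obtain ⟨t, -, ht, e⟩ := (isSmooth_of_le hp.pos hpy).exists_phiIter_mul hp.pos k n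
  rw [e]
  exact ⟨fun h => h.of_dvd (Dvd.intro_left _ rfl), fun h => ht.mul h⟩

theorem sq_dvd_or_exists_prime_of_dvd_totient {q m : ℕ} (hq : q.Prime) (hm : 0 < m)
    (h : q ∣ m.totient) : q ^ 2 ∣ m ∨ ∃ p, p.Prime ∧ p ∣ m ∧ q ∣ p - 1 := by
  induction m using induction_on_primes with
  | zero => exact absurd hm (lt_irrefl 0)
  | one => simp at h; exact absurd h hq.ne_one
  | prime_mul p m hp ih =>
    have hm' : 0 < m := Nat.pos_of_mul_pos_left hm
    have hrec : q ∣ m.totient → q ^ 2 ∣ p * m ∨ ∃ r, r.Prime ∧ r ∣ p * m ∧ q ∣ r - 1 := fun h => by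
      rcases ih hm' h with h | ⟨r, hr, hrm, hqr⟩
      · exact Or.inl (h.mul_left p)
      · exact Or.inr ⟨r, hr, hrm.mul_left p, hqr⟩
    by_cases hd : p ∣ m
    · rw [Nat.totient_mul_of_prime_of_dvd hp hd] at h
      rcases (Nat.Prime.dvd_mul hq).mp h with h | h
      · rw [(Nat.prime_dvd_prime_iff_eq hq hp).mp h, sq]
        exact Or.inl (mul_dvd_mul_left p hd)
      · exact hrec h
    · rw [Nat.totient_mul_of_prime_of_not_dvd hp hd] at h
      rcases (Nat.Prime.dvd_mul hq).mp h with h | h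
      · exact Or.inr ⟨p, hp, Dvd.intro _ rfl, h⟩
      · exact hrec h

/-- In the absence of squares of large primes, a large prime factor of `φ_k(n)` comes from a single
prime factor of `n`. -/
theorem exists_prime_of_dvd_phiIter {y : ℝ} {n : ℕ} (hn : 0 < n) (k : ℕ)
    (hsq : ∀ i < k, ∀ q : ℕ, q.Prime → y < q → ¬ q ^ 2 ∣ phiIter i n) {q : ℕ} (hq : q.Prime)
    (hqy : y < q) (h : q ∣ phiIter k n) : ∃ p, p.Prime ∧ p ∣ n ∧ q ∣ phiIter k p := by
  induction k generalizing q with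
  | zero => exact ⟨q, hq, h, dvd_rfl⟩
  | succ k ih =>
    rw [phiIter_succ] at h
    rcases sq_dvd_or_exists_prime_of_dvd_totient hq (phiIter_pos k hn) h with h | ⟨r, hr, hrn, hqr⟩
    · exact absurd h (hsq k (Nat.lt_succ_self k) q hq hqy)
    · have hlt : q < r := by
        have := Nat.le_of_dvd (Nat.sub_pos_of_lt hr.one_lt) hqr
        have := hr.pos
        omega
      obtain ⟨p, hp, hpn, hrp⟩ := ih (fun i hi => hsq i (Nat.lt_succ_of_lt hi)) hr
        (hqy.trans (Nat.cast_lt.mpr hlt)) hrn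
      refine ⟨p, hp, hpn, ?_⟩
      rw [phiIter_succ]
      refine dvd_trans ?_ (Nat.totient_dvd_of_dvd hrp)
      rwa [Nat.totient_prime hr]

theorem isSmooth_phiIter_iff {y : ℝ} {n : ℕ} (hn : 0 < n) (k : ℕ)
    (hsq : ∀ i < k, ∀ q : ℕ, q.Prime → y < q → ¬ q ^ 2 ∣ phiIter i n) :
    IsSmooth y (phiIter k n) ↔ ∀ p, p.Prime → p ∣ n → IsSmooth y (phiIter k p) := by
  refine ⟨fun h p _ hpn => h.of_dvd (phiIter_dvd k hpn), fun h q hq hqn => ?_⟩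
  by_contra! hqy
  obtain ⟨p, hp, hpn, hqp⟩ := exists_prime_of_dvd_phiIter hn k hsq hq hqy hqn
  exact absurd (h p hp hpn q hq hqp) (not_le.mpr hqy)

/-! ### Squares of large primes dividing iterated totients -/

/-- `p` is a prime through which a prime factor `q` of `φ(m)` can arise from `p ∣ m`. -/
def IsLinked (q p : ℕ) : Prop := p.Prime ∧ (p = q ∨ q ∣ p - 1)

theorem exists_isLinked_of_dvd_totient {q m : ℕ} (hq : q.Prime) (hm : 0 < m) (h : q ∣ m.totient) :
    ∃ p, IsLinked q p ∧ p ∣ m := by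
  rcases sq_dvd_or_exists_prime_of_dvd_totient hq hm h with h | ⟨p, hp, hpm, hqp⟩
  · exact ⟨q, ⟨hq, Or.inl rfl⟩, (dvd_pow_self q two_ne_zero).trans h⟩
  · exact ⟨p, ⟨hp, Or.inr hqp⟩, hpm⟩

theorem mul_dvd_mul_cases {q r a b : ℕ} (hq : q.Prime) (hr : r.Prime) (h : q * r ∣ a * b) :
    q * r ∣ a ∨ q * r ∣ b ∨ (q ∣ a ∧ r ∣ b) ∨ (r ∣ a ∧ q ∣ b) := by
  rcases (Nat.Prime.dvd_mul hq).mp ((Dvd.intro _ rfl).trans h) with ⟨a', rfl⟩ | ⟨b', rfl⟩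
  · rw [mul_assoc] at h
    rcases (Nat.Prime.dvd_mul hr).mp (Nat.dvd_of_mul_dvd_mul_left hq.pos h) with h | h
    · exact Or.inl (mul_dvd_mul_left q h)
    · exact Or.inr (Or.inr (Or.inl ⟨Dvd.intro _ rfl, h⟩))
  · rw [mul_left_comm] at h
    rcases (Nat.Prime.dvd_mul hr).mp (Nat.dvd_of_mul_dvd_mul_left hq.pos h) with h | h
    · exact Or.inr (Or.inr (Or.inr ⟨h, Dvd.intro _ rfl⟩))
    · exact Or.inr (Or.inl (mul_dvd_mul_left q h))

/-- The sources of a divisor `q r` of `φ(m)`, where `q = r` is allowed. -/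
theorem mul_dvd_totient_cases {q r m : ℕ} (hq : q.Prime) (hr : r.Prime) (hm : 0 < m)
    (h : q * r ∣ m.totient) : (∃ p, p.Prime ∧ p ∣ m ∧ q * r ∣ p - 1) ∨
      ∃ a b, IsLinked q a ∧ IsLinked r b ∧ a * b ∣ m := by
  induction m using induction_on_primes with
  | zero => exact absurd hm (lt_irrefl 0)
  | one =>
    simp only [Nat.totient_one, Nat.dvd_one, mul_eq_one] at h
    exact absurd h.1 hq.ne_one
  | prime_mul p m hp ih =>
    have hm' : 0 < m := Nat.pos_of_mul_pos_left hm
    have key : ∀ c, (∀ s : ℕ, s.Prime → s ∣ c → IsLinked s p) → (q * r ∣ c → q * r ∣ p - 1) →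
        q * r ∣ c * m.totient → (∃ t, t.Prime ∧ t ∣ p * m ∧ q * r ∣ t - 1) ∨
          ∃ a b, IsLinked q a ∧ IsLinked r b ∧ a * b ∣ p * m := by
      intro c hc hc2 hdvd
      rcases mul_dvd_mul_cases hq hr hdvd with h | h | ⟨h1, h2⟩ | ⟨h1, h2⟩
      · exact Or.inl ⟨p, hp, Dvd.intro _ rfl, hc2 h⟩
      · rcases ih hm' h with ⟨t, ht, htm, h⟩ | ⟨a, b, ha, hb, hab⟩
        · exact Or.inl ⟨t, ht, htm.mul_left p, h⟩
        · exact Or.inr ⟨a, b, ha, hb, hab.mul_left p⟩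
      · obtain ⟨b, hb, hbm⟩ := exists_isLinked_of_dvd_totient hr hm' h2
        exact Or.inr ⟨p, b, hc q hq h1, hb, mul_dvd_mul_left p hbm⟩
      · obtain ⟨a, ha, ham⟩ := exists_isLinked_of_dvd_totient hq hm' h2
        refine Or.inr ⟨a, p, ha, hc r hr h1, ?_⟩
        rw [mul_comm]
        exact mul_dvd_mul_left p ham
    by_cases hd : p ∣ m
    · rw [Nat.totient_mul_of_prime_of_dvd hp hd] at h
      refine key p (fun s hs hsp => ⟨hp, Or.inl ?_⟩) (fun hqr => ?_) h
      · exact ((Nat.prime_dvd_prime_iff_eq hs hp).mp hsp).symm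
      · rcases (Nat.dvd_prime hp).mp hqr with h1 | h1
        · exact absurd (mul_eq_one.mp h1).1 hq.ne_one
        · exact absurd (h1 ▸ hp) (Nat.not_prime_mul hq.ne_one hr.ne_one)
    · rw [Nat.totient_mul_of_prime_of_not_dvd hp hd] at h
      exact key (p - 1) (fun s hs hsp => ⟨hp, Or.inr hsp⟩) id h

theorem sum_inv_primes_dvd_sub_one_le {d : ℕ} (hd : 0 < d) (N : ℕ) :
    ∑ p ∈ (Finset.Icc 1 N).filter (fun p => p.Prime ∧ d ∣ p - 1), (1 : ℝ) / p ≤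
      (1 + Real.log N) / d := by
  have hd0 : (0 : ℝ) < d := by exact_mod_cast hd
  have hsub : (Finset.Icc 1 N).filter (fun p => p.Prime ∧ d ∣ p - 1) ⊆
      (Finset.Icc 1 N).image fun i => 1 + d * i := by
    intro p hp
    rw [Finset.mem_filter, Finset.mem_Icc] at hp
    obtain ⟨⟨h1, h2⟩, hpp, i, hi⟩ := hp
    have h3 := hpp.one_lt
    have hi0 : 0 < i := Nat.pos_of_ne_zero fun h => by rw [h, mul_zero] at hi; omega
    have hid : i ≤ d * i := Nat.le_mul_of_pos_left i hd
    exact Finset.mem_image.mpr ⟨i, Finset.mem_Icc.mpr ⟨hi0, by omega⟩, by omega⟩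
  calc _ ≤ ∑ p ∈ (Finset.Icc 1 N).image fun i => 1 + d * i, (1 : ℝ) / p :=
        Finset.sum_le_sum_of_subset_of_nonneg hsub fun _ _ _ => by positivity
    _ = ∑ i ∈ Finset.Icc 1 N, (1 : ℝ) / ((1 + d * i : ℕ) : ℝ) := by
        refine Finset.sum_image fun i _ j _ hij => ?_
        exact Nat.eq_of_mul_eq_mul_left hd (Nat.add_left_cancel hij)
    _ ≤ ∑ i ∈ Finset.Icc 1 N, (1 / (d : ℝ)) * (i : ℝ)⁻¹ := by
        refine Finset.sum_le_sum fun i hi => ?_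
        have hi0 : (0 : ℝ) < i := by exact_mod_cast (Finset.mem_Icc.mp hi).1
        rw [← one_div, one_div_mul_one_div]
        push_cast
        exact one_div_le_one_div_of_le (by positivity) (by linarith)
    _ = (1 / (d : ℝ)) * ∑ i ∈ Finset.Icc 1 N, (i : ℝ)⁻¹ := by rw [Finset.mul_sum]
    _ ≤ (1 / (d : ℝ)) * (1 + Real.log N) := by
        refine mul_le_mul_of_nonneg_left ?_ (by positivity)
        have := harmonic_le_one_add_log N
        rw [harmonic_eq_sum_Icc] at this
        push_cast at this
        exact this
    _ = _ := by ring

open Classical in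
/-- The primes up to `N` linked to `q`. -/
noncomputable def linkedPrimes (N q : ℕ) : Finset ℕ := (Finset.Icc 1 N).filter fun p => IsLinked q p

theorem mem_linkedPrimes {N q p : ℕ} : p ∈ linkedPrimes N q ↔ p ≤ N ∧ IsLinked q p := by
  classical
  simp only [linkedPrimes, Finset.mem_filter, Finset.mem_Icc]
  exact ⟨fun h => ⟨h.1.2, h.2⟩, fun h => ⟨⟨h.2.1.pos, h.1⟩, h.2⟩⟩

theorem sum_inv_linkedPrimes_le {q : ℕ} (hq : q.Prime) (N : ℕ) :
    ∑ p ∈ linkedPrimes N q, (1 : ℝ) / p ≤ (2 + Real.log N) / q := by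
  have hsub : linkedPrimes N q ⊆
      {q} ∪ (Finset.Icc 1 N).filter (fun p => p.Prime ∧ q ∣ p - 1) := by
    intro p hp
    obtain ⟨hpN, hpp, h⟩ := mem_linkedPrimes.mp hp
    rw [Finset.mem_union, Finset.mem_singleton, Finset.mem_filter, Finset.mem_Icc]
    exact h.imp id fun h => ⟨⟨hpp.pos, hpN⟩, hpp, h⟩
  calc _ ≤ ∑ p ∈ {q} ∪ (Finset.Icc 1 N).filter (fun p => p.Prime ∧ q ∣ p - 1), (1 : ℝ) / p :=
        Finset.sum_le_sum_of_subset_of_nonneg hsub fun _ _ _ => by positivity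
    _ ≤ ∑ p ∈ {q}, (1 : ℝ) / p +
        ∑ p ∈ (Finset.Icc 1 N).filter (fun p => p.Prime ∧ q ∣ p - 1), (1 : ℝ) / p := by
        rw [← Finset.sum_union_inter]
        exact le_add_of_nonneg_right (Finset.sum_nonneg fun _ _ => by positivity)
    _ ≤ 1 / q + (1 + Real.log N) / q := by
        rw [Finset.sum_singleton]
        exact add_le_add_right (sum_inv_primes_dvd_sub_one_le hq.pos N) _
    _ = _ := by ring

/-- The number of `n ≤ N` with `d ∣ φ_k(n)`. -/
def dvdCount (N k d : ℕ) : ℕ := ((Finset.Icc 1 N).filter fun n => d ∣ phiIter k n).card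

theorem dvdCount_zero_le (N d : ℕ) : (dvdCount N 0 d : ℝ) ≤ N / d := by
  have h1 : dvdCount N 0 d = N / d := Nat.Ioc_filter_dvd_card_eq_div N d
  rw [h1]
  exact Nat.cast_div_le

/-- By induction on `k`: a prime factor `q` of `φ(m)` comes from a prime factor of `m` linked to
`q`. -/
theorem dvdCount_prime_le (N k : ℕ) {q : ℕ} (hq : q.Prime) :
    (dvdCount N k q : ℝ) ≤ N * (2 + Real.log N) ^ k / q := by
  have hL : 0 ≤ 2 + Real.log N := by have := Real.log_natCast_nonneg N; linarith
  induction k generalizing q with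
  | zero => simpa using dvdCount_zero_le N q
  | succ k ih =>
    have hsub : ((Finset.Icc 1 N).filter fun n => q ∣ phiIter (k + 1) n) ⊆
        (linkedPrimes N q).biUnion fun p => (Finset.Icc 1 N).filter fun n => p ∣ phiIter k n := by
      intro n hn
      obtain ⟨hn1, hqn⟩ := Finset.mem_filter.mp hn
      have hn0 := (Finset.mem_Icc.mp hn1).1
      rw [phiIter_succ] at hqn
      obtain ⟨p, hp, hpn⟩ := exists_isLinked_of_dvd_totient hq (phiIter_pos k hn0) hqn
      refine Finset.mem_biUnion.mpr ⟨p, mem_linkedPrimes.mpr ⟨?_, hp⟩, Finset.mem_filter.mpr ⟨hn1, hpn⟩⟩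
      exact (Nat.le_of_dvd (phiIter_pos k hn0) hpn).trans
        ((phiIter_le k n).trans (Finset.mem_Icc.mp hn1).2)
    have hcard : (dvdCount N (k + 1) q : ℝ) ≤ ∑ p ∈ linkedPrimes N q, (dvdCount N k p : ℝ) := by
      exact_mod_cast (Finset.card_le_card hsub).trans Finset.card_biUnion_le
    calc _ ≤ ∑ p ∈ linkedPrimes N q, (dvdCount N k p : ℝ) := hcard
      _ ≤ ∑ p ∈ linkedPrimes N q, N * (2 + Real.log N) ^ k * (1 / (p : ℝ)) :=
          Finset.sum_le_sum fun p hp =>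
            (ih (mem_linkedPrimes.mp hp).2.1).trans (le_of_eq (by rw [mul_one_div]))
      _ = N * (2 + Real.log N) ^ k * ∑ p ∈ linkedPrimes N q, 1 / (p : ℝ) := by rw [Finset.mul_sum]
      _ ≤ N * (2 + Real.log N) ^ k * ((2 + Real.log N) / q) :=
          mul_le_mul_of_nonneg_left (sum_inv_linkedPrimes_le hq N) (by positivity)
      _ = _ := by rw [pow_succ]; ring

/-- By induction on `k`: a divisor `q r` of `φ(m)` comes from one prime factor `p ≡ 1` modulo `q r` of
`m`, or from a divisor `a b` of `m` with `a` linked to `q` and `b` linked to `r`. -/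
theorem dvdCount_mul_le (N k : ℕ) {q r : ℕ} (hq : q.Prime) (hr : r.Prime) :
    (dvdCount N k (q * r) : ℝ) ≤ N * (2 * (2 + Real.log N)) ^ (2 * k) / (q * r) := by
  set L := 2 + Real.log N with hLdef
  have hL : 1 ≤ L := by have := Real.log_natCast_nonneg N; linarith
  induction k generalizing q r with
  | zero => simpa using dvdCount_zero_le N (q * r)
  | succ k ih =>
    set P := (Finset.Icc 1 N).filter (fun p => p.Prime ∧ q * r ∣ p - 1)
    have hsub : ((Finset.Icc 1 N).filter fun n => q * r ∣ phiIter (k + 1) n) ⊆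
        (P.biUnion fun p => (Finset.Icc 1 N).filter fun n => p ∣ phiIter k n) ∪
        ((linkedPrimes N q ×ˢ linkedPrimes N r).biUnion fun z =>
          (Finset.Icc 1 N).filter fun n => z.1 * z.2 ∣ phiIter k n) := by
      intro n hn
      obtain ⟨hn1, hqn⟩ := Finset.mem_filter.mp hn
      have hn0 := (Finset.mem_Icc.mp hn1).1
      have hle : ∀ d, d ∣ phiIter k n → d ≤ N := fun d hd =>
        (Nat.le_of_dvd (phiIter_pos k hn0) hd).trans
          ((phiIter_le k n).trans (Finset.mem_Icc.mp hn1).2)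
      rw [phiIter_succ] at hqn
      rw [Finset.mem_union, Finset.mem_biUnion, Finset.mem_biUnion]
      rcases mul_dvd_totient_cases hq hr (phiIter_pos k hn0) hqn with ⟨p, hp, hpn, h⟩ | ⟨a, b, ha, hb, h⟩
      · exact Or.inl ⟨p, Finset.mem_filter.mpr ⟨Finset.mem_Icc.mpr ⟨hp.pos, hle p hpn⟩, hp, h⟩,
          Finset.mem_filter.mpr ⟨hn1, hpn⟩⟩
      · exact Or.inr ⟨(a, b), Finset.mem_product.mpr
          ⟨mem_linkedPrimes.mpr ⟨hle a ((Dvd.intro _ rfl).trans h), ha⟩,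
            mem_linkedPrimes.mpr ⟨hle b ((Dvd.intro_left _ rfl).trans h), hb⟩⟩,
          Finset.mem_filter.mpr ⟨hn1, h⟩⟩
    have hcard : (dvdCount N (k + 1) (q * r) : ℝ) ≤ ∑ p ∈ P, (dvdCount N k p : ℝ) +
        ∑ z ∈ linkedPrimes N q ×ˢ linkedPrimes N r, (dvdCount N k (z.1 * z.2) : ℝ) := by
      exact_mod_cast (Finset.card_le_card hsub).trans ((Finset.card_union_le _ _).trans
        (add_le_add Finset.card_biUnion_le Finset.card_biUnion_le))
    have hq0 : (0 : ℝ) < q := by exact_mod_cast hq.pos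
    have hr0 : (0 : ℝ) < r := by exact_mod_cast hr.pos
    have h1 : ∑ p ∈ P, (dvdCount N k p : ℝ) ≤ N * L ^ k * (L / (q * r)) := by
      calc _ ≤ ∑ p ∈ P, N * L ^ k * (1 / (p : ℝ)) :=
            Finset.sum_le_sum fun p hp =>
              (dvdCount_prime_le N k (Finset.mem_filter.mp hp).2.1).trans
                (le_of_eq (by rw [mul_one_div]))
        _ = N * L ^ k * ∑ p ∈ P, 1 / (p : ℝ) := by rw [Finset.mul_sum]
        _ ≤ N * L ^ k * ((1 + Real.log N) / ((q * r : ℕ) : ℝ)) :=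
            mul_le_mul_of_nonneg_left
              (sum_inv_primes_dvd_sub_one_le (Nat.mul_pos hq.pos hr.pos) N) (by positivity)
        _ ≤ N * L ^ k * (L / (q * r)) := by
            push_cast
            gcongr
            linarith
    have h2 : ∑ z ∈ linkedPrimes N q ×ˢ linkedPrimes N r, (dvdCount N k (z.1 * z.2) : ℝ) ≤
        N * (2 * L) ^ (2 * k) * ((L / q) * (L / r)) := by
      calc _ ≤ ∑ z ∈ linkedPrimes N q ×ˢ linkedPrimes N r,
            N * (2 * L) ^ (2 * k) * (1 / (z.1 : ℝ) * (1 / (z.2 : ℝ))) := by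
            refine Finset.sum_le_sum fun z hz => ?_
            obtain ⟨hz1, hz2⟩ := Finset.mem_product.mp hz
            refine (ih (mem_linkedPrimes.mp hz1).2.1 (mem_linkedPrimes.mp hz2).2.1).trans (le_of_eq ?_)
            rw [one_div_mul_one_div, mul_one_div]
        _ = N * (2 * L) ^ (2 * k) *
            ((∑ a ∈ linkedPrimes N q, 1 / (a : ℝ)) * ∑ b ∈ linkedPrimes N r, 1 / (b : ℝ)) := by
            rw [← Finset.mul_sum, Finset.sum_mul_sum, Finset.sum_product]
        _ ≤ _ := by
            refine mul_le_mul_of_nonneg_left ?_ (by positivity)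
            exact mul_le_mul (sum_inv_linkedPrimes_le hq N) (sum_inv_linkedPrimes_le hr N)
              (Finset.sum_nonneg fun _ _ => by positivity) (by positivity)
    have h3 : L ^ (k + 1) ≤ 3 * (2 * L) ^ (2 * k) * L ^ 2 := by
      have e1 : L ^ (k + 1) ≤ L ^ (2 * k + 2) := pow_le_pow_right₀ hL (by omega)
      have e2 : L ^ (2 * k) ≤ (2 * L) ^ (2 * k) := pow_le_pow_left₀ (by linarith) (by linarith) _
      have e3 : L ^ (2 * k + 2) ≤ (2 * L) ^ (2 * k) * L ^ 2 := by
        rw [pow_add]; exact mul_le_mul_of_nonneg_right e2 (by positivity)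
      have e4 : 0 ≤ (2 * L) ^ (2 * k) * L ^ 2 := by positivity
      linarith
    calc _ ≤ N * L ^ k * (L / (q * r)) + N * (2 * L) ^ (2 * k) * ((L / q) * (L / r)) := by linarith
      _ = N / (q * r) * (L ^ (k + 1) + (2 * L) ^ (2 * k) * L ^ 2) := by field_simp; ring
      _ ≤ N / (q * r) * (4 * (2 * L) ^ (2 * k) * L ^ 2) := by
          refine mul_le_mul_of_nonneg_left ?_ (by positivity)
          linarith
      _ = _ := by rw [show 2 * (k + 1) = 2 * k + 2 by ring, pow_add]; ring

/-- The `n ≤ N` for which some `φ_i(n)`, `i < k`, is divisible by the square of a prime exceeding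
`y`. -/
theorem card_sq_dvd_phiIter_le {y : ℝ} (hy : 0 < y) (N k : ℕ) (S : Finset ℕ)
    (hS : ∀ n ∈ S, n ∈ Finset.Icc 1 N ∧ ∃ i < k, ∃ q : ℕ, q.Prime ∧ y < q ∧ q ^ 2 ∣ phiIter i n) :
    (S.card : ℝ) ≤ N * (k * (2 * (2 + Real.log N)) ^ (2 * k) * (2 / y)) := by
  set L := 2 + Real.log N with hLdef
  have hL : 1 ≤ L := by have := Real.log_natCast_nonneg N; linarith
  let Q := (Finset.Ioo ⌊y⌋₊ (N + 1)).filter Nat.Prime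
  have hsub : S ⊆ (Finset.range k ×ˢ Q).biUnion fun z =>
      (Finset.Icc 1 N).filter fun n => z.2 * z.2 ∣ phiIter z.1 n := by
    intro n hn
    obtain ⟨hnN, i, hi, q, hq, hyq, hdvd⟩ := hS n hn
    have hn0 := (Finset.mem_Icc.mp hnN).1
    have hqN : q ≤ N := (Nat.le_of_dvd (phiIter_pos i hn0)
      ((dvd_pow_self q two_ne_zero).trans hdvd)).trans
        ((phiIter_le i n).trans (Finset.mem_Icc.mp hnN).2)
    refine Finset.mem_biUnion.mpr ⟨(i, q), Finset.mem_product.mpr ⟨Finset.mem_range.mpr hi,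
      Finset.mem_filter.mpr ⟨Finset.mem_Ioo.mpr ⟨(Nat.floor_lt hy.le).mpr hyq, by omega⟩, hq⟩⟩,
      Finset.mem_filter.mpr ⟨hnN, ?_⟩⟩
    rwa [← sq]
  have hcard : (S.card : ℝ) ≤ ∑ z ∈ Finset.range k ×ˢ Q, (dvdCount N z.1 (z.2 * z.2) : ℝ) := by
    exact_mod_cast (Finset.card_le_card hsub).trans Finset.card_biUnion_le
  have hsum : ∑ q ∈ Q, ((q : ℝ) ^ 2)⁻¹ ≤ 2 / y := by
    calc _ ≤ ∑ q ∈ Finset.Ioo ⌊y⌋₊ (N + 1), ((q : ℝ) ^ 2)⁻¹ :=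
          Finset.sum_le_sum_of_subset_of_nonneg (Finset.filter_subset _ _) fun _ _ _ => by positivity
      _ ≤ 2 / (⌊y⌋₊ + 1) := sum_Ioo_inv_sq_le _ _
      _ ≤ 2 / y := by gcongr; exact (Nat.lt_floor_add_one y).le
  calc _ ≤ ∑ z ∈ Finset.range k ×ˢ Q, (dvdCount N z.1 (z.2 * z.2) : ℝ) := hcard
    _ ≤ ∑ z ∈ Finset.range k ×ˢ Q, N * (2 * L) ^ (2 * k) * ((z.2 : ℝ) ^ 2)⁻¹ := by
        refine Finset.sum_le_sum fun z hz => ?_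
        obtain ⟨hz1, hz2⟩ := Finset.mem_product.mp hz
        have hzp := (Finset.mem_filter.mp hz2).2
        have hzk := Finset.mem_range.mp hz1
        refine (dvdCount_mul_le N z.1 hzp hzp).trans ?_
        rw [← sq, div_eq_mul_inv]
        have : (2 * L) ^ (2 * z.1) ≤ (2 * L) ^ (2 * k) :=
          pow_le_pow_right₀ (by linarith) (by omega)
        gcongr
    _ = N * (k * (2 * L) ^ (2 * k) * ∑ q ∈ Q, ((q : ℝ) ^ 2)⁻¹) := by
        rw [Finset.sum_product]
        simp only [← Finset.mul_sum, Finset.sum_const, Finset.card_range, nsmul_eq_mul]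
        ring
    _ ≤ _ := by gcongr

/-! ### Smooth iterated totients and completely multiplicative functions -/

open Classical in
/-- The indicator function of the `n` for which `φ_k(n)` is `y`-smooth. -/
noncomputable def smoothIndicator (y : ℝ) (k n : ℕ) : ℝ := if IsSmooth y (phiIter k n) then 1 else 0

open Classical in
/-- The completely multiplicative indicator function of the `n` all of whose prime factors `p` have
`y`-smooth `φ_k(p)`; its value at `0` is `1`. -/
noncomputable def primewiseIndicator (y : ℝ) (k n : ℕ) : ℝ :=
  if n = 0 ∨ ∀ p : ℕ, p.Prime → p ∣ n → IsSmooth y (phiIter k p) then 1 else 0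

theorem smoothIndicator_nonneg (y : ℝ) (k n : ℕ) : 0 ≤ smoothIndicator y k n := by
  rw [smoothIndicator]; split_ifs <;> norm_num

theorem smoothIndicator_le_one (y : ℝ) (k n : ℕ) : smoothIndicator y k n ≤ 1 := by
  rw [smoothIndicator]; split_ifs <;> norm_num

theorem primewiseIndicator_nonneg (y : ℝ) (k n : ℕ) : 0 ≤ primewiseIndicator y k n := by
  rw [primewiseIndicator]; split_ifs <;> norm_num

theorem primewiseIndicator_le_one (y : ℝ) (k n : ℕ) : primewiseIndicator y k n ≤ 1 := by
  rw [primewiseIndicator]; split_ifs <;> norm_num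

theorem smoothIndicator_mul {y : ℝ} (k : ℕ) {p : ℕ} (n : ℕ) (hp : p.Prime) (hpy : (p : ℝ) ≤ y) :
    smoothIndicator y k (p * n) = smoothIndicator y k n := by
  classical
  rw [smoothIndicator, smoothIndicator]
  exact if_congr (isSmooth_phiIter_mul_iff hp hpy k n) rfl rfl

theorem primewiseIndicator_mul (y : ℝ) (k : ℕ) {m n : ℕ} (hm : 0 < m) (hn : 0 < n) :
    primewiseIndicator y k (m * n) = primewiseIndicator y k m * primewiseIndicator y k n := by
  classical
  have hiff : (∀ p : ℕ, p.Prime → p ∣ m * n → IsSmooth y (phiIter k p)) ↔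
      (∀ p : ℕ, p.Prime → p ∣ m → IsSmooth y (phiIter k p)) ∧
        ∀ p : ℕ, p.Prime → p ∣ n → IsSmooth y (phiIter k p) := by
    refine ⟨fun h => ⟨fun p hp hpm => h p hp (hpm.mul_right n), fun p hp hpn => h p hp (hpn.mul_left m)⟩,
      fun h p hp hpmn => ?_⟩
    exact ((Nat.Prime.dvd_mul hp).mp hpmn).elim (h.1 p hp) (h.2 p hp)
  rw [primewiseIndicator, primewiseIndicator, primewiseIndicator]
  by_cases h1 : ∀ p : ℕ, p.Prime → p ∣ m → IsSmooth y (phiIter k p)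
  · by_cases h2 : ∀ p : ℕ, p.Prime → p ∣ n → IsSmooth y (phiIter k p)
    · rw [if_pos (Or.inr (hiff.mpr ⟨h1, h2⟩)), if_pos (Or.inr h1), if_pos (Or.inr h2), one_mul]
    · rw [if_neg fun h => h2 (hiff.mp (h.resolve_left (Nat.mul_pos hm hn).ne')).2,
        if_pos (Or.inr h1), if_neg fun h => h2 (h.resolve_left hn.ne'), mul_zero]
  · rw [if_neg fun h => h1 (hiff.mp (h.resolve_left (Nat.mul_pos hm hn).ne')).1,
      if_neg fun h => h1 (h.resolve_left hm.ne'), zero_mul]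

theorem primewiseIndicator_prime (y : ℝ) (k : ℕ) {p : ℕ} (hp : p.Prime) :
    primewiseIndicator y k p = smoothIndicator y k p := by
  classical
  rw [primewiseIndicator, smoothIndicator]
  refine if_congr ⟨fun h => ?_, fun h => Or.inr fun q hq hqp => ?_⟩ rfl rfl
  · exact h.resolve_left hp.ne_zero p hp dvd_rfl
  · rwa [(Nat.prime_dvd_prime_iff_eq hq hp).mp hqp]

theorem primewiseIndicator_of_le {y : ℝ} (k : ℕ) {n : ℕ} (hn : (n : ℝ) ≤ y) :
    primewiseIndicator y k n = 1 := by
  rw [primewiseIndicator, if_pos]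
  rcases Nat.eq_zero_or_pos n with h0 | h0
  · exact Or.inl h0
  · refine Or.inr fun p hp hpn => isSmooth_of_le (phiIter_pos k hp.pos) (le_trans ?_ hn)
    exact_mod_cast (phiIter_le k p).trans (Nat.le_of_dvd h0 hpn)

theorem summatory_smoothIndicator (x y : ℝ) (k : ℕ) :
    summatory (smoothIndicator y k) x = PhiCount k x y := by
  classical
  rw [summatory, PhiCount]
  simp only [smoothIndicator]
  rw [Finset.sum_boole]
  congr!

theorem tendsto_mul_log_pow_div (U : ℝ) (hU : 1 ≤ U) (k : ℕ) :
    Tendsto (fun y : ℝ => k * (2 * (2 + U * Real.log y)) ^ (2 * k) * (2 / y)) atTop (𝓝 0) := by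
  have h1 : Tendsto (fun y : ℝ => Real.log y ^ (2 * k) / y) atTop (𝓝 0) :=
    (Real.isLittleO_pow_log_id_atTop (n := 2 * k)).tendsto_div_nhds_zero
  have h2 := h1.const_mul (k * (6 * U) ^ (2 * k) * 2)
  rw [mul_zero] at h2
  refine squeeze_zero' ?_ ?_ h2
  · filter_upwards [eventually_ge_atTop 1] with y hy
    have := Real.log_nonneg hy
    positivity
  · filter_upwards [eventually_ge_atTop (Real.exp 1)] with y hy
    have hy0 : 0 < y := (Real.exp_pos 1).trans_le hy
    have hl : 1 ≤ Real.log y := by rwa [Real.le_log_iff_exp_le hy0]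
    have h3 : 2 * (2 + U * Real.log y) ≤ 6 * U * Real.log y := by nlinarith
    calc _ ≤ k * (6 * U * Real.log y) ^ (2 * k) * (2 / y) := by gcongr
      _ = _ := by rw [mul_pow]; ring

/-- For almost all `n`, the iterated totient `φ_k(n)` is smooth if and only if `φ_k(p)` is smooth for
all primes `p ∣ n`. -/
theorem exists_abs_summatory_sub_le {U η : ℝ} (hU : 1 ≤ U) (hη : 0 < η) (k : ℕ) :
    ∃ Y : ℝ, 1 < Y ∧ ∀ y ≥ Y, ∀ x ∈ Icc (1 : ℝ) (y ^ U),
      |summatory (smoothIndicator y k) x - summatory (primewiseIndicator y k) x| ≤ η * x := by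
  classical
  obtain ⟨Y, hY⟩ := eventually_atTop.mp ((tendsto_mul_log_pow_div U hU k).eventually_le_const hη)
  refine ⟨max 2 Y, lt_max_of_lt_left (by norm_num), fun y hy x hx => ?_⟩
  have hy2 : 2 ≤ y := (le_max_left _ _).trans hy
  have hy0 : 0 < y := by linarith
  have hx0 : 0 < x := by linarith [hx.1]
  set N := ⌊x⌋₊ with hN
  have hN1 : 1 ≤ N := Nat.le_floor (by simpa using hx.1)
  have hNx : (N : ℝ) ≤ x := Nat.floor_le hx0.le
  have hN0 : (0 : ℝ) < N := by exact_mod_cast hN1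
  have hlogN : Real.log N ≤ U * Real.log y := by
    rw [← Real.log_rpow hy0]
    exact Real.log_le_log hN0 (hNx.trans hx.2)
  have hlogN0 := Real.log_natCast_nonneg N
  let S := (Finset.Icc 1 N).filter
    fun n => ∃ i < k, ∃ q : ℕ, q.Prime ∧ y < q ∧ q ^ 2 ∣ phiIter i n
  have hS := card_sq_dvd_phiIter_le hy0 N k S fun n hn => Finset.mem_filter.mp hn
  have hpt : ∀ n ∈ Finset.Icc 1 N, |smoothIndicator y k n - primewiseIndicator y k n| ≤
      if n ∈ S then 1 else 0 := by
    intro n hn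
    have hn0 := (Finset.mem_Icc.mp hn).1
    split_ifs with h
    · rw [abs_le]
      constructor <;> linarith [smoothIndicator_nonneg y k n, smoothIndicator_le_one y k n,
        primewiseIndicator_nonneg y k n, primewiseIndicator_le_one y k n]
    · have hsq : ∀ i < k, ∀ q : ℕ, q.Prime → y < q → ¬ q ^ 2 ∣ phiIter i n :=
        fun i hi q hq hyq hdvd => h (Finset.mem_filter.mpr ⟨hn, i, hi, q, hq, hyq, hdvd⟩)
      have e : smoothIndicator y k n = primewiseIndicator y k n := by
        rw [smoothIndicator, primewiseIndicator]
        refine if_congr ?_ rfl rfl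
        rw [isSmooth_phiIter_iff hn0 k hsq]
        simp [Nat.pos_iff_ne_zero.mp hn0]
      rw [e, sub_self, abs_zero]
  rw [summatory, summatory, ← Finset.sum_sub_distrib]
  calc _ ≤ ∑ n ∈ Finset.Icc 1 N, |smoothIndicator y k n - primewiseIndicator y k n| :=
        Finset.abs_sum_le_sum_abs _ _
    _ ≤ ∑ n ∈ Finset.Icc 1 N, if n ∈ S then (1 : ℝ) else 0 := Finset.sum_le_sum hpt
    _ = S.card := by
        rw [← Finset.sum_filter, Finset.sum_const, nsmul_eq_mul, mul_one]
        congr 2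
        exact Finset.filter_mem_eq_inter.trans
          (Finset.inter_eq_right.mpr (Finset.filter_subset _ _))
    _ ≤ N * (k * (2 * (2 + Real.log N)) ^ (2 * k) * (2 / y)) := hS
    _ ≤ N * (k * (2 * (2 + U * Real.log y)) ^ (2 * k) * (2 / y)) := by gcongr
    _ ≤ N * η := by gcongr; exact hY y ((le_max_right _ _).trans hy)
    _ ≤ η * x := by rw [mul_comm]; gcongr

/-! ### The distribution of smooth iterated totients -/

/-- If the weights of the primes `p` with smooth `φ_k(p)` are distributed as the kernel of the delay
equation for `σ_k`, then `Φ_k(x, y)` is asymptotic to `x σ_k(log x / log y)`. -/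
theorem DelayPair.exists_abs_phiCount_sub_le {χ σ : ℝ → ℝ} (h : DelayPair χ σ) (k : ℕ)
    (hcdf : ∀ U η : ℝ, 1 ≤ U → 0 < η → ∃ Y : ℝ, 1 < Y ∧ ∀ y ≥ Y,
      CdfClose χ (primewiseIndicator y k) y U η) {U η : ℝ} (hU : 1 ≤ U) (hη : 0 < η) :
    ∃ Y : ℝ, 1 < Y ∧ ∀ y ≥ Y, ∀ x ∈ Icc y (y ^ U),
      |(PhiCount k x y : ℝ) - x * σ (Real.log x / Real.log y)| ≤ η * x := by
  obtain ⟨η₁, hη₁, Y₁, hY₁, H₁⟩ := h.exists_mean_value hU (ε := η / 3) (by linarith)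
  obtain ⟨Y₂, hY₂, H₂⟩ := hcdf U η₁ hU hη₁
  obtain ⟨Y₃, hY₃, H₃⟩ := exists_abs_summatory_sub_le hU (η := η / 3) (by linarith) k
  refine ⟨max (max Y₁ Y₂) (max Y₃ (3 / η)), lt_max_of_lt_left (lt_max_of_lt_left hY₁), ?_⟩
  intro y hy x hx
  simp only [ge_iff_le, max_le_iff] at hy
  obtain ⟨⟨hy1, hy2⟩, hy3, hy4⟩ := hy
  have hx1 : x ∈ Icc 1 (y ^ U) := ⟨by linarith [hx.1], hx.2⟩
  have hx0 : 0 < x := by linarith [hx1.1]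
  have h1 := H₁ y hy1 (primewiseIndicator y k) (fun m n hm hn => primewiseIndicator_mul y k hm hn)
    (primewiseIndicator_nonneg y k) (primewiseIndicator_le_one y k)
    (fun n _ hn => primewiseIndicator_of_le k hn) (H₂ y hy2) x hx1
  have h2 := H₃ y hy3 x hx1
  rw [summatory_smoothIndicator] at h2
  have h3 : 1 / x ≤ η / 3 := by
    rw [div_le_iff₀ hx0]
    rw [div_le_iff₀ hη] at hy4
    nlinarith [hx.1]
  set M := summatory (primewiseIndicator y k) x
  set s := σ (Real.log x / Real.log y)
  have h4 : |M - x * s| ≤ 2 * (η / 3) * x := by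
    have e : M - x * s = x * (M / x - s) := by field_simp
    rw [e, abs_mul, abs_of_pos hx0, mul_comm]
    exact mul_le_mul_of_nonneg_right (by linarith) hx0.le
  have h5 := abs_add_le ((PhiCount k x y : ℝ) - M) (M - x * s)
  rw [sub_add_sub_cancel] at h5
  linarith

/-- By induction on `k`: the frequency of the primes with smooth `φ_{k+1}(p) = φ_k(p - 1)` is that of
the integers with smooth `φ_k(n)`, given by `σ_k`, which is the kernel of the delay equation for
`σ_{k+1}`. -/
theorem IsSigmaSequence.exists_abs_phiCount_sub_le (hEH : WeakElliottHalberstam)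
    {σ : ℕ → ℝ → ℝ} (hσ : IsSigmaSequence σ) (k : ℕ) {U η : ℝ} (hU : 1 ≤ U) (hη : 0 < η) :
    ∃ Y : ℝ, 1 < Y ∧ ∀ y ≥ Y, ∀ x ∈ Icc y (y ^ U),
      |(PhiCount k x y : ℝ) - x * extendLeft (σ k) (Real.log x / Real.log y)| ≤ η * x := by
  induction k generalizing U η with
  | zero =>
    refine (hσ.delayPair 0).exists_abs_phiCount_sub_le 0 (fun U η _ hη => ?_) hU hη
    obtain ⟨Y, hY, H⟩ := exists_cdfClose_indicator (U := U) hη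
    refine ⟨Y, hY, fun y hy => H y hy _ (primewiseIndicator_nonneg y 0)
      (primewiseIndicator_le_one y 0) (fun n hn => primewiseIndicator_of_le 0 hn) fun p hp hyp => ?_⟩
    rw [primewiseIndicator_prime y 0 hp, smoothIndicator, if_neg]
    exact fun h => absurd (h p hp dvd_rfl) (not_le.mpr hyp)
  | succ k ih =>
    refine (hσ.delayPair (k + 1)).exists_abs_phiCount_sub_le (k + 1) (fun U η hU hη => ?_) hU hη
    obtain ⟨η', hη', Y₁, hY₁, H₁⟩ := (hσ.delayPair k).exists_cdfClose hU hη
    obtain ⟨Y₂, hY₂, H₂⟩ := exists_transference hEH hU (η := η' / 2) (by linarith)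
    obtain ⟨Y₃, hY₃, H₃⟩ := ih hU (η := η' / 2) (by linarith)
    refine ⟨max Y₁ (max Y₂ Y₃), lt_max_of_lt_left hY₁, fun y hy => ?_⟩
    simp only [ge_iff_le, max_le_iff] at hy
    obtain ⟨hy1, hy2, hy3⟩ := hy
    refine H₁ y hy1 _ (primewiseIndicator_nonneg y _) (primewiseIndicator_le_one y _)
      (fun n hn => primewiseIndicator_of_le _ hn) fun s hs => ?_
    have hs0 : 0 < s := by linarith [hs.1]
    have h2 := H₂ y hy2 s hs (smoothIndicator y k) (smoothIndicator_nonneg y k)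
      (smoothIndicator_le_one y k) fun p n hp hpy _ => smoothIndicator_mul k n hp hpy
    have h3 := H₃ y hy3 s hs
    rw [← summatory_smoothIndicator] at h3
    have e1 : ∑ p ∈ primesUpTo s, primewiseIndicator y (k + 1) p =
        ∑ p ∈ primesUpTo s, smoothIndicator y k (p - 1) := by
      refine Finset.sum_congr rfl fun p hp => ?_
      have hpp := ((mem_primesUpTo hs0.le).mp hp).1
      rw [primewiseIndicator_prime y _ hpp, smoothIndicator, smoothIndicator, phiIter_succ',
        Nat.totient_prime hpp]
    rw [e1]
    set M := summatory (smoothIndicator y k) s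
    set r := extendLeft (σ k) (Real.log s / Real.log y)
    set P : ℝ := (primePi s : ℝ)
    have hP : 0 ≤ P := Nat.cast_nonneg _
    have h4 : |P * (M / s) - P * r| ≤ η' / 2 * P := by
      have e : P * (M / s) - P * r = P * ((M - s * r) / s) := by field_simp
      rw [e, abs_mul, abs_of_nonneg hP, mul_comm]
      refine mul_le_mul_of_nonneg_right ?_ hP
      rw [abs_div, abs_of_pos hs0, div_le_iff₀ hs0]
      exact h3
    have h5 := abs_add_le (∑ p ∈ primesUpTo s, smoothIndicator y k (p - 1) - P * (M / s))
      (P * (M / s) - P * r)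
    rw [sub_add_sub_cancel] at h5
    linarith

/-- On a bounded range of `u`, the positive function `σ_k` is bounded below, so that the absolute
error term may be replaced by a relative one. -/
theorem IsSigmaSequence.eventually_abs_phiCount_sub_le (hEH : WeakElliottHalberstam)
    {σ : ℕ → ℝ → ℝ} (hσ : IsSigmaSequence σ) {U : ℝ} (hU : 1 < U) (k : ℕ) {ε : ℝ} (hε : 0 < ε) :
    ∀ᶠ x : ℝ in atTop, ∀ u ∈ Icc (1 : ℝ) U,
      |(PhiCount k x (x ^ (1 / u)) : ℝ) - x * σ k u| ≤ ε * (x * σ k u) := by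
  have hd := hσ.delayPair k
  obtain ⟨u₀, -, hu₀⟩ := isCompact_Icc.exists_isMinOn (nonempty_Icc.mpr hU.le)
    hd.continuous.continuousOn
  set m := extendLeft (σ k) u₀
  have hm : 0 < m := hd.pos _
  obtain ⟨Y, hY, H⟩ := hσ.exists_abs_phiCount_sub_le hEH k hU.le (mul_pos hε hm)
  filter_upwards [eventually_ge_atTop (Y ^ U)] with x hx u hu
  have hu0 : 0 < u := by linarith [hu.1]
  have hU0 : 0 < U := by linarith
  have hY0 : 0 < Y := by linarith
  have hx1 : 1 < x := (Real.one_lt_rpow hY hU0).trans_le hx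
  have hx0 : 0 < x := by linarith
  set y := x ^ (1 / u) with hy
  have hyY : Y ≤ y := by
    calc Y = (Y ^ U) ^ (1 / U) := by
          rw [← Real.rpow_mul hY0.le, mul_one_div_cancel hU0.ne', Real.rpow_one]
      _ ≤ x ^ (1 / U) := Real.rpow_le_rpow (by positivity) hx (by positivity)
      _ ≤ y := Real.rpow_le_rpow_of_exponent_le hx1.le (one_div_le_one_div_of_le hu0 hu.2)
  have hy1 : 1 < y := by linarith
  have hyu : y ^ u = x := by
    rw [hy, ← Real.rpow_mul hx0.le, one_div_mul_cancel hu0.ne', Real.rpow_one]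
  have hlog : Real.log x / Real.log y = u := by
    rw [← hyu, Real.log_rpow (by linarith), mul_div_assoc, div_self (Real.log_pos hy1).ne', mul_one]
  have hmem : x ∈ Icc y (y ^ U) := by
    constructor
    · calc y = y ^ (1 : ℝ) := (Real.rpow_one y).symm
        _ ≤ y ^ u := Real.rpow_le_rpow_of_exponent_le hy1.le hu.1
        _ = x := hyu
    · rw [← hyu]
      exact Real.rpow_le_rpow_of_exponent_le hy1.le hu.2
  have h1 := H y hyY x hmem
  rw [hlog, extendLeft_of_nonneg _ hu0.le] at h1
  have h2 : m ≤ σ k u := by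
    have := hu₀ hu
    rwa [mem_ofPred_eq, extendLeft_of_nonneg (σ k) hu0.le] at this
  calc _ ≤ ε * m * x := h1
    _ ≤ ε * σ k u * x := by gcongr
    _ = _ := by ring

end IteratedTotient

theorem theorem2 (hEH : IteratedTotient.WeakElliottHalberstam) :
    -- the functions `σ_k` exist and are unique on `[0, ∞)`
    (∃ σ : ℕ → ℝ → ℝ, IteratedTotient.IsSigmaSequence σ) ∧
    (∀ σ τ : ℕ → ℝ → ℝ, IteratedTotient.IsSigmaSequence σ →
      IteratedTotient.IsSigmaSequence τ → ∀ k : ℕ, Set.EqOn (σ k) (τ k) (Set.Ici 0)) ∧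
    ∀ σ : ℕ → ℝ → ℝ, IteratedTotient.IsSigmaSequence σ →
      -- `Φ_k(x, x^(1/u)) ~ x σ_k(u)` as `x → ∞`, uniformly for `1 ≤ u ≤ U`
      (∀ U : ℝ, 1 < U → ∀ k : ℕ, ∀ ε : ℝ, 0 < ε → ∀ᶠ x : ℝ in atTop,
        ∀ u ∈ Set.Icc (1 : ℝ) U,
          |(IteratedTotient.PhiCount k x (x ^ (1 / u)) : ℝ) - x * σ k u| ≤ ε * (x * σ k u)) ∧
      -- `σ_0(u) = ((e + o(1)) / (u log u))^u` as `u → ∞`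
      (∃ δ : ℝ → ℝ, Tendsto δ atTop (𝓝 0) ∧ ∀ᶠ u : ℝ in atTop,
        σ 0 u = ((Real.exp 1 + δ u) / (u * Real.log u)) ^ u) ∧
      -- `σ_k(u) = ((1 + o(1)) / (log_k u · log_{k+1} u))^u` as `u → ∞`, for `k ≥ 1`
      (∀ k : ℕ, 1 ≤ k → ∃ δ : ℝ → ℝ, Tendsto δ atTop (𝓝 0) ∧ ∀ᶠ u : ℝ in atTop,
        σ k u = ((1 + δ u) /
          (IteratedTotient.logIter k u * IteratedTotient.logIter (k + 1) u)) ^ u) :=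
  ⟨IteratedTotient.exists_isSigmaSequence, fun _ _ hσ hτ k => hσ.eqOn hτ k, fun _ hσ =>
    ⟨fun _ hU k _ hε => hσ.eventually_abs_phiCount_sub_le hEH hU k hε, hσ.asymptotic_zero,
      fun _ hk => hσ.asymptotic_succ hk⟩⟩
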